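/- Let $M=\mathbb Z^n$ (row vectors) and $N=\mathbb Z^n$ (column vectors), paired by $\langle m,v\rangle=mv$. Let $v_1,\dots,v_k\in N$ be the primitive generators of the distinct rays of a strongly convex, full-dimensional cone $\sigma=\mathbb R_+v_1+\dots+\mathbb R_+v_k$, and let $R=R_\sigma=\mathbb C[\sigma^\vee\cap M]\subset\mathbb C[M]$. Let $U$ be an integer $n\times n$ matrix with $\det U\neq 0$ such that all $Uv_i$ are primitive. The group $G=\{\rho\in\mathrm{Hom}(M,\mathbb C^*)\mid \rho(m)=1 \text{ for all } m\in MU\}$ acts on $\mathbb C[M]$ by $x^m\mapsto\rho(m)x^m$, and on $R$. Choose representatives $m_1,\dots,m_g\in M$ of $M/MU$. Let $T=L_1\oplus\dots\oplus L_\ell$, where each $L_j$ is an $M$-graded reflexive $R$-submodule of $\mathbb C[M]$ of rank one. Then $G$ acts on $T$, and on $\mathrm{End}_R T$ by conjugation. Call an $R$-algebra $A$ an NCCR of a commutative ring $R$ if $A\cong\mathrm{End}_R(T')$ as $R$-algebras for a finitely generated reflexive $R$-module $T'$, and all simple $A$-modules have the same finite projective dimension. 1. The map $f\rho\mapsto (t\mapsto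 f(\rho t))$ is a ring isomorphism $\mathrm{End}_R T * G\to\mathrm{End}_{R^G}T$ from the skew group ring. 2. If $\mathrm{End}_R T$ is an NCCR of $R$, then $\mathrm{End}_{R^G}T$ is an NCCR of $R^G$. 3. The $Uv_i$ are the primitive generators of the distinct rays of the strongly convex full-dimensional cone $U\sigma$; there is an isomorphism of $\mathbb C$-algebras $R_{U\sigma}\cong R^G$, $x^m\mapsto x^{mU}$. The $R_{U\sigma}$-modules $L_{j,r}=\mathrm{Span}\{x^m\mid x^{m_r+mU}\in L_j\}$ are graded rank one reflexives over $R_{U\sigma}$, and the maps $x^m\mapsto x^{m_r+mU}$ give an isomorphism $\bigoplus_{j,r}L_{j,r}\cong T$ compatible with $R_{U\sigma}\cong R^G$. 4. Suppose the $L_j$ are pairwise nonisomorphic, and choose points $p_j\in M\otimes\mathbb R=\mathbb R^n$ with $p_i-p_j\notin M$ for $i\ne j$ and a set $\Gamma$ of monomial morphisms $x^m:L_i\to L_j$ that generates the $\mathbb C$-algebra $\mathrm{End}_RT$ together with the idempotents of the summands. The embedded quiver $Q$ for $\mathrm{End}_RT$ lies in the torus $(M\otimes\mathbb R)/M$; its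 vertices are the images of the $p_j$, and its arrows are the images of the straight paths from $p_i+m$ to $p_j$, one for each $x^m:L_i\to L_j$ in $\Gamma$. Let $\tilde Q\subset M\otimes\mathbb R$ be its universal cover, i.e. the pullback (all preimages of vertices and all lifts of arrows) along $M\otimes\mathbb R\to(M\otimes\mathbb R)/M$. Then the $L_{j,r}$ are pairwise nonisomorphic, the points $p_{j,r}=(p_j-m_r)U^{-1}$ are distinct modulo $M$, and there is a set $\Gamma'$ of monomial morphisms between the $L_{j,r}$ generating $\mathrm{End}_{R_{U\sigma}}(\bigoplus_{j,r} L_{j,r})\cong\mathrm{End}_{R^G}T$ in the same sense (and minimal with this property if $\Gamma$ is), such that the universal cover of the embedded quiver of $(L_{j,r},p_{j,r},\Gamma')$ is $\tilde Q\cdot U^{-1}$. 5. This is compatible with the standard choice of points. Let $\phi:\mathbb Z^k\to N$, $\phi(b)=\sum_i b_iv_i$, let $\kappa(b)=(\phi\phi^T)^{-1}\phi(b)\in M\otimes\mathbb R$, and let $\kappa_U$ be the same map for $Uv_1,\dots,Uv_k$. If $L_j=T(b)=\mathrm{Span}\{x^m\mid\langle m,v_i\rangle\ge b_i\ \forall i\}$,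 then $L_{j,r}=\mathrm{Span}\{x^m\mid\langle m,Uv_i\rangle\ge b_i-\langle m_r,v_i\rangle\ \forall i\}$ and $\kappa_U\big((b_i-\langle m_r,v_i\rangle)_i\big)=(\kappa(b)-m_r)U^{-1}$. -/

import Mathlib

open scoped Matrix

noncomputable section

namespace ToricQuotient

/-! ### Toric data

`M = ℤⁿ` (row vectors) and `N = ℤⁿ` (column vectors) are both written `Fin n → ℤ`; the pairing
`⟨m, v⟩` is the dot product `m ⬝ᵥ v`. -/

/-- A vector of `N` is primitive if it is not a non-unit integer multiple of a lattice vector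
(in particular it is nonzero). -/
def IsPrimitive {n : ℕ} (w : Fin n → ℤ) : Prop :=
  ∀ (c : ℤ) (u : Fin n → ℤ), w = c • u → IsUnit c

/-- The vectors `v₁, …, v_k` are the primitive generators of the (pairwise distinct) rays of a
strongly convex rational polyhedral cone `σ = ℝ₊v₁ + ⋯ + ℝ₊v_k` of full dimension `n`.
That `ℝ₊ vᵢ` is a face of `σ` is expressed by a supporting lattice vector `m ∈ σ^∨ ∩ M` that
vanishes on `vᵢ` and on no other generator. -/
structure IsConeGenerators {n k : ℕ} (v : Fin k → Fin n → ℤ) : Prop where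
  primitive : ∀ i, IsPrimitive (v i)
  ray : ∀ i, ∃ m : Fin n → ℤ, m ⬝ᵥ v i = 0 ∧ ∀ j, j ≠ i → 0 < m ⬝ᵥ v j
  full_dim : Submodule.span ℝ (Set.range fun i => (fun a => (v i a : ℝ))) = ⊤

/-- The Laurent polynomial ring `ℂ[M]`; the monomial `x^m` is `AddMonoidAlgebra.single m 1`. -/
abbrev Laurent (n : ℕ) : Type := AddMonoidAlgebra ℂ (Fin n → ℤ)

/-- The monomial `x^m`. -/
abbrev mono {n : ℕ} (m : Fin n → ℤ) : Laurent n := AddMonoidAlgebra.single m 1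

/-- The toric ring `R_σ = ℂ[σ^∨ ∩ M]`. -/
def toricRing {n k : ℕ} (v : Fin k → Fin n → ℤ) : Subalgebra ℂ (Laurent n) where
  carrier := {f | ∀ m ∈ f.coeff.support, ∀ i, 0 ≤ m ⬝ᵥ v i}
  mul_mem' := by
    intro f h hf hh m hm i
    classical
    obtain ⟨a, ha, b, hb, rfl⟩ :=
      Finset.mem_add.1 (AddMonoidAlgebra.support_coeff_mul_subset f h hm)
    rw [add_dotProduct]
    exact add_nonneg (hf a ha i) (hh b hb i)
  add_mem' := by
    intro f h hf hh m hm i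
    classical
    rcases Finset.mem_union.1 (Finsupp.support_add hm) with h1 | h1
    · exact hf m h1 i
    · exact hh m h1 i
  algebraMap_mem' := by
    intro r m hm i
    have h : m = 0 := by
      by_contra hne
      simp [AddMonoidAlgebra.coe_algebraMap, Ne.symm hne] at hm
    simp [h]

/-- An `M`-graded `R_σ`-submodule of `ℂ[M]`. -/
structure GradedSubmodule {n k : ℕ} (v : Fin k → Fin n → ℤ) where
  /-- the underlying submodule -/
  toSubmodule : Submodule (toricRing v) (Laurent n)
  homogeneous : ∀ f ∈ toSubmodule, ∀ m, AddMonoidAlgebra.single m (f.coeff m) ∈ toSubmodule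

/-- A graded submodule of `ℂ[M]` is a graded rank one reflexive if it has rank one and the
evaluation map to its double dual is bijective. -/
def GradedSubmodule.IsRankOneReflexive {n k : ℕ} {v : Fin k → Fin n → ℤ}
    (L : GradedSubmodule v) : Prop :=
  Module.IsReflexive (toricRing v) L.toSubmodule ∧ Module.rank (toricRing v) L.toSubmodule = 1

/-- The graded submodule spanned by the monomials `x^m`, `m ∈ S`, for a subset `S ⊆ M` that is
stable under addition of `σ^∨ ∩ M`. -/
def GradedSubmodule.ofSet {n k : ℕ} (v : Fin k → Fin n → ℤ) (S : Set (Fin n → ℤ))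
    (hS : ∀ a, (∀ i, 0 ≤ a ⬝ᵥ v i) → ∀ s ∈ S, a + s ∈ S) : GradedSubmodule v where
  toSubmodule :=
    { carrier := {f | ∀ m ∈ f.coeff.support, m ∈ S}
      zero_mem' := by intro m hm; simp at hm
      add_mem' := by
        intro f h hf hh m hm
        classical
        rcases Finset.mem_union.1 (Finsupp.support_add hm) with h1 | h1
        · exact hf m h1
        · exact hh m h1
      smul_mem' := by
        intro r f hf m hm
        classical
        obtain ⟨a, ha, b, hb, rfl⟩ :=
          Finset.mem_add.1 (AddMonoidAlgebra.support_coeff_mul_subset (r : Laurent n) f hm)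
        exact hS a (r.2 a ha) b (hf b hb) }
  homogeneous := by
    intro f hf m x hx
    by_cases h : m = x
    · subst h
      refine hf m ?_
      simpa using hx
    · simp [h] at hx

/-- `T(b) = Span {x^m : ⟨m, vᵢ⟩ ≥ bᵢ for all i}`. -/
def reflexiveOf {n k : ℕ} (v : Fin k → Fin n → ℤ) (b : Fin k → ℤ) : GradedSubmodule v :=
  GradedSubmodule.ofSet v {m | ∀ i, b i ≤ m ⬝ᵥ v i} (by
    intro a ha s hs i
    rw [add_dotProduct]
    linarith [ha i, hs i])

/-- The direct sum `T = ⨁ᵢ Lᵢ` of a finite family of graded submodules of `ℂ[M]`. -/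
def DirSum {n k : ℕ} {v : Fin k → Fin n → ℤ} {ι : Type} (L : ι → GradedSubmodule v) : Type :=
  ∀ i, (L i).toSubmodule

instance {n k : ℕ} {v : Fin k → Fin n → ℤ} {ι : Type} (L : ι → GradedSubmodule v) :
    AddCommGroup (DirSum L) :=
  inferInstanceAs (AddCommGroup (∀ i, (L i).toSubmodule))

instance {n k : ℕ} {v : Fin k → Fin n → ℤ} {ι : Type} (L : ι → GradedSubmodule v) :
    Module (toricRing v) (DirSum L) :=
  inferInstanceAs (Module (toricRing v) (∀ i, (L i).toSubmodule))

instance {n k : ℕ} {v : Fin k → Fin n → ℤ} {ι : Type} (L : ι → GradedSubmodule v) :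
    Module ℂ (DirSum L) :=
  inferInstanceAs (Module ℂ (∀ i, (L i).toSubmodule))

instance {n k : ℕ} {v : Fin k → Fin n → ℤ} {ι : Type} (L : ι → GradedSubmodule v) :
    IsScalarTower ℂ (toricRing v) (DirSum L) :=
  inferInstanceAs (IsScalarTower ℂ (toricRing v) (∀ i, (L i).toSubmodule))

/-! ### The group `G` and its actions -/

/-- The group `Hom(M, ℂˣ)`. -/
abbrev CharGroup (n : ℕ) : Type := Multiplicative (Fin n → ℤ) →* ℂˣ

/-- The sublattice `MU = {mU : m ∈ M}` of `M`. -/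
def subLattice {n : ℕ} (U : Matrix (Fin n) (Fin n) ℤ) : AddSubgroup (Fin n → ℤ) :=
  (Matrix.vecMulLinear U).toAddMonoidHom.range

/-- The group `G = {ρ ∈ Hom(M, ℂˣ) : ρ = 1 on MU}`. -/
def quotGroup {n : ℕ} (U : Matrix (Fin n) (Fin n) ℤ) : Subgroup (CharGroup n) where
  carrier := {ρ | ∀ m ∈ subLattice U, ρ (Multiplicative.ofAdd m) = 1}
  one_mem' := by intro m _; rfl
  mul_mem' := by
    intro a b ha hb m hm
    rw [MonoidHom.mul_apply, ha m hm, hb m hm, one_mul]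
  inv_mem' := by
    intro a ha m hm
    rw [MonoidHom.inv_apply, ha m hm, inv_one]

/-- The action of a character on `ℂ[M]`: `x^m ↦ ρ(m) x^m`. -/
def charAct {n : ℕ} (ρ : CharGroup n) : Laurent n →ₐ[ℂ] Laurent n :=
  AddMonoidAlgebra.lift ℂ (Laurent n) (Fin n → ℤ)
    { toFun := fun m => AddMonoidAlgebra.single m.toAdd ((ρ m : ℂˣ) : ℂ)
      map_one' := by simp [AddMonoidAlgebra.one_def]
      map_mul' := by intro a b; simp [AddMonoidAlgebra.single_mul_single] }

theorem charAct_single {n : ℕ} (ρ : CharGroup n) (m : Fin n → ℤ) (c : ℂ) :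
    charAct ρ (AddMonoidAlgebra.single m c)
      = AddMonoidAlgebra.single m ((ρ (Multiplicative.ofAdd m) : ℂˣ) * c) := by
  simp [charAct, AddMonoidAlgebra.lift_single, mul_comm]

theorem charAct_coeff {n : ℕ} (ρ : CharGroup n) (f : Laurent n) (m : Fin n → ℤ) :
    (charAct ρ f).coeff m = (ρ (Multiplicative.ofAdd m) : ℂˣ) * f.coeff m := by
  induction f using AddMonoidAlgebra.induction_linear with
  | zero => simp
  | add f g hf hg => simp [hf, hg, mul_add]
  | single a c =>
    rw [charAct_single]
    by_cases h : a = m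
    · subst h; simp
    · simp [h]

theorem charAct_one {n : ℕ} (f : Laurent n) : charAct 1 f = f := by
  ext m; simp [charAct_coeff]

theorem charAct_mul {n : ℕ} (ρ τ : CharGroup n) (f : Laurent n) :
    charAct (ρ * τ) f = charAct ρ (charAct τ f) := by
  ext m; simp [charAct_coeff, mul_assoc]

theorem charAct_mem_toricRing {n k : ℕ} {v : Fin k → Fin n → ℤ} (ρ : CharGroup n)
    {f : Laurent n} (hf : f ∈ toricRing v) : charAct ρ f ∈ toricRing v := by
  intro m hm i
  refine hf m ?_ i
  rw [Finsupp.mem_support_iff, charAct_coeff] at hm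
  exact Finsupp.mem_support_iff.2 (right_ne_zero_of_mul hm)

theorem GradedSubmodule.charAct_mem {n k : ℕ} {v : Fin k → Fin n → ℤ}
    (L : GradedSubmodule v) (ρ : CharGroup n) {f : Laurent n} (hf : f ∈ L.toSubmodule) :
    charAct ρ f ∈ L.toSubmodule := by
  have h : charAct ρ f = ∑ m ∈ f.coeff.support,
      charAct ρ (AddMonoidAlgebra.single m (f.coeff m)) := by
    rw [← map_sum]
    congr 1
    ext x
    simp [AddMonoidAlgebra.coeff_sum, Finsupp.finsetSum_apply, Finsupp.single_apply]
  rw [h]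
  refine Submodule.sum_mem _ fun m _ => ?_
  have h2 : charAct ρ (AddMonoidAlgebra.single m (f.coeff m)) =
      (algebraMap ℂ (toricRing v) (ρ (Multiplicative.ofAdd m) : ℂˣ)) •
        AddMonoidAlgebra.single m (f.coeff m) := by
    rw [charAct_single]
    simp
  rw [h2]
  exact Submodule.smul_mem _ _ (L.homogeneous f hf m)

/-- The action of a character on `T = ⨁ᵢ Lᵢ`, summand by summand. -/
def sumAct {n k : ℕ} {v : Fin k → Fin n → ℤ} {ι : Type} (L : ι → GradedSubmodule v)
    (ρ : CharGroup n) (t : DirSum L) : DirSum L :=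
  fun i => ⟨charAct ρ (t i : Laurent n), (L i).charAct_mem ρ (t i).2⟩

/-- The conjugation action `(ρ · f)(t) = ρ f(ρ⁻¹ t)` of a character on `End_R T`. -/
def conjAct {n k : ℕ} {v : Fin k → Fin n → ℤ} {ι : Type} (L : ι → GradedSubmodule v)
    (ρ : CharGroup n) (f : Module.End (toricRing v) (DirSum L)) :
    Module.End (toricRing v) (DirSum L) where
  toFun t := sumAct L ρ (f (sumAct L ρ⁻¹ t))
  map_add' s t := by
    have h : sumAct L ρ⁻¹ (s + t) = sumAct L ρ⁻¹ s + sumAct L ρ⁻¹ t := by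
      funext i
      exact Subtype.ext (map_add (charAct ρ⁻¹) (s i : Laurent n) (t i : Laurent n))
    rw [h, map_add]
    funext i
    exact Subtype.ext (map_add (charAct ρ) _ _)
  map_smul' r t := by
    have h : sumAct L ρ⁻¹ (r • t) =
        (⟨charAct ρ⁻¹ (r : Laurent n), charAct_mem_toricRing ρ⁻¹ r.2⟩ : toricRing v) •
          sumAct L ρ⁻¹ t := by
      funext i
      apply Subtype.ext
      exact map_mul (charAct ρ⁻¹) (r : Laurent n) (t i : Laurent n)
    rw [h, map_smul]
    funext i
    apply Subtype.ext
    refine (map_mul (charAct ρ) (charAct ρ⁻¹ (r : Laurent n)) _).trans ?_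
    rw [← charAct_mul, mul_inv_cancel ρ, charAct_one]
    rfl

theorem sumAct_mul {n k : ℕ} {v : Fin k → Fin n → ℤ} {ι : Type} (L : ι → GradedSubmodule v)
    (ρ τ : CharGroup n) (t : DirSum L) : sumAct L (ρ * τ) t = sumAct L ρ (sumAct L τ t) := by
  funext i
  exact Subtype.ext (charAct_mul ρ τ _)

theorem sumAct_one {n k : ℕ} {v : Fin k → Fin n → ℤ} {ι : Type} (L : ι → GradedSubmodule v)
    (t : DirSum L) : sumAct L 1 t = t := by
  funext i
  exact Subtype.ext (charAct_one _)

theorem conjAct_one {n k : ℕ} {v : Fin k → Fin n → ℤ} {ι : Type} (L : ι → GradedSubmodule v)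
    (f : Module.End (toricRing v) (DirSum L)) : conjAct L 1 f = f := by
  ext1 t
  change sumAct L 1 (f (sumAct L 1⁻¹ t)) = f t
  rw [inv_one (G := CharGroup n), sumAct_one, sumAct_one]

theorem conjAct_mul {n k : ℕ} {v : Fin k → Fin n → ℤ} {ι : Type} (L : ι → GradedSubmodule v)
    (ρ τ : CharGroup n) (f : Module.End (toricRing v) (DirSum L)) :
    conjAct L (ρ * τ) f = conjAct L ρ (conjAct L τ f) := by
  ext1 t
  change sumAct L (ρ * τ) (f (sumAct L (ρ * τ)⁻¹ t)) =
    sumAct L ρ (sumAct L τ (f (sumAct L τ⁻¹ (sumAct L ρ⁻¹ t))))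
  rw [mul_inv_rev ρ τ, sumAct_mul, sumAct_mul]

theorem conjAct_id {n k : ℕ} {v : Fin k → Fin n → ℤ} {ι : Type} (L : ι → GradedSubmodule v)
    (ρ : CharGroup n) : conjAct L ρ 1 = 1 := by
  ext1 t
  change sumAct L ρ (sumAct L ρ⁻¹ t) = t
  rw [← sumAct_mul, mul_inv_cancel ρ, sumAct_one]

theorem conjAct_comp {n k : ℕ} {v : Fin k → Fin n → ℤ} {ι : Type} (L : ι → GradedSubmodule v)
    (ρ : CharGroup n) (f h : Module.End (toricRing v) (DirSum L)) :
    conjAct L ρ (f * h) = conjAct L ρ f * conjAct L ρ h := by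
  ext1 t
  change sumAct L ρ (f (h (sumAct L ρ⁻¹ t))) =
    sumAct L ρ (f (sumAct L ρ⁻¹ (sumAct L ρ (h (sumAct L ρ⁻¹ t)))))
  rw [← sumAct_mul L ρ⁻¹ ρ, inv_mul_cancel ρ, sumAct_one]

/-- `G` acts on the ring `End_R T` by conjugation. -/
instance conjAction {n k : ℕ} {v : Fin k → Fin n → ℤ} {ι : Type} (L : ι → GradedSubmodule v)
    (U : Matrix (Fin n) (Fin n) ℤ) :
    MulSemiringAction (quotGroup U) (Module.End (toricRing v) (DirSum L)) where
  smul ρ f := conjAct L ρ f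
  one_smul f := conjAct_one L f
  mul_smul ρ τ f := conjAct_mul L ρ τ f
  smul_zero ρ := by
    ext1 t
    funext i
    exact Subtype.ext (map_zero (charAct (ρ : CharGroup n)))
  smul_add ρ f h := by
    ext1 t
    funext i
    exact Subtype.ext (map_add (charAct (ρ : CharGroup n)) _ _)
  smul_one ρ := conjAct_id L ρ
  smul_mul ρ f h := conjAct_comp L ρ f h

/-- The skew group ring `End_R T * G`. -/
abbrev SkewGroupRing {n k : ℕ} {v : Fin k → Fin n → ℤ} {ι : Type} (L : ι → GradedSubmodule v)
    (U : Matrix (Fin n) (Fin n) ℤ) : Type :=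
  SkewMonoidAlgebra (Module.End (toricRing v) (DirSum L)) (quotGroup U)

/-- The ring of invariants `R^G`. -/
def invariantRing {n k : ℕ} (v : Fin k → Fin n → ℤ) (U : Matrix (Fin n) (Fin n) ℤ) :
    Subalgebra ℂ (toricRing v) where
  carrier := {r | ∀ ρ ∈ quotGroup U, charAct ρ (r : Laurent n) = r}
  mul_mem' := by
    intro r s hr hs ρ hρ
    have := map_mul (charAct ρ) (r : Laurent n) (s : Laurent n)
    rw [hr ρ hρ, hs ρ hρ] at this
    exact this
  add_mem' := by
    intro r s hr hs ρ hρ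
    have := map_add (charAct ρ) (r : Laurent n) (s : Laurent n)
    rw [hr ρ hρ, hs ρ hρ] at this
    exact this
  algebraMap_mem' := by
    intro c ρ _
    exact (charAct ρ).commutes c

/-- `T` is a module over `R^G` by restriction of scalars. -/
instance invModule {n k : ℕ} {v : Fin k → Fin n → ℤ} {ι : Type} (L : ι → GradedSubmodule v)
    (U : Matrix (Fin n) (Fin n) ℤ) : Module (invariantRing v U) (DirSum L) :=
  (invariantRing v U).moduleLeft

instance {n k : ℕ} {v : Fin k → Fin n → ℤ} {ι : Type} (L : ι → GradedSubmodule v)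
    (U : Matrix (Fin n) (Fin n) ℤ) :
    SMulCommClass (invariantRing v U) (invariantRing v U) (DirSum L) :=
  ⟨fun a b t => by rw [smul_smul, smul_smul, mul_comm]⟩

instance {n k : ℕ} {v : Fin k → Fin n → ℤ} {ι : Type} (L : ι → GradedSubmodule v)
    (U : Matrix (Fin n) (Fin n) ℤ) :
    Algebra (invariantRing v U) (Module.End (invariantRing v U) (DirSum L)) :=
  Module.End.instAlgebra (invariantRing v U) (invariantRing v U) (DirSum L)

/-! ### Noncommutative crepant resolutions -/

/-- All simple modules of `A` have the same (finite) projective dimension. -/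
def IsHomologicallyHomogeneous (A : Type) [Ring A] : Prop :=
  ∃ d : ℕ, ∀ (S : Type) [AddCommGroup S] [Module A S], IsSimpleModule A S →
    CategoryTheory.projectiveDimension (ModuleCat.of A S) = d

/-- `A` is a noncommutative crepant resolution of `R`: it is homologically homogeneous and
isomorphic to `End_R T` for a finitely generated reflexive `R`-module `T`. -/
def IsNCCR (R A : Type) [CommRing R] [Ring A] [Algebra R A] : Prop :=
  (∃ (T : Type) (_ : AddCommGroup T) (_ : Module R T),
    Module.Finite R T ∧ Module.IsReflexive R T ∧ Nonempty (A ≃ₐ[R] Module.End R T)) ∧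
  IsHomologicallyHomogeneous A

/-! ### Embedded quivers -/

/-- A quiver embedded in a space `X`: its vertices are points of `X` and its arrows are paths
`a : [0,1] → X` from the tail `a(0)` to the head `a(1)`. -/
@[ext]
structure EmbeddedQuiver (X : Type) [TopologicalSpace X] where
  /-- the vertices -/
  verts : Set X
  /-- the arrows -/
  arrows : Set C(unitInterval, X)
  tail_mem : ∀ a ∈ arrows, a 0 ∈ verts
  head_mem : ∀ a ∈ arrows, a 1 ∈ verts

/-- The pullback of an embedded quiver: the vertices are the points over vertices, the arrows are
the lifts of arrows. -/
def EmbeddedQuiver.pullback {X Y : Type} [TopologicalSpace X] [TopologicalSpace Y]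
    (Q : EmbeddedQuiver X) (π : C(Y, X)) : EmbeddedQuiver Y where
  verts := π ⁻¹' Q.verts
  arrows := {a | π.comp a ∈ Q.arrows}
  tail_mem _ ha := Q.tail_mem _ ha
  head_mem _ ha := Q.head_mem _ ha

/-- The image of an embedded quiver under a continuous map. -/
def EmbeddedQuiver.map {X Y : Type} [TopologicalSpace X] [TopologicalSpace Y]
    (Q : EmbeddedQuiver X) (f : C(X, Y)) : EmbeddedQuiver Y where
  verts := f '' Q.verts
  arrows := (fun a => f.comp a) '' Q.arrows
  tail_mem := by
    rintro _ ⟨a, ha, rfl⟩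
    exact ⟨_, Q.tail_mem a ha, rfl⟩
  head_mem := by
    rintro _ ⟨a, ha, rfl⟩
    exact ⟨_, Q.head_mem a ha, rfl⟩

/-- The inclusion `M → M ⊗ ℝ`. -/
def toReal (n : ℕ) : (Fin n → ℤ) →+ (Fin n → ℝ) where
  toFun m := fun i => (m i : ℝ)
  map_zero' := by ext; simp
  map_add' a b := by ext; simp

/-- `M` as a subgroup of `M ⊗ ℝ`. -/
def lattice (n : ℕ) : AddSubgroup (Fin n → ℝ) := (toReal n).range

/-- The torus `(M ⊗ ℝ) / M`. -/
abbrev Torus (n : ℕ) : Type := (Fin n → ℝ) ⧸ lattice n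

/-- The projection `M ⊗ ℝ → (M ⊗ ℝ) / M`. -/
def torusProj (n : ℕ) : C(Fin n → ℝ, Torus n) :=
  ⟨fun x => (x : Torus n), continuous_quot_mk⟩

/-- The projection from `M ⊗ ℝ`, which is contractible, is the universal covering map. -/
theorem isCoveringMap_torusProj (n : ℕ) : IsCoveringMap (torusProj n) := by
  have hd : DiscreteTopology (lattice n) := by
    rw [discreteTopology_iff_isOpen_singleton_zero, Metric.isOpen_singleton_iff]
    refine ⟨1, one_pos, ?_⟩
    rintro ⟨_, m, rfl⟩ h
    apply Subtype.ext
    funext i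
    have h1 : dist ((toReal n m) i) 0 < 1 := lt_of_le_of_lt (dist_le_pi_dist (toReal n m) 0 i) h
    have h2 : |(m i : ℝ)| < 1 := by simpa [toReal] using h1
    have h3 : |m i| < 1 := by exact_mod_cast h2
    have h4 : m i = 0 := Int.abs_lt_one_iff.1 h3
    simp [toReal, h4]
  exact (AddSubgroup.isAddQuotientCoveringMap_of_comm (lattice n)
    DiscreteTopology.isDiscrete).isCoveringMap

/-- The universal cover of a quiver embedded in the torus. -/
def EmbeddedQuiver.universalCover {n : ℕ} (Q : EmbeddedQuiver (Torus n)) :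
    EmbeddedQuiver (Fin n → ℝ) :=
  Q.pullback (torusProj n)

/-- The straight path from `x` to `y`. -/
def segmentPath {n : ℕ} (x y : Fin n → ℝ) : C(unitInterval, Fin n → ℝ) :=
  ⟨fun t => x + (t : ℝ) • (y - x), by fun_prop⟩

/-- A homogeneous morphism between summands of `⨁ᵢ Lᵢ`: it shifts (by the lattice vector `deg`)
the summand `src` into the summand `tgt`. -/
structure Arrow (ι : Type) (n : ℕ) where
  /-- index of the source -/
  src : ι
  /-- index of the target -/
  tgt : ι
  /-- the lattice vector by which the source is shifted -/
  deg : Fin n → ℤ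

/-- The quiver in the torus `(M ⊗ ℝ)/M` defined by points `pᵢ ∈ M ⊗ ℝ` and a set of arrows:
an arrow from `i` to `j` of degree `m` is the image of the straight path from `pᵢ + m` to `pⱼ`. -/
def embeddedQuiver {ι : Type} {n : ℕ} (p : ι → Fin n → ℝ) (Γ : Set (Arrow ι n)) :
    EmbeddedQuiver (Torus n) where
  verts := Set.range fun i => torusProj n (p i)
  arrows := (fun a : Arrow ι n =>
    (torusProj n).comp (segmentPath (p a.src + toReal n a.deg) (p a.tgt))) '' Γ
  tail_mem := by
    rintro _ ⟨a, _, rfl⟩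
    refine ⟨a.src, ?_⟩
    change ((p a.src : Fin n → ℝ) : Torus n) =
      ((p a.src + toReal n a.deg + (0 : ℝ) • (p a.tgt - (p a.src + toReal n a.deg)) :
        Fin n → ℝ) : Torus n)
    rw [zero_smul, add_zero]
    refine QuotientAddGroup.eq.2 ⟨a.deg, ?_⟩
    abel
  head_mem := by
    rintro _ ⟨a, _, rfl⟩
    refine ⟨a.tgt, ?_⟩
    change ((p a.tgt : Fin n → ℝ) : Torus n) =
      ((p a.src + toReal n a.deg + (1 : ℝ) • (p a.tgt - (p a.src + toReal n a.deg)) :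
        Fin n → ℝ) : Torus n)
    rw [one_smul, add_sub_cancel]

/-- `E` is the endomorphism of `T = ⨁ᵢ Lᵢ` given by the arrow `a`: it is multiplication by
`x^deg` from the summand `src` to the summand `tgt`, and zero on the other summands. -/
def IsMonomialHom {n k : ℕ} {v : Fin k → Fin n → ℤ} {ι : Type} [DecidableEq ι]
    (L : ι → GradedSubmodule v) (a : Arrow ι n) (E : Module.End (toricRing v) (DirSum L)) : Prop :=
  ∀ (t : DirSum L) (i : ι),
    (E t i : Laurent n) = if i = a.tgt then mono a.deg * (t a.src : Laurent n) else 0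

/-- The arrows in `Γ` are homogeneous endomorphisms of `T = ⨁ᵢ Lᵢ` that, together with the
idempotents of the summands (the trivial paths), generate the algebra `End_R T`. -/
def Generates {n k : ℕ} {v : Fin k → Fin n → ℤ} {ι : Type} [DecidableEq ι]
    (L : ι → GradedSubmodule v) (Γ : Set (Arrow ι n)) : Prop :=
  (∀ a ∈ Γ, ∃ E, IsMonomialHom L a E) ∧
  Algebra.adjoin ℂ ({E : Module.End (toricRing v) (DirSum L) | ∃ a ∈ Γ, IsMonomialHom L a E} ∪
    {E | ∃ i, IsMonomialHom L ⟨i, i, 0⟩ E}) = ⊤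

/-- `embeddedQuiver p Γ` is an embedded quiver for `End_R T`, where `T = ⨁ᵢ Lᵢ`: the summands are
pairwise nonisomorphic, the points `pᵢ` are different modulo `M`, and the set `Γ` of homogeneous
morphisms generates `End_R T`. -/
structure IsQuiverFor {n k : ℕ} {v : Fin k → Fin n → ℤ} {ι : Type} [DecidableEq ι]
    (L : ι → GradedSubmodule v) (p : ι → Fin n → ℝ) (Γ : Set (Arrow ι n)) : Prop where
  nonisomorphic : ∀ i j, i ≠ j →
    IsEmpty ((L i).toSubmodule ≃ₗ[toricRing v] (L j).toSubmodule)
  distinct : ∀ i j, i ≠ j → p i - p j ∉ lattice n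
  generates : Generates L Γ

/-- The map `κ(b) = (φφᵀ)⁻¹ φ(b)`, where `φ : ℤᵏ → N`, `φ(b) = ∑ᵢ bᵢ vᵢ`. -/
def kappa {n k : ℕ} (v : Fin k → Fin n → ℤ) (b : Fin k → ℤ) : Fin n → ℝ :=
  let φ : Matrix (Fin n) (Fin k) ℝ := Matrix.of fun a i => (v i a : ℝ)
  (φ * φᵀ)⁻¹ *ᵥ (φ *ᵥ fun i => (b i : ℝ))

/-! ### The quotient singularity -/

/-- The generators `Uvᵢ` of the cone `Uσ`. -/
def newGens {n k : ℕ} (U : Matrix (Fin n) (Fin n) ℤ) (v : Fin k → Fin n → ℤ) :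
    Fin k → Fin n → ℤ :=
  fun i => U *ᵥ v i

/-- The substitution `x^m ↦ x^{mU}`. -/
def subst {n : ℕ} (U : Matrix (Fin n) (Fin n) ℤ) : Laurent n →ₐ[ℂ] Laurent n :=
  AddMonoidAlgebra.mapDomainAlgHom ℂ ℂ (Matrix.vecMulLinear U).toAddMonoidHom

/-- The graded `R_{Uσ}`-module `Span {x^m : x^{μ + mU} ∈ L}`, which is, up to the identification
of `m` with `μ + mU`, the part of `L` whose degrees lie in the coset `μ + MU`. -/
def piece {n k : ℕ} {v : Fin k → Fin n → ℤ} (U : Matrix (Fin n) (Fin n) ℤ)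
    (μ : Fin n → ℤ) (L : GradedSubmodule v) : GradedSubmodule (newGens U v) :=
  GradedSubmodule.ofSet (newGens U v) {m | mono (μ + m ᵥ* U) ∈ L.toSubmodule} (by
    intro a ha s hs
    have hr : mono (a ᵥ* U) ∈ toricRing v := by
      intro m hm i
      have h : a ᵥ* U = m := by
        by_contra hne
        simp at hm
        exact hne hm.symm
      rw [← h, ← Matrix.dotProduct_mulVec]
      exact ha i
    have h := L.toSubmodule.smul_mem (⟨mono (a ᵥ* U), hr⟩ : toricRing v) hs
    have e : (⟨mono (a ᵥ* U), hr⟩ : toricRing v) • (mono (μ + s ᵥ* U) : Laurent n) =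
        mono (μ + (a + s) ᵥ* U) := by
      change mono (a ᵥ* U) * mono (μ + s ᵥ* U) = mono (μ + (a + s) ᵥ* U)
      rw [AddMonoidAlgebra.single_mul_single, one_mul, Matrix.add_vecMul]
      congr 1
      abel
    rw [e] at h
    exact h)

/-- The map `x ↦ xU⁻¹` on `M ⊗ ℝ`. -/
def mulInv {n : ℕ} (U : Matrix (Fin n) (Fin n) ℤ) : C(Fin n → ℝ, Fin n → ℝ) :=
  ⟨fun x => x ᵥ* (U.map (fun z : ℤ => (z : ℝ)))⁻¹, by fun_prop⟩

end ToricQuotient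

end

set_option linter.unusedSectionVars false

namespace ToricQuotient

/-! ### Lattice points with prescribed pairings -/

/-! Everything is read off from degrees. Since the `vᵢ` are primitive and span faces, there are
lattice points with prescribed pairing with one `vᵢ` and arbitrarily large pairing with the others
(`IsConeGenerators.exists_degree`). Homomorphisms between graded submodules are multiplications by
Laurent polynomials, and testing these on such points gives `Hom(T(b), T(c)) = T(c - b)`. Hence the
graded rank one reflexives are exactly the `T(b)`, and `End_R T` consists of matrices with entries
in `T(b_j - b_i)`.

An `R^G`-linear map commutes only with the monomials of degree in `MU`, so each matrix entry becomes
a family of multipliers, one for each coset of `MU` (`exists_coset_multiplier`). As the `Uvᵢ` are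
primitive too, every coset contains the test points, and each multiplier again lies in `T(b_j -
b_i)`. On the coset of `m_r` the element `∑ f_ρ ρ` multiplies by `∑ ρ(m_r) f_ρ`. So the map from the
skew group ring is a Fourier transform on `M/MU`: it is injective by independence of characters and
surjective by their orthogonality.

For the NCCR property, let `B = A * G` with `|G|` invertible. By averaging, a `B`-module is
projective if and only if it is so over `A`, so projective dimensions agree. A simple `B`-module is
semisimple over `A`, embedded in a finite product of simple `A`-modules, and inherits their common
projective dimension. Sorting monomials by cosets of `MU` identifies `T` with a sum of modules
`T(b')` over `R_{Uσ} ≅ R^G`, which gives finiteness and reflexivity.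

For quivers, generation of the endomorphism algebra means that every monomial morphism is a path of
arrows (`generates_iff`). `Γ'` is the preimage of `Γ` under `Arrow.down`; paths lift once the coset
at the start is chosen, and minimality passes up because arrows of a minimal generating set are
irreducible. Universal covers agree since `M` is the union of the cosets `MU - m_r`. The statement
on `κ` is matrix algebra with `φ_U = Uφ`. -/

/-- The coordinates of `w` generate a principal ideal `(c)` and `w` is a multiple of `c`, so
primitivity makes `c` a unit. -/
theorem IsPrimitive.exists_dotProduct_eq_one {n : ℕ} {w : Fin n → ℤ} (h : IsPrimitive w) :
    ∃ q : Fin n → ℤ, q ⬝ᵥ w = 1 := by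
  obtain ⟨c, hc⟩ := (IsPrincipalIdealRing.principal (Ideal.span (Set.range w))).principal
  have hd : ∀ a, ∃ u, w a = c * u := fun a => by
    have : w a ∈ Ideal.span (Set.range w) := Ideal.subset_span ⟨a, rfl⟩
    rw [hc] at this
    obtain ⟨u, hu⟩ := Submodule.mem_span_singleton.1 this
    exact ⟨u, by rw [← hu, smul_eq_mul, mul_comm]⟩
  choose u hu using hd
  have hunit : IsUnit c := h c u (funext fun a => hu a)
  have h1 : (1 : ℤ) ∈ Ideal.span (Set.range w) := by
    rw [hc]
    exact (Ideal.eq_top_iff_one _).1 (Ideal.span_singleton_eq_top.2 hunit)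
  obtain ⟨q, hq⟩ := (Ideal.mem_span_range_iff_exists_fun).1 h1
  exact ⟨q, hq⟩

section Cone

variable {n k : ℕ} {v : Fin k → Fin n → ℤ}

theorem IsConeGenerators.exists_degree (hv : IsConeGenerators v) (i : Fin k) (c : ℤ)
    (N : Fin k → ℤ) : ∃ m : Fin n → ℤ, m ⬝ᵥ v i = c ∧ ∀ j, j ≠ i → N j ≤ m ⬝ᵥ v j := by
  obtain ⟨q, hq⟩ := (hv.primitive i).exists_dotProduct_eq_one
  obtain ⟨r, hr0, hr⟩ := hv.ray i
  -- `c • q` has the right pairing with `v i`. Adding `K • r` keeps it, and raises each other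
  -- pairing by at least `K`, which exceeds every deficit.
  set K : ℤ := ∑ j, |N j - c * (q ⬝ᵥ v j)| with hK
  refine ⟨c • q + K • r, by
    rw [add_dotProduct, smul_dotProduct, smul_dotProduct, hq, hr0, smul_zero, add_zero,
      smul_eq_mul, mul_one], fun j hj => ?_⟩
  have h1 : |N j - c * (q ⬝ᵥ v j)| ≤ K :=
    Finset.single_le_sum (f := fun j => |N j - c * (q ⬝ᵥ v j)|)
      (fun _ _ => abs_nonneg _) (Finset.mem_univ j)
  have h2 := le_abs_self (N j - c * (q ⬝ᵥ v j))
  have h3 : K * 1 ≤ K * (r ⬝ᵥ v j) :=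
    mul_le_mul_of_nonneg_left (hr j hj) (Finset.sum_nonneg fun _ _ => abs_nonneg _)
  rw [add_dotProduct, smul_dotProduct, smul_dotProduct, smul_eq_mul, smul_eq_mul]
  linarith

theorem IsConeGenerators.exists_forall_le (hv : IsConeGenerators v) (N : Fin k → ℤ) :
    ∃ m : Fin n → ℤ, ∀ j, N j ≤ m ⬝ᵥ v j := by
  rcases isEmpty_or_nonempty (Fin k) with h | ⟨⟨i⟩⟩
  · exact ⟨0, fun j => h.elim j⟩
  · obtain ⟨m, h1, h2⟩ := hv.exists_degree i (N i) N
    refine ⟨m, fun j => ?_⟩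
    by_cases hj : j = i
    · rw [hj, h1]
    · exact h2 j hj

/-- Pairing with `m` vanishes on the real span of the generators, in particular on `m` itself. -/
theorem IsConeGenerators.eq_zero (hv : IsConeGenerators v) {m : Fin n → ℤ}
    (hm : ∀ i, m ⬝ᵥ v i = 0) : m = 0 := by
  have key : ∀ x ∈ Submodule.span ℝ (Set.range fun i => (fun a => (v i a : ℝ))),
      (fun a => (m a : ℝ)) ⬝ᵥ x = 0 := by
    intro x hx
    induction hx using Submodule.span_induction with
    | mem x hx =>
      obtain ⟨i, rfl⟩ := hx
      have := congrArg (fun z : ℤ => (z : ℝ)) (hm i)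
      simpa [dotProduct] using this
    | zero => simp
    | add x y _ _ hx hy => rw [dotProduct_add, hx, hy, add_zero]
    | smul c x _ hx => rw [dotProduct_smul, hx, smul_zero]
  have h := key (fun a => (m a : ℝ)) (by rw [hv.full_dim]; trivial)
  have h' := dotProduct_self_eq_zero.1 h
  funext a
  simpa using congrFun h' a

variable {U : Matrix (Fin n) (Fin n) ℤ}

theorem dotProduct_newGens (m : Fin n → ℤ) (i : Fin k) :
    m ⬝ᵥ newGens U v i = (m ᵥ* U) ⬝ᵥ v i :=
  Matrix.dotProduct_mulVec m U (v i)

theorem vecMul_injective_of_det_ne_zero (hU : U.det ≠ 0) :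
    Function.Injective fun m : Fin n → ℤ => m ᵥ* U :=
  fun a b h => sub_eq_zero.1 (Matrix.eq_zero_of_vecMul_eq_zero hU (by
    rw [Matrix.sub_vecMul]; exact sub_eq_zero.2 h))

theorem vecMul_adjugate_vecMul (m : Fin n → ℤ) : (m ᵥ* U.adjugate) ᵥ* U = U.det • m := by
  rw [Matrix.vecMul_vecMul, Matrix.adjugate_mul, Matrix.vecMul_smul, Matrix.vecMul_one]

theorem det_map_intCast_ne_zero (hU : U.det ≠ 0) : (U.map (fun z : ℤ => (z : ℝ))).det ≠ 0 := by
  have : (U.map (fun z : ℤ => (z : ℝ))).det = (U.det : ℝ) :=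
    ((Int.castRingHom ℝ).map_det U).symm
  rw [this]
  exact_mod_cast hU

theorem IsConeGenerators.newGens (hv : IsConeGenerators v) (hU : U.det ≠ 0)
    (hUv : ∀ i, IsPrimitive (U *ᵥ v i)) : IsConeGenerators (newGens U v) where
  primitive := hUv
  ray i := by
    obtain ⟨r, hr0, hr⟩ := hv.ray i
    -- An integral substitute for `rU⁻¹`: its pairing with `Uv_j` is `(det U)²` times that of `r`
    -- with `v_j`, so signs are preserved.
    refine ⟨U.det • (r ᵥ* U.adjugate), ?_, fun j hj => ?_⟩
    all_goals rw [dotProduct_newGens, Matrix.smul_vecMul, vecMul_adjugate_vecMul, smul_smul,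
      smul_dotProduct, smul_eq_mul]
    · rw [hr0, mul_zero]
    · exact mul_pos (mul_self_pos.2 hU) (hr j hj)
  full_dim := by
    set W := U.map (fun z : ℤ => (z : ℝ)) with hW
    have h1 : (Set.range fun i => (fun a => ((ToricQuotient.newGens U v i a : ℤ) : ℝ))) =
        Matrix.toLin' W '' Set.range fun i => (fun a => (v i a : ℝ)) := by
      rw [← Set.range_comp]
      congr 1
      funext i a
      simp [ToricQuotient.newGens, Matrix.mulVec, dotProduct, hW]
    rw [h1, ← Submodule.map_span, hv.full_dim, Submodule.map_top, LinearMap.range_eq_top]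
    intro y
    have hu : IsUnit W.det := (det_map_intCast_ne_zero hU).isUnit
    exact ⟨W⁻¹ *ᵥ y, by
      rw [Matrix.toLin'_apply, Matrix.mulVec_mulVec, Matrix.mul_nonsing_inv _ hu,
        Matrix.one_mulVec]⟩

/-- Primitivity of the `Uvᵢ` enters here, through `⟨m, Uvᵢ⟩ = ⟨mU, vᵢ⟩`: the test points exist
inside each coset of `MU`. This expresses that `R` is unramified over `R^G` in codimension one. -/
theorem IsConeGenerators.exists_degree_coset (hv : IsConeGenerators (ToricQuotient.newGens U v))
    (μ : Fin n → ℤ) (i : Fin k) (c : ℤ) (N : Fin k → ℤ) :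
    ∃ m : Fin n → ℤ, (μ + m ᵥ* U) ⬝ᵥ v i = c ∧
      ∀ j, j ≠ i → N j ≤ (μ + m ᵥ* U) ⬝ᵥ v j := by
  obtain ⟨m, h1, h2⟩ := hv.exists_degree i (c - μ ⬝ᵥ v i) (fun j => N j - μ ⬝ᵥ v j)
  refine ⟨m, ?_, fun j hj => ?_⟩
  · rw [add_dotProduct, ← dotProduct_newGens, h1]; ring
  · rw [add_dotProduct, ← dotProduct_newGens]; linarith [h2 j hj]

end Cone

/-! ### Monomials -/

section Mono

variable {n : ℕ}

theorem coeff_mono_mul (m : Fin n → ℤ) (f : Laurent n) (a : Fin n → ℤ) :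
    (mono m * f).coeff a = f.coeff (a - m) := by
  rw [AddMonoidAlgebra.coeff_single_mul_apply, one_mul, neg_add_eq_sub]

theorem mono_mul_mono (a b : Fin n → ℤ) : mono a * mono b = mono (a + b) := by
  rw [AddMonoidAlgebra.single_mul_single, one_mul]

theorem mono_zero : mono (0 : Fin n → ℤ) = 1 := rfl

theorem mono_ne_zero (a : Fin n → ℤ) : mono a ≠ 0 := by simp

theorem coeff_mono (m a : Fin n → ℤ) : (mono m).coeff a = if m = a then 1 else 0 := by
  classical
  simp [Finsupp.single_apply]

theorem smul_mono (c : ℂ) (m : Fin n → ℤ) : c • mono m = AddMonoidAlgebra.single m c := by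
  simp

theorem sum_coeff_smul_mono (f : Laurent n) :
    ∑ m ∈ f.coeff.support, f.coeff m • mono m = f := by
  conv_rhs => rw [← AddMonoidAlgebra.sum_coeff_single f]
  simp [Finsupp.sum]

theorem mono_mul_left_injective (m : Fin n → ℤ) {f g : Laurent n} (h : mono m * f = mono m * g) :
    f = g := by
  have := congrArg (mono (-m) * ·) h
  simpa only [← mul_assoc, mono_mul_mono, neg_add_cancel, mono_zero, one_mul] using this

end Mono

section Members

variable {n k : ℕ} {v : Fin k → Fin n → ℤ}

theorem mem_toricRing {f : Laurent n} :
    f ∈ toricRing v ↔ ∀ m ∈ f.coeff.support, ∀ i, 0 ≤ m ⬝ᵥ v i := Iff.rfl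

theorem mem_reflexiveOf {b : Fin k → ℤ} {f : Laurent n} :
    f ∈ (reflexiveOf v b).toSubmodule ↔ ∀ m ∈ f.coeff.support, ∀ i, b i ≤ m ⬝ᵥ v i := Iff.rfl

theorem mono_mem_toricRing {a : Fin n → ℤ} : mono a ∈ toricRing v ↔ ∀ i, 0 ≤ a ⬝ᵥ v i := by
  rw [mem_toricRing]; simp [AddMonoidAlgebra.coeff_single]

theorem mono_mem_reflexiveOf {b : Fin k → ℤ} {a : Fin n → ℤ} :
    mono a ∈ (reflexiveOf v b).toSubmodule ↔ ∀ i, b i ≤ a ⬝ᵥ v i := by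
  rw [mem_reflexiveOf]; simp [AddMonoidAlgebra.coeff_single]

theorem mul_mem_reflexiveOf {b c : Fin k → ℤ} {f h : Laurent n}
    (hf : f ∈ (reflexiveOf v b).toSubmodule) (hh : h ∈ (reflexiveOf v c).toSubmodule) :
    f * h ∈ (reflexiveOf v (b + c)).toSubmodule := by
  intro m hm i
  classical
  obtain ⟨x, hx, y, hy, rfl⟩ :=
    Finset.mem_add.1 (AddMonoidAlgebra.support_coeff_mul_subset f h hm)
  rw [add_dotProduct]
  exact add_le_add (hf x hx i) (hh y hy i)

/-- A monomial of `L` as an element of `L`. -/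
noncomputable abbrev GradedSubmodule.monoMem (L : GradedSubmodule v) {m : Fin n → ℤ}
    (hm : mono m ∈ L.toSubmodule) : L.toSubmodule := ⟨mono m, hm⟩

theorem GradedSubmodule.smul_mem_complex (L : GradedSubmodule v) (c : ℂ) {f : Laurent n}
    (hf : f ∈ L.toSubmodule) : c • f ∈ L.toSubmodule := by
  rw [← algebraMap_smul (toricRing v) c f]
  exact L.toSubmodule.smul_mem _ hf

theorem GradedSubmodule.mono_mem (L : GradedSubmodule v) {f : Laurent n}
    (hf : f ∈ L.toSubmodule) {m : Fin n → ℤ} (hm : m ∈ f.coeff.support) :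
    mono m ∈ L.toSubmodule := by
  have h := L.smul_mem_complex (f.coeff m)⁻¹ (L.homogeneous f hf m)
  rwa [AddMonoidAlgebra.smul_single', inv_mul_cancel₀ (Finsupp.mem_support_iff.1 hm)] at h

theorem GradedSubmodule.mem_of_mono_mem (L : GradedSubmodule v) {f : Laurent n}
    (hf : ∀ m ∈ f.coeff.support, mono m ∈ L.toSubmodule) : f ∈ L.toSubmodule := by
  rw [← sum_coeff_smul_mono f]
  exact Submodule.sum_mem _ fun m hm => L.smul_mem_complex _ (hf m hm)

@[ext]
theorem GradedSubmodule.ext {L L' : GradedSubmodule v}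
    (h : ∀ m, mono m ∈ L.toSubmodule ↔ mono m ∈ L'.toSubmodule) : L = L' := by
  have : L.toSubmodule = L'.toSubmodule := by
    ext f
    exact ⟨fun hf => L'.mem_of_mono_mem fun m hm => (h m).1 (L.mono_mem hf hm),
      fun hf => L.mem_of_mono_mem fun m hm => (h m).2 (L'.mono_mem hf hm)⟩
  cases L; cases L'; congr

theorem mono_mem_piece {U : Matrix (Fin n) (Fin n) ℤ} {μ : Fin n → ℤ} {L : GradedSubmodule v}
    {a : Fin n → ℤ} :
    mono a ∈ (piece U μ L).toSubmodule ↔ mono (μ + a ᵥ* U) ∈ L.toSubmodule := by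
  change (∀ m ∈ (mono a).coeff.support, mono (μ + m ᵥ* U) ∈ L.toSubmodule) ↔ _
  simp [AddMonoidAlgebra.coeff_single]

theorem piece_reflexiveOf (U : Matrix (Fin n) (Fin n) ℤ) (μ : Fin n → ℤ) (b : Fin k → ℤ) :
    piece U μ (reflexiveOf v b) = reflexiveOf (newGens U v) (fun i => b i - μ ⬝ᵥ v i) := by
  ext m
  rw [mono_mem_piece, mono_mem_reflexiveOf, mono_mem_reflexiveOf]
  refine forall_congr' fun i => ?_
  rw [add_dotProduct, dotProduct_newGens]
  constructor <;> intro h <;> linarith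

end Members

/-! ### Homomorphisms are multiplications -/

section Multiplier

variable {n k : ℕ} {v : Fin k → Fin n → ℤ}

theorem GradedSubmodule.coe_sum_coeff_smul (L : GradedSubmodule v) (t : L.toSubmodule) :
    ∑ m ∈ (t : Laurent n).coeff.support.attach,
      (t : Laurent n).coeff m • L.monoMem (L.mono_mem t.2 m.2) = t := by
  apply Subtype.ext
  rw [← Submodule.subtype_apply, map_sum]
  refine Eq.trans ?_ (sum_coeff_smul_mono (t : Laurent n))
  exact Finset.sum_attach _ fun m => (t : Laurent n).coeff m • (mono m : Laurent n)

theorem GradedSubmodule.linearMap_ext (L : GradedSubmodule v) {E : Type*} [AddCommGroup E]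
    [Module ℂ E] {φ ψ : L.toSubmodule →ₗ[ℂ] E}
    (h : ∀ m (hm : mono m ∈ L.toSubmodule), φ (L.monoMem hm) = ψ (L.monoMem hm)) : φ = ψ := by
  refine LinearMap.ext fun t => ?_
  rw [← L.coe_sum_coeff_smul t, map_sum, map_sum]
  exact Finset.sum_congr rfl fun m _ => by rw [map_smul, map_smul, h]

/-- The monoid `σ^∨ ∩ M` generates `M` as a group: any `d` is moved into the cone by a point deep
enough inside it. -/
theorem IsConeGenerators.exists_sub_eq (hv : IsConeGenerators v) (d : Fin n → ℤ) :
    ∃ a c : Fin n → ℤ, a + d = c ∧ (∀ i, 0 ≤ a ⬝ᵥ v i) ∧ ∀ i, 0 ≤ c ⬝ᵥ v i := by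
  obtain ⟨a, ha⟩ := hv.exists_forall_le fun j => max 0 (-(d ⬝ᵥ v j))
  refine ⟨a, a + d, rfl, fun i => (le_max_left _ _).trans (ha i), fun i => ?_⟩
  rw [add_dotProduct]
  linarith [(le_max_right _ _).trans (ha i)]

/-- A linear map commuting with the monomials of `σ^∨ ∩ MU` multiplies all monomials with degrees
in one coset of `MU` by the same Laurent polynomial. -/
theorem mono_mul_apply_eq {U : Matrix (Fin n) (Fin n) ℤ} (hv : IsConeGenerators (newGens U v))
    (L : GradedSubmodule v) (f : L.toSubmodule → Laurent n)
    (hf : ∀ a : Fin n → ℤ, (∀ i, 0 ≤ (a ᵥ* U) ⬝ᵥ v i) → ∀ s t : L.toSubmodule,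
      (s : Laurent n) = mono (a ᵥ* U) * t → f s = mono (a ᵥ* U) * f t)
    {m m₀ d : Fin n → ℤ} (hm : mono m ∈ L.toSubmodule) (hm₀ : mono m₀ ∈ L.toSubmodule)
    (hd : m₀ + d ᵥ* U = m) :
    f (L.monoMem hm) = mono (m - m₀) * f (L.monoMem hm₀) := by
  -- With `d = c - a`, the monomial `x^{aU + m} = x^{cU + m₀}` is a multiple of both given
  -- monomials. Computing `f` on it in two ways and cancelling `x^{aU}` gives the claim.
  obtain ⟨a, c, hac, ha, hc⟩ := hv.exists_sub_eq d
  have ha' : ∀ i, 0 ≤ (a ᵥ* U) ⬝ᵥ v i := fun i => by rw [← dotProduct_newGens]; exact ha i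
  have hc' : ∀ i, 0 ≤ (c ᵥ* U) ⬝ᵥ v i := fun i => by rw [← dotProduct_newGens]; exact hc i
  have hs : mono (a ᵥ* U + m) ∈ L.toSubmodule := by
    have := L.toSubmodule.smul_mem (⟨mono (a ᵥ* U), mono_mem_toricRing.2 ha'⟩ : toricRing v) hm
    rw [← mono_mul_mono]
    exact this
  have h1 := hf a ha' (L.monoMem hs) (L.monoMem hm) (mono_mul_mono _ _).symm
  have h2 := hf c hc' (L.monoMem hs) (L.monoMem hm₀) (by
    change mono _ = mono _ * mono _
    rw [mono_mul_mono, ← hd, ← hac, Matrix.add_vecMul]; congr 1; abel)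
  apply mono_mul_left_injective (a ᵥ* U)
  rw [← h1, h2, ← mul_assoc, mono_mul_mono, ← hd, ← hac, Matrix.add_vecMul]
  congr 2
  abel

theorem newGens_one : newGens 1 v = v := by
  funext i
  exact Matrix.one_mulVec _

/-- The multiplier can only be `φ(x^{m₀}) / x^{m₀}`. That it works is the case `U = 1` of
`mono_mul_apply_eq`, where `M` is a single coset. -/
theorem exists_multiplier (hv : IsConeGenerators v) (L : GradedSubmodule v) {m₀ : Fin n → ℤ}
    (hm₀ : mono m₀ ∈ L.toSubmodule) (φ : L.toSubmodule →ₗ[toricRing v] Laurent n) :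
    ∃ h : Laurent n, ∀ t, φ t = h * t := by
  refine ⟨mono (-m₀) * φ (L.monoMem hm₀), fun t => ?_⟩
  have key : φ.restrictScalars ℂ =
      LinearMap.mulLeft ℂ (mono (-m₀) * φ (L.monoMem hm₀)) ∘ₗ
        L.toSubmodule.subtype.restrictScalars ℂ := by
    refine L.linearMap_ext fun m hm => ?_
    have := mono_mul_apply_eq (U := 1) (newGens_one.symm ▸ hv) L φ (fun a ha s t hst => by
      have : s = (⟨mono (a ᵥ* 1), mono_mem_toricRing.2 ha⟩ : toricRing v) • t := Subtype.ext hst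
      rw [this, map_smul]; rfl) hm hm₀ (d := m - m₀) (by simp)
    change φ _ = mono (-m₀) * φ (L.monoMem hm₀) * mono m
    rw [this, mul_right_comm, mono_mul_mono]
    congr 2
    abel
  exact LinearMap.congr_fun key t

/-- A monomial with `⟨m, vᵢ⟩ = bᵢ` turns the `i`-th inequality for `h x^m` into the sharp `i`-th
inequality for `h`. -/
theorem mem_reflexiveOf_of_mul_mem {b c : Fin k → ℤ} {h : Laurent n}
    (hh : ∀ i, ∃ m : Fin n → ℤ, m ⬝ᵥ v i = b i ∧ h * mono m ∈ (reflexiveOf v c).toSubmodule) :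
    h ∈ (reflexiveOf v (c - b)).toSubmodule := by
  intro d hd i
  obtain ⟨m, hm, hmem⟩ := hh i
  have := hmem (d + m) (by
    rw [Finsupp.mem_support_iff, mul_comm, coeff_mono_mul, add_sub_cancel_right]
    exact Finsupp.mem_support_iff.1 hd) i
  rw [add_dotProduct, hm] at this
  rw [Pi.sub_apply]
  linarith

theorem IsConeGenerators.exists_mono_mem (hv : IsConeGenerators v) (b : Fin k → ℤ) :
    ∃ m, mono m ∈ (reflexiveOf v b).toSubmodule := by
  obtain ⟨m, hm⟩ := hv.exists_forall_le b
  exact ⟨m, mono_mem_reflexiveOf.2 hm⟩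

theorem IsConeGenerators.exists_mono_mem_eq (hv : IsConeGenerators v) (b : Fin k → ℤ)
    (i : Fin k) : ∃ m, m ⬝ᵥ v i = b i ∧ mono m ∈ (reflexiveOf v b).toSubmodule := by
  obtain ⟨m, h1, h2⟩ := hv.exists_degree i (b i) b
  refine ⟨m, h1, mono_mem_reflexiveOf.2 fun j => ?_⟩
  by_cases hj : j = i
  · rw [hj, h1]
  · exact h2 j hj

/-- Together with `mul_mem_reflexiveOf` this identifies `Hom(T(b), T(c))` with `T(c - b)`. -/
theorem exists_multiplier_reflexiveOf (hv : IsConeGenerators v) (b c : Fin k → ℤ)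
    (φ : (reflexiveOf v b).toSubmodule →ₗ[toricRing v] (reflexiveOf v c).toSubmodule) :
    ∃ h ∈ (reflexiveOf v (c - b)).toSubmodule, ∀ t, (φ t : Laurent n) = h * t := by
  obtain ⟨m₀, hm₀⟩ := hv.exists_mono_mem b
  obtain ⟨h, hh⟩ := exists_multiplier hv _ hm₀ ((Submodule.subtype _).comp φ)
  refine ⟨h, mem_reflexiveOf_of_mul_mem fun i => ?_, hh⟩
  obtain ⟨m, h1, h2⟩ := hv.exists_mono_mem_eq b i
  exact ⟨m, h1, by rw [← hh ⟨mono m, h2⟩]; exact (φ _).2⟩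

/-- Elements of the dual of a graded submodule are multiplications. -/
theorem exists_multiplier_dual (hv : IsConeGenerators v) (L : GradedSubmodule v) {m₀ : Fin n → ℤ}
    (hm₀ : mono m₀ ∈ L.toSubmodule) (φ : Module.Dual (toricRing v) L.toSubmodule) :
    ∃ h : Laurent n, ∀ t, (φ t : Laurent n) = h * t := by
  exact exists_multiplier hv L hm₀ ((Algebra.linearMap (toricRing v) (Laurent n)).comp φ)

theorem exists_multiplier_dual_reflexiveOf (hv : IsConeGenerators v) (b : Fin k → ℤ)
    (φ : Module.Dual (toricRing v) (reflexiveOf v b).toSubmodule) :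
    ∃ h ∈ (reflexiveOf v (-b)).toSubmodule, ∀ t, (φ t : Laurent n) = h * t := by
  obtain ⟨m₀, hm₀⟩ := hv.exists_mono_mem b
  obtain ⟨h, hh⟩ := exists_multiplier_dual hv _ hm₀ φ
  refine ⟨h, ?_, hh⟩
  rw [← zero_sub]
  refine mem_reflexiveOf_of_mul_mem fun i => ?_
  obtain ⟨m, h1, h2⟩ := hv.exists_mono_mem_eq b i
  exact ⟨m, h1, by rw [← hh ⟨mono m, h2⟩]; exact (φ _).2⟩

/-- The pairing `L × L' → R` for graded submodules with `L L' ⊆ R`. -/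
noncomputable def mulPairing (L L' : GradedSubmodule v)
    (h : ∀ f ∈ L.toSubmodule, ∀ g ∈ L'.toSubmodule, f * g ∈ toricRing v) :
    L.toSubmodule →ₗ[toricRing v] Module.Dual (toricRing v) L'.toSubmodule :=
  LinearMap.mk₂ (toricRing v) (fun f g => ⟨(f : Laurent n) * g, h f f.2 g g.2⟩)
    (fun _ _ _ => Subtype.ext (add_mul _ _ _)) (fun _ _ _ => Subtype.ext (mul_assoc _ _ _))
    (fun _ _ _ => Subtype.ext (mul_add _ _ _)) (fun _ _ _ => Subtype.ext (mul_left_comm _ _ _))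

theorem mul_mem_toricRing_of_neg {b : Fin k → ℤ} {f g : Laurent n}
    (hf : f ∈ (reflexiveOf v (-b)).toSubmodule) (hg : g ∈ (reflexiveOf v b).toSubmodule) :
    f * g ∈ toricRing v := by
  have := mul_mem_reflexiveOf hf hg
  rwa [neg_add_cancel] at this

/-- Multiplication identifies the dual of `T(b)` with `T(-b)`, so dualizing twice leads back to
`T(b)`. -/
theorem isReflexive_reflexiveOf (hv : IsConeGenerators v) (b : Fin k → ℤ) :
    Module.IsReflexive (toricRing v) (reflexiveOf v b).toSubmodule := by
  let P := mulPairing (reflexiveOf v (-b)) (reflexiveOf v b)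
    fun f hf g hg => mul_mem_toricRing_of_neg hf hg
  refine ⟨(injective_iff_map_eq_zero _).2 fun x hx => ?_, fun Ψ => ?_⟩
  · obtain ⟨d, hd⟩ := hv.exists_mono_mem (-b)
    have h1 := congrArg Subtype.val (LinearMap.congr_fun hx (P ⟨mono d, hd⟩))
    have h2 : mono d * (x : Laurent n) = 0 := h1
    exact Subtype.ext ((mul_eq_zero.1 h2).resolve_left (mono_ne_zero d))
  · obtain ⟨g, hg, hg'⟩ := exists_multiplier_dual_reflexiveOf hv (-b) (Ψ.comp P)
    rw [neg_neg] at hg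
    refine ⟨⟨g, hg⟩, LinearMap.ext fun χ => Subtype.ext ?_⟩
    obtain ⟨h, hh, hχ⟩ := exists_multiplier_dual_reflexiveOf hv b χ
    have h1 : χ = P ⟨h, hh⟩ := LinearMap.ext fun t => Subtype.ext (hχ t)
    have h2 := hg' ⟨h, hh⟩
    rw [LinearMap.comp_apply, ← h1] at h2
    rw [h2, Module.Dual.eval_apply, hχ, mul_comm]

/-- Monomials deep in the dual cone serve as denominators, so linear relations over `ℂ[M]` can be
cleared to relations over `R`. -/
theorem exists_mono_mul_mem_toricRing (f : Laurent n) :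
    ∃ N : Fin k → ℤ, ∀ a : Fin n → ℤ, (∀ i, N i ≤ a ⬝ᵥ v i) → mono a * f ∈ toricRing v := by
  refine ⟨fun i => ∑ m ∈ f.coeff.support, |m ⬝ᵥ v i|, fun a ha m hm i => ?_⟩
  rw [Finsupp.mem_support_iff, coeff_mono_mul] at hm
  have h1 : |(m - a) ⬝ᵥ v i| ≤ ∑ m ∈ f.coeff.support, |m ⬝ᵥ v i| :=
    Finset.single_le_sum (f := fun m => |m ⬝ᵥ v i|) (fun _ _ => abs_nonneg _)
      (Finsupp.mem_support_iff.2 hm)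
  have h2 := neg_abs_le ((m - a) ⬝ᵥ v i)
  have h3 := ha i
  rw [sub_dotProduct] at h1 h2
  linarith

theorem rank_le_one_of_forall_pair {R M : Type*} [Ring R] [StrongRankCondition R] [AddCommGroup M]
    [Module R M] (h : ∀ x y : M, ∃ a b : R, (a ≠ 0 ∨ b ≠ 0) ∧ a • x + b • y = 0) :
    Module.rank R M ≤ 1 := by
  rw [← Nat.cast_one]
  refine rank_le fun s hs => ?_
  by_contra! hcard
  obtain ⟨x, hx, y, hy, hxy⟩ := Finset.one_lt_card.1 hcard
  have hs' : LinearIndepOn R id (s : Set M) := hs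
  have hs'' : LinearIndepOn R id ({x, y} : Set M) := hs'.mono (by
    intro z hz
    rcases hz with rfl | rfl
    exacts [hx, hy])
  obtain ⟨a, b, hab, h0⟩ := h x y
  have := (LinearIndepOn.pair_iff id hxy).1 hs'' a b h0
  tauto

theorem rank_eq_one_of_mono_mem (hv : IsConeGenerators v) (L : GradedSubmodule v)
    {m₀ : Fin n → ℤ} (hm₀ : mono m₀ ∈ L.toSubmodule) :
    Module.rank (toricRing v) L.toSubmodule = 1 := by
  apply le_antisymm
  · refine rank_le_one_of_forall_pair (R := toricRing v) (M := L.toSubmodule) fun x y => ?_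
    obtain ⟨N₁, h1⟩ := exists_mono_mul_mem_toricRing (v := v) (x : Laurent n)
    obtain ⟨N₂, h2⟩ := exists_mono_mul_mem_toricRing (v := v) (y : Laurent n)
    obtain ⟨a, ha⟩ := hv.exists_forall_le fun i => max (N₁ i) (N₂ i)
    have hX := h1 a fun i => (le_max_left _ _).trans (ha i)
    have hY := h2 a fun i => (le_max_right _ _).trans (ha i)
    by_cases hx : x = 0
    · exact ⟨1, 0, Or.inl one_ne_zero, by rw [hx, smul_zero, zero_smul, add_zero]⟩
    -- The relation is `y x - x y = 0`, with both coefficients multiplied by `x^a` to lie in `R`.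
    · refine ⟨⟨_, hY⟩, ⟨-(mono a * x), neg_mem hX⟩, Or.inr fun h0 => hx (Subtype.ext ?_),
        Subtype.ext ?_⟩
      · have : -(mono a * (x : Laurent n)) = 0 := congrArg Subtype.val h0
        exact (mul_eq_zero.1 (neg_eq_zero.1 this)).resolve_left (mono_ne_zero a)
      · change mono a * (y : Laurent n) * x + -(mono a * (x : Laurent n)) * y = 0
        ring
  · rw [Cardinal.one_le_iff_pos]
    refine (rank_pos_iff_exists_ne_zero (R := toricRing v) (M := L.toSubmodule)).2 ?_
    exact ⟨⟨mono m₀, hm₀⟩, fun h => mono_ne_zero m₀ (congrArg Subtype.val h)⟩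

theorem isRankOneReflexive_reflexiveOf (hv : IsConeGenerators v) (b : Fin k → ℤ) :
    (reflexiveOf v b).IsRankOneReflexive := by
  obtain ⟨m₀, hm₀⟩ := hv.exists_mono_mem b
  exact ⟨isReflexive_reflexiveOf hv b, rank_eq_one_of_mono_mem hv _ hm₀⟩

/-- The graded rank one reflexives are the modules `T(b)`. -/
theorem GradedSubmodule.IsRankOneReflexive.exists_eq_reflexiveOf (hv : IsConeGenerators v)
    {L : GradedSubmodule v} (hL : L.IsRankOneReflexive) : ∃ b, L = reflexiveOf v b := by
  obtain ⟨hrefl, hrank⟩ := hL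
  have hne : ∃ x : L.toSubmodule, x ≠ 0 := by
    refine (rank_pos_iff_exists_ne_zero (R := toricRing v) (M := L.toSubmodule)).1 ?_
    rw [hrank]
    exact zero_lt_one
  obtain ⟨x, hx⟩ := hne
  obtain ⟨m₀, hm₀⟩ : ∃ m₀, mono m₀ ∈ L.toSubmodule := by
    have hx' : (x : Laurent n).coeff ≠ 0 := fun h =>
      hx (Subtype.ext (AddMonoidAlgebra.coeff_eq_zero.1 h))
    obtain ⟨m, hm⟩ := Finsupp.support_nonempty_iff.2 hx'
    exact ⟨m, L.mono_mem x.2 hm⟩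
  -- Reflexivity makes evaluation injective, so the dual is nonzero. One degree `d` of one nonzero
  -- functional then bounds the degrees of `L` from below.
  obtain ⟨φ, hφ⟩ : ∃ φ : Module.Dual (toricRing v) L.toSubmodule, φ x ≠ 0 := by
    by_contra! h
    exact hx (hrefl.bijective_dual_eval'.1 (LinearMap.ext fun φ => by simpa using h φ))
  obtain ⟨h, hh⟩ := exists_multiplier_dual hv L hm₀ φ
  have h0 : h ≠ 0 := fun h0 => hφ (Subtype.ext (by rw [hh, h0, zero_mul]; rfl))
  obtain ⟨d, hd⟩ := Finsupp.support_nonempty_iff.2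
    (fun h' => h0 (AddMonoidAlgebra.coeff_eq_zero.1 h'))
  have mem_dual : ∀ (φ : Module.Dual (toricRing v) L.toSubmodule) (h : Laurent n),
      (∀ t, (φ t : Laurent n) = h * t) → ∀ d ∈ h.coeff.support, ∀ m, mono m ∈ L.toSubmodule →
        ∀ i, 0 ≤ (d + m) ⬝ᵥ v i := fun φ h hh d hd m hm => (φ (L.monoMem hm)).2 (d + m) (by
    rw [hh, Finsupp.mem_support_iff, mul_comm, coeff_mono_mul, add_sub_cancel_right]
    exact Finsupp.mem_support_iff.1 hd)
  have hbound := mem_dual φ h hh d hd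
  have hmin : ∀ i, ∃ b : ℤ, (∃ m, mono m ∈ L.toSubmodule ∧ m ⬝ᵥ v i = b) ∧
      ∀ z, (∃ m, mono m ∈ L.toSubmodule ∧ m ⬝ᵥ v i = z) → b ≤ z := fun i =>
    Int.exists_least_of_bdd ⟨-(d ⬝ᵥ v i), by
      rintro z ⟨m, hm, rfl⟩
      have := hbound m hm i
      rw [add_dotProduct] at this
      linarith⟩ ⟨_, m₀, hm₀, rfl⟩
  -- `b i` is the least pairing of a degree of `L` with `v i`, and it is attained.
  choose b hb hb' using hmin
  have hle : ∀ m, mono m ∈ L.toSubmodule → ∀ i, b i ≤ m ⬝ᵥ v i := fun m hm i =>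
    hb' i _ ⟨m, hm, rfl⟩
  refine ⟨b, GradedSubmodule.ext fun t => ⟨fun hm => mono_mem_reflexiveOf.2 (hle t hm),
    fun ht => ?_⟩⟩
  rw [mono_mem_reflexiveOf] at ht
  -- If `t` satisfies the inequalities, `x^t` times the multiplier of any `φ` lies in `R`: for each
  -- `i`, compare with a monomial of `L` attaining `b i`. Writing the product as `x^{t-m₀}
  -- φ(x^{m₀})` makes it visibly linear in `φ`.
  have hdual : ∀ φ : Module.Dual (toricRing v) L.toSubmodule,
      mono (t - m₀) * (φ (L.monoMem hm₀) : Laurent n) ∈ toricRing v := by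
    intro φ
    obtain ⟨h, hh⟩ := exists_multiplier_dual hv L hm₀ φ
    rw [hh, mul_left_comm, mono_mul_mono, sub_add_cancel]
    intro d hd i
    rw [mul_comm, Finsupp.mem_support_iff, coeff_mono_mul, ← Finsupp.mem_support_iff] at hd
    obtain ⟨m, hm, hmb⟩ := hb i
    have h1 := mem_dual φ h hh _ hd m hm i
    rw [add_dotProduct, sub_dotProduct, hmb] at h1
    linarith [ht i]
  let Ψ : Module.Dual (toricRing v) (Module.Dual (toricRing v) L.toSubmodule) :=
    { toFun := fun φ => ⟨_, hdual φ⟩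
      map_add' := fun φ ψ => Subtype.ext (mul_add _ _ _)
      map_smul' := fun r φ => Subtype.ext (mul_left_comm _ _ _) }
  -- Surjectivity of evaluation gives an element of `L` that acts on the dual as `x^t` does;
  -- cancelling a nonzero multiplier shows that it is `x^t`.
  obtain ⟨l, hl⟩ := hrefl.bijective_dual_eval'.2 Ψ
  have hlt : (l : Laurent n) = mono t := by
    have h1 : (φ l : Laurent n) = mono (t - m₀) * (φ (L.monoMem hm₀) : Laurent n) :=
      congrArg Subtype.val (LinearMap.congr_fun hl φ)
    rw [hh, hh, mul_left_comm, mono_mul_mono, sub_add_cancel] at h1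
    exact mul_left_cancel₀ h0 h1
  rw [← hlt]
  exact l.2

end Multiplier

/-! ### Endomorphisms as matrices of Laurent polynomials -/

section DirSum

variable {n k : ℕ} {v : Fin k → Fin n → ℤ} {ι : Type} (L : ι → GradedSubmodule v)

/-- The inclusion of a summand. -/
noncomputable def inclusion [DecidableEq ι] (i : ι) : (L i).toSubmodule →ₗ[toricRing v] DirSum L :=
  LinearMap.single (toricRing v) (fun i => (L i).toSubmodule) i

/-- The projection to a summand. -/
noncomputable def projection (i : ι) : DirSum L →ₗ[toricRing v] (L i).toSubmodule :=
  LinearMap.proj i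

variable {L}

theorem inclusion_apply_coe [DecidableEq ι] (i j : ι) (t : (L i).toSubmodule) :
    (inclusion L i t j : Laurent n) = if j = i then (t : Laurent n) else 0 := by
  by_cases h : j = i
  · subst h
    rw [if_pos rfl]
    exact congrArg Subtype.val (Pi.single_eq_same (M := fun i => (L i).toSubmodule) j t)
  · rw [if_neg h]
    exact congrArg Subtype.val (Pi.single_eq_of_ne (M := fun i => (L i).toSubmodule) h t)

theorem DirSum.ext_coe {s t : DirSum L} (h : ∀ i, (s i : Laurent n) = t i) : s = t :=
  funext fun i => Subtype.ext (h i)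

theorem DirSum.coe_sum_apply {α : Type*} (s : Finset α) (f : α → DirSum L) (i : ι) :
    ((∑ a ∈ s, f a) i : Laurent n) = ∑ a ∈ s, (f a i : Laurent n) :=
  map_sum ((L i).toSubmodule.subtype.comp (projection L i)) f s

theorem DirSum.sum_inclusion [Fintype ι] [DecidableEq ι] (t : DirSum L) :
    ∑ i, inclusion L i (t i) = t := by
  refine DirSum.ext_coe fun j => ?_
  rw [DirSum.coe_sum_apply]
  simp [inclusion_apply_coe]

theorem end_ext_coe {L : ι → GradedSubmodule v} {E F : Module.End (toricRing v) (DirSum L)}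
    (h : ∀ t i, (E t i : Laurent n) = F t i) : E = F :=
  LinearMap.ext fun t => DirSum.ext_coe (h t)

/-- Multiplication by a Laurent polynomial, as a map of graded submodules. -/
noncomputable def mulHom (L L' : GradedSubmodule v) (f : Laurent n)
    (hf : ∀ t ∈ L.toSubmodule, f * t ∈ L'.toSubmodule) :
    L.toSubmodule →ₗ[toricRing v] L'.toSubmodule where
  toFun t := ⟨f * t, hf t t.2⟩
  map_add' s t := Subtype.ext (mul_add f (s : Laurent n) t)
  map_smul' r t := Subtype.ext (mul_left_comm f (r : Laurent n) (t : Laurent n))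

end DirSum

/-! ### Degrees of morphisms and paths -/

section Degrees

variable {n k : ℕ} {v : Fin k → Fin n → ℤ} {ι : Type} {b : ι → Fin k → ℤ}

theorem coeff_mul_ne_zero {f g : Laurent n} {m : Fin n → ℤ} (h : (f * g).coeff m ≠ 0) :
    ∃ x y, f.coeff x ≠ 0 ∧ g.coeff y ≠ 0 ∧ x + y = m := by
  classical
  obtain ⟨x, hx, y, hy, hxy⟩ := Finset.mem_add.1
    (AddMonoidAlgebra.support_coeff_mul_subset f g (Finsupp.mem_support_iff.2 h))
  exact ⟨x, y, Finsupp.mem_support_iff.1 hx, Finsupp.mem_support_iff.1 hy, hxy⟩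

/-- The degrees of the paths in a set of arrows. -/
inductive Paths {ι : Type} {n : ℕ} (Γ : Set (Arrow ι n)) : ι → ι → (Fin n → ℤ) → Prop
  | nil (i : ι) : Paths Γ i i 0
  | cons {i l j : ι} {d m : Fin n → ℤ} : (⟨i, l, d⟩ : Arrow ι n) ∈ Γ → Paths Γ l j m →
      Paths Γ i j (d + m)

theorem Paths.trans {Γ : Set (Arrow ι n)} {i j l : ι} {m m' : Fin n → ℤ} (h : Paths Γ i j m)
    (h' : Paths Γ j l m') : Paths Γ i l (m + m') := by
  induction h with
  | nil => rwa [zero_add]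
  | cons ha _ ih => rw [add_assoc]; exact .cons ha (ih h')

theorem Paths.single {Γ : Set (Arrow ι n)} {a : Arrow ι n} (ha : a ∈ Γ) :
    Paths Γ a.src a.tgt a.deg := by
  have := Paths.cons (Γ := Γ) (i := a.src) (d := a.deg) ha (Paths.nil a.tgt)
  rwa [add_zero] at this

/-- There is a morphism `x^m : T(b i) → T(b j)`. -/
def IsHomDeg (v : Fin k → Fin n → ℤ) (b : ι → Fin k → ℤ) (i j : ι) (m : Fin n → ℤ) : Prop :=
  ∀ x, b j x ≤ m ⬝ᵥ v x + b i x

theorem isHomDeg_iff {i j : ι} {m : Fin n → ℤ} :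
    IsHomDeg v b i j m ↔ mono m ∈ (reflexiveOf v (b j - b i)).toSubmodule := by
  rw [mono_mem_reflexiveOf]
  exact forall_congr' fun x => by rw [Pi.sub_apply, sub_le_iff_le_add]

theorem IsHomDeg.trans {i j l : ι} {m m' : Fin n → ℤ} (h : IsHomDeg v b i j m)
    (h' : IsHomDeg v b j l m') : IsHomDeg v b i l (m + m') := fun x => by
  rw [add_dotProduct]
  linarith [h x, h' x]

theorem IsHomDeg.refl (i : ι) : IsHomDeg v b i i 0 := fun x => by
  rw [zero_dotProduct, zero_add]

theorem Paths.isHomDeg {Γ : Set (Arrow ι n)} (hΓ : ∀ a ∈ Γ, IsHomDeg v b a.src a.tgt a.deg)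
    {i j : ι} {m : Fin n → ℤ} (h : Paths Γ i j m) : IsHomDeg v b i j m := by
  induction h with
  | nil i => exact .refl i
  | cons ha _ ih => exact (hΓ _ ha).trans ih

end Degrees

/-! ### Matrix entries of endomorphisms of sums of the modules `T(b)`. -/

section Matrix

variable {n k : ℕ} {v : Fin k → Fin n → ℤ} {ι : Type} [Fintype ι] [DecidableEq ι]
  {b : ι → Fin k → ℤ}

/-- The sum of the modules `T(b i)`. -/
abbrev sumOf (v : Fin k → Fin n → ℤ) (b : ι → Fin k → ℤ) : ι → GradedSubmodule v :=
  fun i => reflexiveOf v (b i)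

/-- The endomorphism with the single matrix entry `f : T(b i) → T(b j)`. -/
noncomputable def elemEnd (b : ι → Fin k → ℤ) (i j : ι)
    (f : (reflexiveOf v (b j - b i)).toSubmodule) :
    Module.End (toricRing v) (DirSum (sumOf v b)) :=
  (inclusion (sumOf v b) j).comp <|
    (mulHom (reflexiveOf v (b i)) (reflexiveOf v (b j)) (f : Laurent n) fun t ht => by
      have := mul_mem_reflexiveOf f.2 ht
      rwa [sub_add_cancel] at this).comp (projection (sumOf v b) i)

theorem elemEnd_apply_coe (i j : ι) (f : (reflexiveOf v (b j - b i)).toSubmodule)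
    (t : DirSum (sumOf v b)) (l : ι) :
    (elemEnd b i j f t l : Laurent n) = if l = j then (f : Laurent n) * t i else 0 :=
  inclusion_apply_coe (L := sumOf v b) j l _

theorem elemEnd_add (i j : ι) (f g : (reflexiveOf v (b j - b i)).toSubmodule) :
    elemEnd b i j (f + g) = elemEnd b i j f + elemEnd b i j g := by
  refine end_ext_coe fun t l => ?_
  change _ = (elemEnd b i j f t l : Laurent n) + elemEnd b i j g t l
  simp only [elemEnd_apply_coe]
  split_ifs
  · exact add_mul _ _ _
  · rw [add_zero]

theorem elemEnd_smul (i j : ι) (c : ℂ) (f : (reflexiveOf v (b j - b i)).toSubmodule) :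
    elemEnd b i j (c • f) = c • elemEnd b i j f := by
  refine end_ext_coe fun t l => ?_
  change _ = c • (elemEnd b i j f t l : Laurent n)
  simp only [elemEnd_apply_coe]
  split_ifs
  · exact smul_mul_assoc _ _ _
  · rw [smul_zero]

variable (b) in
/-- The endomorphism with one matrix entry, as a linear map. -/
noncomputable def elemEndₗ (i j : ι) : (reflexiveOf v (b j - b i)).toSubmodule →ₗ[ℂ]
    Module.End (toricRing v) (DirSum (sumOf v b)) where
  toFun := elemEnd b i j
  map_add' := elemEnd_add i j
  map_smul' := elemEnd_smul i j

/-- `h` is the matrix of `E`. -/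
def HasMatrix {L : ι → GradedSubmodule v} (E : Module.End (toricRing v) (DirSum L))
    (h : ι → ι → Laurent n) : Prop :=
  ∀ t j, (E t j : Laurent n) = ∑ i, h i j * t i

theorem exists_hasMatrix (hv : IsConeGenerators v)
    (E : Module.End (toricRing v) (DirSum (sumOf v b))) :
    ∃ h, (∀ i j, h i j ∈ (reflexiveOf v (b j - b i)).toSubmodule) ∧ HasMatrix E h := by
  choose h hmem hh using fun i j => exists_multiplier_reflexiveOf hv (b i) (b j)
    ((projection (sumOf v b) j).comp (E.comp (inclusion (sumOf v b) i)))
  refine ⟨h, hmem, fun t j => ?_⟩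
  conv_lhs => rw [← DirSum.sum_inclusion t]
  rw [map_sum, DirSum.coe_sum_apply]
  exact Finset.sum_congr rfl fun i _ => hh i j (t i)

theorem HasMatrix.apply_inclusion {L : ι → GradedSubmodule v}
    {E : Module.End (toricRing v) (DirSum L)} {h : ι → ι → Laurent n} (hE : HasMatrix E h)
    (i j : ι) (t : (L i).toSubmodule) : (E (inclusion L i t) j : Laurent n) = h i j * t := by
  rw [hE]
  simp [inclusion_apply_coe]

theorem HasMatrix.unique (hv : IsConeGenerators v)
    {E : Module.End (toricRing v) (DirSum (sumOf v b))} {h h' : ι → ι → Laurent n}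
    (hE : HasMatrix E h) (hE' : HasMatrix E h') : h = h' := by
  funext i j
  obtain ⟨m, hm⟩ := hv.exists_mono_mem (b i)
  have := (hE.apply_inclusion i j ⟨mono m, hm⟩).symm.trans
    (hE'.apply_inclusion i j ⟨mono m, hm⟩)
  exact mul_right_cancel₀ (mono_ne_zero m) this

/-- Entries carry the source index before the target index, so composition multiplies the matrices
in the opposite order. -/
theorem HasMatrix.mul {L : ι → GradedSubmodule v} {E F : Module.End (toricRing v) (DirSum L)}
    {h h' : ι → ι → Laurent n} (hE : HasMatrix E h) (hF : HasMatrix F h') :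
    HasMatrix (E * F) (fun i j => ∑ l, h' i l * h l j) := by
  intro t j
  change (E (F t) j : Laurent n) = _
  rw [hE]
  simp only [hF t, Finset.mul_sum, Finset.sum_mul]
  rw [Finset.sum_comm]
  exact Finset.sum_congr rfl fun _ _ => Finset.sum_congr rfl fun _ _ => by ring

theorem HasMatrix.add {L : ι → GradedSubmodule v} {E F : Module.End (toricRing v) (DirSum L)}
    {h h' : ι → ι → Laurent n} (hE : HasMatrix E h) (hF : HasMatrix F h') :
    HasMatrix (E + F) (h + h') := by
  intro t j
  change (E t j : Laurent n) + F t j = _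
  rw [hE, hF, ← Finset.sum_add_distrib]
  exact Finset.sum_congr rfl fun _ _ => (add_mul _ _ _).symm

theorem hasMatrix_elemEnd (i j : ι) (f : (reflexiveOf v (b j - b i)).toSubmodule) :
    HasMatrix (elemEnd b i j f) (fun i' j' => if j' = j ∧ i' = i then (f : Laurent n) else 0) := by
  intro t l
  rw [elemEnd_apply_coe]
  by_cases h : l = j <;> simp [h]

/-- The endomorphism with a given matrix. -/
noncomputable def matEnd (h : ∀ i j, (reflexiveOf v (b j - b i)).toSubmodule) :
    Module.End (toricRing v) (DirSum (sumOf v b)) :=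
  ∑ i, ∑ j, elemEnd b i j (h i j)

theorem hasMatrix_matEnd (h : ∀ i j, (reflexiveOf v (b j - b i)).toSubmodule) :
    HasMatrix (matEnd h) (fun i j => (h i j : Laurent n)) := by
  intro t l
  rw [matEnd, LinearMap.sum_apply, DirSum.coe_sum_apply]
  refine Finset.sum_congr rfl fun i _ => ?_
  rw [LinearMap.sum_apply, DirSum.coe_sum_apply]
  simp [elemEnd_apply_coe]

theorem HasMatrix.eq {L : ι → GradedSubmodule v} {E F : Module.End (toricRing v) (DirSum L)}
    {h : ι → ι → Laurent n} (hE : HasMatrix E h) (hF : HasMatrix F h) : E = F :=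
  end_ext_coe fun t j => (hE t j).trans (hF t j).symm

/-! ### Generators of the endomorphism algebra -/

theorem isMonomialHom_elemEnd {i j : ι} {m : Fin n → ℤ}
    (hm : mono m ∈ (reflexiveOf v (b j - b i)).toSubmodule) :
    IsMonomialHom (sumOf v b) ⟨i, j, m⟩ (elemEnd b i j ⟨mono m, hm⟩) := fun t l =>
  elemEnd_apply_coe i j _ t l

theorem IsMonomialHom.unique {L : ι → GradedSubmodule v} {a : Arrow ι n}
    {E F : Module.End (toricRing v) (DirSum L)} (hE : IsMonomialHom L a E)
    (hF : IsMonomialHom L a F) : E = F :=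
  end_ext_coe fun t j => (hE t j).trans (hF t j).symm

theorem IsMonomialHom.hasMatrix {L : ι → GradedSubmodule v} {a : Arrow ι n}
    {E : Module.End (toricRing v) (DirSum L)} (hE : IsMonomialHom L a E) :
    HasMatrix E (fun i j => if j = a.tgt ∧ i = a.src then mono a.deg else 0) := by
  intro t l
  rw [hE]
  by_cases h : l = a.tgt <;> simp [h]

theorem exists_isMonomialHom_iff (hv : IsConeGenerators v) {a : Arrow ι n} :
    (∃ E, IsMonomialHom (sumOf v b) a E) ↔ IsHomDeg v b a.src a.tgt a.deg := by
  rw [isHomDeg_iff]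
  refine ⟨?_, fun h => ⟨_, isMonomialHom_elemEnd h⟩⟩
  rintro ⟨E, hE⟩
  obtain ⟨h, hmem, hh⟩ := exists_hasMatrix hv E
  have := congrFun (congrFun (hE.hasMatrix.unique hv hh) a.src) a.tgt
  rw [if_pos ⟨rfl, rfl⟩] at this
  rw [this]
  exact hmem _ _

/-- Endomorphisms whose entries are supported on degrees of paths form a subalgebra: trivial paths
account for scalars and concatenation for products. It contains the generators. -/
theorem paths_of_mem_adjoin (hv : IsConeGenerators v) {Γ : Set (Arrow ι n)}
    {E : Module.End (toricRing v) (DirSum (sumOf v b))}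
    (hE : E ∈ Algebra.adjoin ℂ
      ({E : Module.End (toricRing v) (DirSum (sumOf v b)) |
          ∃ a ∈ Γ, IsMonomialHom (sumOf v b) a E} ∪
        {E | ∃ i, IsMonomialHom (sumOf v b) ⟨i, i, 0⟩ E}))
    {h : ι → ι → Laurent n} (hh : HasMatrix E h) {i j : ι} {m : Fin n → ℤ}
    (hm : (h i j).coeff m ≠ 0) : Paths Γ i j m := by
  induction hE using Algebra.adjoin_induction generalizing h i j m with
  | mem E hE =>
    have aux : ∀ a : Arrow ι n, IsMonomialHom (sumOf v b) a E →
        j = a.tgt ∧ i = a.src ∧ m = a.deg := by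
      intro a ha
      rw [hh.unique hv ha.hasMatrix] at hm
      simp only at hm
      split_ifs at hm with hij
      · rw [coeff_mono] at hm
        by_cases hd : a.deg = m
        · exact ⟨hij.1, hij.2, hd.symm⟩
        · exact absurd (if_neg hd) hm
      · exact absurd rfl hm
    rcases hE with ⟨a, ha, hE⟩ | ⟨l, hE⟩
    · obtain ⟨rfl, rfl, rfl⟩ := aux a hE
      exact .single ha
    · obtain ⟨rfl, rfl, rfl⟩ := aux _ hE
      exact .nil _
  | algebraMap c =>
    have h1 : HasMatrix (algebraMap ℂ (Module.End (toricRing v) (DirSum (sumOf v b))) c)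
        (fun i j => if j = i then c • mono 0 else 0) := by
      intro t l
      change ((c • t : DirSum (sumOf v b)) l : Laurent n) = _
      change c • (t l : Laurent n) = _
      simp only [ite_mul, zero_mul, Finset.sum_ite_eq, Finset.mem_univ, if_true, mono_zero,
        smul_mul_assoc, one_mul]
    rw [hh.unique hv h1] at hm
    simp only at hm
    split_ifs at hm with hij
    · subst hij
      have : m = 0 := by
        by_contra hne
        refine hm ?_
        rw [AddMonoidAlgebra.coeff_smul, Finsupp.smul_apply, coeff_mono, if_neg (Ne.symm hne),
          smul_zero]
      rw [this]
      exact .nil _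
    · exact absurd rfl hm
  | add E F _ _ hE hF =>
    obtain ⟨e, -, he⟩ := exists_hasMatrix hv E
    obtain ⟨f, -, hf⟩ := exists_hasMatrix hv F
    rw [hh.unique hv (he.add hf)] at hm
    by_cases h0 : (e i j).coeff m = 0
    · refine hF hf fun h1 => hm ?_
      change (e i j).coeff m + (f i j).coeff m = 0
      rw [h0, h1, add_zero]
    · exact hE he h0
  | mul E F _ _ hE hF =>
    obtain ⟨e, -, he⟩ := exists_hasMatrix hv E
    obtain ⟨f, -, hf⟩ := exists_hasMatrix hv F
    rw [hh.unique hv (he.mul hf)] at hm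
    simp only [AddMonoidAlgebra.coeff_sum, Finsupp.finsetSum_apply] at hm
    obtain ⟨l, -, hl⟩ := Finset.exists_ne_zero_of_sum_ne_zero hm
    obtain ⟨x, y, hx, hy, rfl⟩ := coeff_mul_ne_zero hl
    exact (hF hf hx).trans (hE he hy)

/-- A set of arrows generates the endomorphism algebra if and only if all monomial morphisms are
paths. -/
theorem generates_iff (hv : IsConeGenerators v) {Γ : Set (Arrow ι n)} :
    Generates (sumOf v b) Γ ↔ (∀ a ∈ Γ, IsHomDeg v b a.src a.tgt a.deg) ∧
      ∀ i j m, IsHomDeg v b i j m → Paths Γ i j m := by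
  unfold Generates
  have h1 : (∀ a ∈ Γ, ∃ E, IsMonomialHom (sumOf v b) a E) ↔
      ∀ a ∈ Γ, IsHomDeg v b a.src a.tgt a.deg :=
    forall₂_congr fun a _ => exists_isMonomialHom_iff hv
  rw [h1]
  refine and_congr_right fun hΓ => ⟨fun h i j m hm => ?_, fun h => ?_⟩
  · rw [isHomDeg_iff] at hm
    have hE := hasMatrix_elemEnd i j ⟨mono m, hm⟩
    refine paths_of_mem_adjoin hv (by rw [h]; trivial) hE ?_
    simp
  · set A := Algebra.adjoin ℂ
      ({E : Module.End (toricRing v) (DirSum (sumOf v b)) |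
          ∃ a ∈ Γ, IsMonomialHom (sumOf v b) a E} ∪
        {E | ∃ i, IsMonomialHom (sumOf v b) ⟨i, i, 0⟩ E}) with hA
    -- Each monomial morphism is a product of generators along a path. Monomial morphisms span the
    -- endomorphism algebra over `ℂ`.
    have key : ∀ i j m, Paths Γ i j m → ∀ E, IsMonomialHom (sumOf v b) ⟨i, j, m⟩ E → E ∈ A := by
      intro i j m hp
      induction hp with
      | nil i => exact fun E hE => Algebra.subset_adjoin (Or.inr ⟨i, hE⟩)
      | @cons i l j d m ha hp ih =>
        intro E hE
        obtain ⟨F, hF⟩ := (exists_isMonomialHom_iff (b := b) hv).2 (hΓ _ ha)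
        obtain ⟨G, hG⟩ := (exists_isMonomialHom_iff (b := b) hv (a := ⟨l, j, m⟩)).2
          (hp.isHomDeg hΓ)
        have : E = G * F := by
          refine hE.unique fun t x => ?_
          change (G (F t) x : Laurent n) = _
          rw [hG, hF]
          by_cases hx : x = j
          · simp only [hx, if_true]
            rw [← mul_assoc, mono_mul_mono, add_comm]
          · simp [hx]
        rw [this]
        exact A.mul_mem (ih _ hG) (Algebra.subset_adjoin (Or.inl ⟨_, ha, hF⟩))
    rw [eq_top_iff]
    rintro E -
    obtain ⟨e, hmem, he⟩ := exists_hasMatrix hv E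
    rw [he.eq (hasMatrix_matEnd fun i j => ⟨e i j, hmem i j⟩), matEnd]
    refine A.sum_mem fun i _ => A.sum_mem fun j _ => ?_
    change elemEndₗ b i j _ ∈ A
    rw [← (reflexiveOf v (b j - b i)).coe_sum_coeff_smul ⟨e i j, hmem i j⟩, map_sum]
    refine A.sum_mem fun m _ => ?_
    rw [map_smul]
    have hm := (reflexiveOf v (b j - b i)).mono_mem (hmem i j) m.2
    exact A.smul_mem (key i j m (h i j m (isHomDeg_iff.2 hm)) _ (isMonomialHom_elemEnd hm)) _

end Matrix

/-! ### Characters of `M / MU` -/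

section Characters

variable {n g : ℕ} {U : Matrix (Fin n) (Fin n) ℤ} {rep : Fin g → Fin n → ℤ}

/-- The value of a character as a complex number. -/
noncomputable def charVal (ρ : CharGroup n) (m : Fin n → ℤ) : ℂ :=
  (ρ (Multiplicative.ofAdd m) : ℂˣ)

theorem charVal_add (ρ : CharGroup n) (m m' : Fin n → ℤ) :
    charVal ρ (m + m') = charVal ρ m * charVal ρ m' := by
  simp [charVal]

theorem charVal_ne_zero (ρ : CharGroup n) (m : Fin n → ℤ) : charVal ρ m ≠ 0 :=
  Units.ne_zero _

theorem charVal_mul (ρ τ : CharGroup n) (m : Fin n → ℤ) :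
    charVal (ρ * τ) m = charVal ρ m * charVal τ m := by
  simp [charVal]

theorem charVal_eq_one (ρ : quotGroup U) {m : Fin n → ℤ} (hm : m ∈ subLattice U) :
    charVal (ρ : CharGroup n) m = 1 := by
  rw [charVal, ρ.2 m hm, Units.val_one]

theorem charVal_sub (ρ : CharGroup n) (m m' : Fin n → ℤ) :
    charVal ρ (m - m') = (charVal ρ m')⁻¹ * charVal ρ m := by
  rw [eq_inv_mul_iff_mul_eq₀ (charVal_ne_zero _ _), ← charVal_add, add_sub_cancel]

theorem exists_sub_mem_subLattice
    (hrep : Function.Bijective fun r => (rep r : (Fin n → ℤ) ⧸ subLattice U)) (m : Fin n → ℤ) :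
    ∃ r, m - rep r ∈ subLattice U := by
  obtain ⟨r, hr⟩ := hrep.2 (m : (Fin n → ℤ) ⧸ subLattice U)
  refine ⟨r, ?_⟩
  have := QuotientAddGroup.eq.1 hr
  rwa [neg_add_eq_sub] at this

theorem eq_of_rep_sub_rep_mem
    (hrep : Function.Bijective fun r => (rep r : (Fin n → ℤ) ⧸ subLattice U)) {r s : Fin g}
    (h : rep s - rep r ∈ subLattice U) : r = s :=
  hrep.1 (QuotientAddGroup.eq.2 (by rwa [neg_add_eq_sub]))

/-- Dedekind's independence of characters on `M`. Restriction to the representatives loses nothing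
because characters in `G` are constant on cosets of `MU`. -/
theorem linearIndependent_charVal_rep
    (hrep : Function.Bijective fun r => (rep r : (Fin n → ℤ) ⧸ subLattice U)) :
    LinearIndependent ℂ fun (ρ : quotGroup U) (r : Fin g) => charVal (ρ : CharGroup n) (rep r) := by
  have h1 := linearIndependent_monoidHom (Multiplicative (Fin n → ℤ)) ℂ
  let e : quotGroup U → (Multiplicative (Fin n → ℤ) →* ℂ) := fun ρ =>
    (Units.coeHom ℂ).comp (ρ : CharGroup n)
  have he : Function.Injective e := fun ρ τ h => by
    refine Subtype.ext (MonoidHom.ext fun m => Units.ext ?_)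
    exact DFunLike.congr_fun h m
  have h2 := h1.comp e he
  rw [linearIndependent_iff'] at h2 ⊢
  intro s c hc ρ hρ
  refine h2 s c (funext fun m => ?_) ρ hρ
  obtain ⟨r, hr⟩ := exists_sub_mem_subLattice hrep m.toAdd
  have h3 := congrFun hc r
  simp only [Finset.sum_apply, Pi.smul_apply, smul_eq_mul, Pi.zero_apply] at h3 ⊢
  rw [← h3]
  refine Finset.sum_congr rfl fun τ _ => ?_
  have h4 := charVal_eq_one τ hr
  rw [charVal_sub, inv_mul_eq_one₀ (charVal_ne_zero _ _)] at h4
  exact congrArg (c τ * ·) h4.symm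

theorem finite_quotGroup
    (hrep : Function.Bijective fun r => (rep r : (Fin n → ℤ) ⧸ subLattice U)) :
    Finite (quotGroup U) :=
  (linearIndependent_charVal_rep hrep).finite

/-- The characters of the finite abelian group `M/MU` separate its points; pull one back to `M`. -/
theorem exists_charVal_ne_one
    (hrep : Function.Bijective fun r => (rep r : (Fin n → ℤ) ⧸ subLattice U)) {m : Fin n → ℤ}
    (hm : m ∉ subLattice U) : ∃ ρ : quotGroup U, charVal (ρ : CharGroup n) m ≠ 1 := by
  have : Finite ((Fin n → ℤ) ⧸ subLattice U) := Finite.of_surjective _ hrep.2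
  have hm' : (m : (Fin n → ℤ) ⧸ subLattice U) ≠ 0 := fun h =>
    hm ((QuotientAddGroup.eq_zero_iff m).1 h)
  obtain ⟨ψ, hψ⟩ := AddChar.exists_apply_ne_zero.2 hm'
  let ρ : CharGroup n := (ψ.toMonoidHom.comp
    (AddMonoidHom.toMultiplicative (QuotientAddGroup.mk' (subLattice U)))).toHomUnits
  have hρ : ∀ x, charVal ρ x = ψ (x : (Fin n → ℤ) ⧸ subLattice U) := fun x => rfl
  refine ⟨⟨ρ, fun x hx => Units.ext ?_⟩, ?_⟩
  · change charVal ρ x = 1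
    rw [hρ, (QuotientAddGroup.eq_zero_iff x).2 hx, AddChar.map_zero_eq_one]
  · change charVal ρ m ≠ 1
    rwa [hρ]

/-- Multiplication by `τ(m) ≠ 1` only permutes the summands. -/
theorem sum_charVal (hrep : Function.Bijective fun r => (rep r : (Fin n → ℤ) ⧸ subLattice U))
    [Fintype (quotGroup U)] {m : Fin n → ℤ} (hm : m ∉ subLattice U) :
    ∑ ρ : quotGroup U, charVal (ρ : CharGroup n) m = 0 := by
  obtain ⟨τ, hτ⟩ := exists_charVal_ne_one hrep hm
  have h : ∑ ρ : quotGroup U, charVal ((τ * ρ : quotGroup U) : CharGroup n) m =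
      ∑ ρ : quotGroup U, charVal (ρ : CharGroup n) m :=
    Equiv.sum_comp (Equiv.mulLeft τ) fun ρ : quotGroup U => charVal (ρ : CharGroup n) m
  simp only [Subgroup.coe_mul, charVal_mul, ← Finset.mul_sum] at h
  exact (mul_left_eq_self₀.1 h).resolve_left hτ

theorem charAct_mono (ρ : CharGroup n) (m : Fin n → ℤ) :
    charAct ρ (mono m) = charVal ρ m • mono m := by
  rw [charAct_single, smul_mono, mul_one]; rfl

end Characters

/-! ### The skew group ring -/

section Skew

variable {n k g : ℕ} {v : Fin k → Fin n → ℤ} {U : Matrix (Fin n) (Fin n) ℤ} {ι : Type}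
  {rep : Fin g → Fin n → ℤ}

theorem mono_mem_invariantRing {a : Fin n → ℤ} (ha : a ∈ subLattice U)
    (ha' : mono a ∈ toricRing v) : (⟨mono a, ha'⟩ : toricRing v) ∈ invariantRing v U := by
  intro ρ hρ
  change charAct ρ (mono a) = mono a
  rw [charAct_mono, charVal_eq_one ⟨ρ, hρ⟩ ha, one_smul]

/-- A character of `G` acts on `T` linearly over `R^G`. -/
noncomputable def sumActHom (L : ι → GradedSubmodule v) (ρ : quotGroup U) :
    Module.End (invariantRing v U) (DirSum L) where
  toFun := sumAct L ρ
  map_add' s t := DirSum.ext_coe fun i => map_add (charAct (ρ : CharGroup n)) (s i : Laurent n) (t i)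
  map_smul' r t := DirSum.ext_coe fun i => by
    change charAct (ρ : CharGroup n) (((r : toricRing v) : Laurent n) * t i) =
      ((r : toricRing v) : Laurent n) * charAct (ρ : CharGroup n) (t i)
    rw [map_mul, r.2 ρ ρ.2]

/-- Restriction of scalars from `End_R T` to `End_{R^G} T`. -/
noncomputable def restrictEnd (L : ι → GradedSubmodule v) (U : Matrix (Fin n) (Fin n) ℤ) :
    Module.End (toricRing v) (DirSum L) →+* Module.End (invariantRing v U) (DirSum L) where
  toFun E :=
    { toFun := E
      map_add' := map_add E
      map_smul' := fun r t => map_smul E (r : toricRing v) t }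
  map_one' := rfl
  map_mul' _ _ := rfl
  map_zero' := rfl
  map_add' _ _ := rfl

/-- The group `G` acts on `T` linearly over `R^G`. -/
noncomputable def sumActMonoidHom (L : ι → GradedSubmodule v) (U : Matrix (Fin n) (Fin n) ℤ) :
    quotGroup U →* Module.End (invariantRing v U) (DirSum L) where
  toFun := sumActHom L
  map_one' := LinearMap.ext fun t => sumAct_one L t
  map_mul' ρ τ := LinearMap.ext fun t => sumAct_mul L ρ τ t

/-- The defining relation of the skew group ring, which makes `skewHom` multiplicative. -/
theorem restrictEnd_smul_mul (L : ι → GradedSubmodule v)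
    (E : Module.End (toricRing v) (DirSum L)) (ρ : quotGroup U) :
    restrictEnd L U (ρ • E) * sumActMonoidHom L U ρ =
      sumActMonoidHom L U ρ * restrictEnd L U E := by
  refine LinearMap.ext fun t => ?_
  change sumAct L ρ (E (sumAct L (ρ : CharGroup n)⁻¹ (sumAct L ρ t))) = sumAct L ρ (E t)
  rw [← sumAct_mul, inv_mul_cancel (ρ : CharGroup n), sumAct_one]

/-- The map from the skew group ring to `End_{R^G} T`. -/
noncomputable def skewHom (L : ι → GradedSubmodule v) (U : Matrix (Fin n) (Fin n) ℤ) :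
    SkewGroupRing L U →+* Module.End (invariantRing v U) (DirSum L) :=
  SkewMonoidAlgebra.liftNCRingHom (restrictEnd L U) (sumActMonoidHom L U)
    fun {E ρ} => restrictEnd_smul_mul L E ρ

theorem skewHom_single_apply (L : ι → GradedSubmodule v) (ρ : quotGroup U)
    (E : Module.End (toricRing v) (DirSum L)) (t : DirSum L) :
    skewHom L U (SkewMonoidAlgebra.single ρ E) t = E (sumAct L ρ t) := by
  have : skewHom L U (SkewMonoidAlgebra.single ρ E) =
      restrictEnd L U E * sumActMonoidHom L U ρ :=
    SkewMonoidAlgebra.liftNC_single _ _ _ _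
  rw [this]
  rfl

theorem skewHom_apply [Fintype (quotGroup U)] (L : ι → GradedSubmodule v)
    (x : SkewGroupRing L U) (t : DirSum L) :
    skewHom L U x t = ∑ ρ : quotGroup U, x.coeff ρ (sumAct L ρ t) := by
  induction x using SkewMonoidAlgebra.induction_on with
  | zero => simp
  | single ρ E =>
    classical
    rw [skewHom_single_apply, Finset.sum_eq_single ρ]
    · simp
    · intro τ _ hτ
      simp [Ne.symm hτ]
    · simp
  | add x y hx hy =>
    rw [map_add, LinearMap.add_apply, hx, hy, ← Finset.sum_add_distrib]
    simp only [SkewMonoidAlgebra.coeff_add, Finsupp.add_apply, LinearMap.add_apply]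

variable [Fintype ι] [DecidableEq ι] {b : ι → Fin k → ℤ}

theorem sumAct_inclusion_mono (L : ι → GradedSubmodule v) (ρ : CharGroup n) (i : ι)
    {m : Fin n → ℤ} (hm : mono m ∈ (L i).toSubmodule) :
    sumAct L ρ (inclusion L i ((L i).monoMem hm)) =
      charVal ρ m • inclusion L i ((L i).monoMem hm) := by
  refine DirSum.ext_coe fun j => ?_
  change charAct ρ (inclusion L i ((L i).monoMem hm) j : Laurent n) =
    charVal ρ m • (inclusion L i ((L i).monoMem hm) j : Laurent n)
  rw [inclusion_apply_coe]
  split_ifs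
  · exact charAct_mono ρ m
  · rw [map_zero, smul_zero]

theorem end_map_complex_smul {L : ι → GradedSubmodule v}
    (E : Module.End (toricRing v) (DirSum L)) (c : ℂ) (t : DirSum L) : E (c • t) = c • E t := by
  rw [← algebraMap_smul (toricRing v) c t, map_smul, algebraMap_smul]

/-- The central formula: on a monomial of degree `m`, the element `∑ f_ρ ρ` acts through the Fourier
transform `∑ ρ(m) f_ρ` of its coefficients, which depends only on the coset of `m`. -/
theorem skewHom_apply_mono [Fintype (quotGroup U)] (x : SkewGroupRing (sumOf v b) U)
    {h : quotGroup U → ι → ι → Laurent n} (hh : ∀ ρ, HasMatrix (x.coeff ρ) (h ρ)) (i j : ι)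
    {m : Fin n → ℤ} (hm : mono m ∈ (sumOf v b i).toSubmodule) :
    (skewHom (sumOf v b) U x (inclusion (sumOf v b) i ((sumOf v b i).monoMem hm)) j : Laurent n) =
      (∑ ρ : quotGroup U, charVal (ρ : CharGroup n) m • h ρ i j) * mono m := by
  rw [skewHom_apply, DirSum.coe_sum_apply, Finset.sum_mul]
  refine Finset.sum_congr rfl fun ρ _ => ?_
  rw [sumAct_inclusion_mono, end_map_complex_smul]
  change charVal (ρ : CharGroup n) m •
    (x.coeff ρ (inclusion (sumOf v b) i ((sumOf v b i).monoMem hm)) j : Laurent n) = _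
  rw [(hh ρ).apply_inclusion, smul_mul_assoc]

theorem IsConeGenerators.exists_mono_mem_coset (hv : IsConeGenerators (ToricQuotient.newGens U v))
    (c : Fin k → ℤ) (μ : Fin n → ℤ) :
    ∃ m, m - μ ∈ subLattice U ∧ mono m ∈ (reflexiveOf v c).toSubmodule := by
  obtain ⟨a, ha⟩ := hv.exists_forall_le fun j => c j - μ ⬝ᵥ v j
  refine ⟨μ + a ᵥ* U, ⟨a, by simp⟩, mono_mem_reflexiveOf.2 fun i => ?_⟩
  rw [add_dotProduct, ← dotProduct_newGens]
  linarith [ha i]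

theorem IsConeGenerators.exists_mono_mem_coset_eq (hv : IsConeGenerators (ToricQuotient.newGens U v))
    (c : Fin k → ℤ) (μ : Fin n → ℤ) (i : Fin k) :
    ∃ m, m - μ ∈ subLattice U ∧ m ⬝ᵥ v i = c i ∧ mono m ∈ (reflexiveOf v c).toSubmodule := by
  obtain ⟨a, h1, h2⟩ := hv.exists_degree_coset μ i (c i) c
  refine ⟨μ + a ᵥ* U, ⟨a, by simp⟩, h1, mono_mem_reflexiveOf.2 fun j => ?_⟩
  by_cases hj : j = i
  · rw [hj, h1]
  · exact h2 j hj

theorem charVal_eq_of_sub_mem (ρ : quotGroup U) {m m' : Fin n → ℤ}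
    (h : m - m' ∈ subLattice U) : charVal (ρ : CharGroup n) m = charVal (ρ : CharGroup n) m' := by
  have := charVal_eq_one ρ h
  rwa [charVal_sub, inv_mul_eq_one₀ (charVal_ne_zero _ _), eq_comm] at this

/-- One monomial of `T(b i)` from each coset shows that the Fourier transform of every coefficient
vanishes; independence of characters then kills the coefficients. -/
theorem skewHom_injective (hv : IsConeGenerators v) (hv' : IsConeGenerators (newGens U v))
    (hrep : Function.Bijective fun r => (rep r : (Fin n → ℤ) ⧸ subLattice U)) :
    Function.Injective (skewHom (sumOf v b) U) := by
  rw [injective_iff_map_eq_zero]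
  intro x hx
  have := finite_quotGroup hrep
  have := Fintype.ofFinite (quotGroup U)
  choose h hmem hh using fun ρ => exists_hasMatrix hv (x.coeff ρ)
  have hzero : ∀ ρ i j d, (h ρ i j).coeff d = 0 := by
    intro ρ i j d
    refine Fintype.linearIndependent_iff.1 (linearIndependent_charVal_rep hrep)
      (fun ρ => (h ρ i j).coeff d) (funext fun r => ?_) ρ
    obtain ⟨m, hm, hm'⟩ := hv'.exists_mono_mem_coset (b i) (rep r)
    have h1 := skewHom_apply_mono x hh i j hm'
    rw [hx] at h1
    have h2 := (mul_eq_zero.1 h1.symm).resolve_right (mono_ne_zero m)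
    have h3 := congrArg (fun f : Laurent n => f.coeff d) h2
    simp only [AddMonoidAlgebra.coeff_sum, Finsupp.finsetSum_apply, AddMonoidAlgebra.coeff_smul,
      Finsupp.smul_apply, AddMonoidAlgebra.coeff_zero, Finsupp.zero_apply] at h3
    simp only [Finset.sum_apply, Pi.smul_apply, Pi.zero_apply]
    rw [← h3]
    exact Finset.sum_congr rfl fun ρ _ => by
      rw [charVal_eq_of_sub_mem ρ hm, smul_eq_mul, smul_eq_mul, mul_comm]
  refine SkewMonoidAlgebra.ext fun ρ => ?_
  refine end_ext_coe fun t j => ?_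
  rw [hh ρ]
  refine Finset.sum_eq_zero fun i _ => ?_
  have : h ρ i j = 0 := AddMonoidAlgebra.coeff_injective (Finsupp.ext fun d => hzero ρ i j d)
  rw [this, zero_mul]

/-- The action of a matrix entry of an `R^G`-linear endomorphism on a coset of degrees. -/
theorem exists_coset_multiplier (hv' : IsConeGenerators (newGens U v))
    (E : Module.End (invariantRing v U) (DirSum (sumOf v b))) (μ : Fin n → ℤ) (i j : ι) :
    ∃ h ∈ (reflexiveOf v (b j - b i)).toSubmodule,
      ∀ m (hm : mono m ∈ (sumOf v b i).toSubmodule), m - μ ∈ subLattice U →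
        (E (inclusion (sumOf v b) i ((sumOf v b i).monoMem hm)) j : Laurent n) = h * mono m := by
  obtain ⟨m₀, hm₀, hm₀'⟩ := hv'.exists_mono_mem_coset (b i) μ
  set f : (sumOf v b i).toSubmodule → Laurent n := fun t =>
    (E (inclusion (sumOf v b) i t) j : Laurent n) with hf
  have key : ∀ m (hm : mono m ∈ (sumOf v b i).toSubmodule), m - μ ∈ subLattice U →
      f ((sumOf v b i).monoMem hm) =
        (mono (-m₀) * f ((sumOf v b i).monoMem hm₀')) * mono m := by
    intro m hm hmμ
    obtain ⟨d, hd⟩ := (subLattice U).sub_mem hmμ hm₀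
    have hd' : d ᵥ* U = (m - μ) - (m₀ - μ) := hd
    rw [mono_mul_apply_eq hv' (sumOf v b i) f (fun a ha s t hst => ?_) hm hm₀'
      (d := d) (by rw [hd']; abel)]
    · rw [mul_right_comm, mono_mul_mono]
      congr 2
      abel
    · have ha' : mono (a ᵥ* U) ∈ toricRing v := mono_mem_toricRing.2 ha
      have hst' : inclusion (sumOf v b) i s =
          (⟨⟨_, ha'⟩, mono_mem_invariantRing ⟨a, rfl⟩ ha'⟩ : invariantRing v U) •
            inclusion (sumOf v b) i t := by
        have h1 : s = (⟨_, ha'⟩ : toricRing v) • t := Subtype.ext hst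
        rw [h1, map_smul]
        rfl
      simp only [hf]
      rw [hst', map_smul]
      rfl
  -- The multiplier satisfies the sharp inequalities because the coset contains, for each facet, a
  -- monomial of `T(b i)` lying on it.
  refine ⟨mono (-m₀) * f ((sumOf v b i).monoMem hm₀'), mem_reflexiveOf_of_mul_mem fun x => ?_, key⟩
  obtain ⟨m, h1, h2, h3⟩ := hv'.exists_mono_mem_coset_eq (b i) μ x
  exact ⟨m, h2, by rw [← key m h3 h1]; exact (E _ j).2⟩

theorem invEnd_ext {L : ι → GradedSubmodule v}
    {E F : Module.End (invariantRing v U) (DirSum L)}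
    (h : ∀ i j m (hm : mono m ∈ (L i).toSubmodule),
      (E (inclusion L i ((L i).monoMem hm)) j : Laurent n) =
        F (inclusion L i ((L i).monoMem hm)) j) : E = F := by
  have hsmul : ∀ (c : ℂ) (t : DirSum L), algebraMap ℂ (invariantRing v U) c • t = c • t :=
    fun c t => algebraMap_smul (toricRing v) c t
  have hc : ∀ (E : Module.End (invariantRing v U) (DirSum L)) (c : ℂ) (t : DirSum L),
      E (c • t) = c • E t := fun E c t => by rw [← hsmul, map_smul, hsmul]
  have key : ∀ i, ∀ t : (L i).toSubmodule, E (inclusion L i t) = F (inclusion L i t) := by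
    intro i t
    let φ : Module.End (invariantRing v U) (DirSum L) → (L i).toSubmodule →ₗ[ℂ] DirSum L :=
      fun E =>
        { toFun := fun t => E (inclusion L i t)
          map_add' := fun s t => by rw [map_add, map_add]
          map_smul' := fun c t => by
            rw [RingHom.id_apply, ← hc, ← algebraMap_smul (toricRing v) c t, map_smul,
              algebraMap_smul] }
    have : φ E = φ F := (L i).linearMap_ext fun m hm => DirSum.ext_coe fun j => h i j m hm
    exact LinearMap.congr_fun this t
  refine LinearMap.ext fun t => ?_
  rw [← DirSum.sum_inclusion t, map_sum, map_sum]
  exact Finset.sum_congr rfl fun i _ => key i _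

theorem skewHom_surjective (hv' : IsConeGenerators (newGens U v))
    (hrep : Function.Bijective fun r => (rep r : (Fin n → ℤ) ⧸ subLattice U)) :
    Function.Surjective (skewHom (sumOf v b) U) := by
  intro E
  have := finite_quotGroup hrep
  have := Fintype.ofFinite (quotGroup U)
  choose h hmem hh using fun r i j => exists_coset_multiplier hv' E (rep r) i j
  -- Fourier inversion: `f_ρ = |G|⁻¹ ∑_r ρ(m_r)⁻¹ h_r`. Orthogonality of characters leaves only the
  -- coset of `m` when this is evaluated on `x^m`.
  let H : quotGroup U → ∀ i j, (reflexiveOf v (b j - b i)).toSubmodule := fun ρ i j =>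
    ((Fintype.card (quotGroup U) : ℂ)⁻¹ • ∑ r, (charVal (ρ : CharGroup n) (rep r))⁻¹ •
      ⟨h r i j, hmem r i j⟩)
  have hH : ∀ ρ i j, (H ρ i j : Laurent n) = (Fintype.card (quotGroup U) : ℂ)⁻¹ •
      ∑ r, (charVal (ρ : CharGroup n) (rep r))⁻¹ • h r i j := by
    intro ρ i j
    change (Fintype.card (quotGroup U) : ℂ)⁻¹ • (reflexiveOf v (b j - b i)).toSubmodule.subtype
      (∑ r, (charVal (ρ : CharGroup n) (rep r))⁻¹ • ⟨h r i j, hmem r i j⟩) = _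
    rw [map_sum]
    rfl
  let x : SkewGroupRing (sumOf v b) U := ⟨Finsupp.equivFunOnFinite.symm fun ρ => matEnd (H ρ)⟩
  have hx : ∀ ρ, HasMatrix (x.coeff ρ) (fun i j => (H ρ i j : Laurent n)) := fun ρ =>
    hasMatrix_matEnd (H ρ)
  refine ⟨x, invEnd_ext fun i j m hm => ?_⟩
  rw [skewHom_apply_mono x hx i j hm]
  obtain ⟨r₀, hr₀⟩ := exists_sub_mem_subLattice hrep m
  rw [hh r₀ i j m hm hr₀]
  congr 1
  simp only [hH, Finset.smul_sum]
  rw [Finset.sum_comm, Finset.sum_eq_single r₀]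
  · have : ∀ ρ : quotGroup U, charVal (ρ : CharGroup n) m •
        (Fintype.card (quotGroup U) : ℂ)⁻¹ • (charVal (ρ : CharGroup n) (rep r₀))⁻¹ • h r₀ i j =
        (Fintype.card (quotGroup U) : ℂ)⁻¹ • h r₀ i j := by
      intro ρ
      rw [smul_smul, smul_smul, charVal_eq_of_sub_mem ρ hr₀, mul_right_comm,
        mul_inv_cancel₀ (charVal_ne_zero _ _), one_mul]
    simp only [this, Finset.sum_const, Finset.card_univ]
    rw [← Nat.cast_smul_eq_nsmul ℂ, smul_smul, mul_inv_cancel₀, one_smul]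
    exact Nat.cast_ne_zero.2 Fintype.card_ne_zero
  · intro r _ hr
    have hmr : m - rep r ∉ subLattice U := fun hmr => hr (eq_of_rep_sub_rep_mem hrep (by
      have := (subLattice U).sub_mem hmr hr₀
      rwa [sub_sub_sub_cancel_left] at this))
    have : ∀ ρ : quotGroup U, charVal (ρ : CharGroup n) m •
        (Fintype.card (quotGroup U) : ℂ)⁻¹ • (charVal (ρ : CharGroup n) (rep r))⁻¹ • h r i j =
        charVal (ρ : CharGroup n) (m - rep r) •
          ((Fintype.card (quotGroup U) : ℂ)⁻¹ • h r i j) := by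
      intro ρ
      rw [smul_smul, smul_smul, smul_smul, charVal_sub]
      congr 1
      ring
    simp only [this]
    rw [← Finset.sum_smul, sum_charVal hrep hmr, zero_smul]
  · simp

end Skew

/-! ### Projective dimension over crossed products -/

section CrossedProduct

open CategoryTheory

/-- `B` is the skew group ring of `G` over `A`: the elements `u ρ` form a left `A`-basis of `B`
and satisfy `u ρ a = (ρ a) u ρ`. -/
structure IsCrossedProduct {A B G : Type} [Ring A] [Ring B] [Group G] [Fintype G]
    [MulSemiringAction G A] (f : A →+* B) (u : G →* B) : Prop where
  comm : ∀ ρ a, u ρ * f a = f (ρ • a) * u ρ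
  bijective : Function.Bijective fun c : G → A => ∑ ρ, f (c ρ) * u ρ

variable {A B G : Type} [Ring A] [Ring B] [Group G] [Fintype G] [MulSemiringAction G A]
  {f : A →+* B} {u : G →* B}

namespace IsCrossedProduct

/-- `B` is free over `A`, so a summand of a free `B`-module is a summand of a free `A`-module. -/
theorem projective_restrict (h : IsCrossedProduct f u) {M : Type} [AddCommGroup M] [Module A M]
    [Module B M] (hM : ∀ (a : A) (m : M), a • m = f a • m) [Module.Projective B M] :
    Module.Projective A M := by
  let _ : Module A B := Module.compHom B f
  have hB : ∀ (a : A) (x : B), a • x = f a * x := fun _ _ => rfl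
  let e : (G → A) →ₗ[A] B :=
    { toFun := fun c => ∑ ρ, f (c ρ) * u ρ
      map_add' := fun c d => by
        rw [← Finset.sum_add_distrib]
        exact Finset.sum_congr rfl fun ρ _ => by rw [Pi.add_apply, map_add, add_mul]
      map_smul' := fun a c => by
        rw [RingHom.id_apply, hB, Finset.mul_sum]
        exact Finset.sum_congr rfl fun ρ _ => by
          rw [Pi.smul_apply, smul_eq_mul, map_mul, mul_assoc] }
  have : Module.Free A B := Module.Free.of_equiv (LinearEquiv.ofBijective e h.bijective)
  obtain ⟨s, hs⟩ := Module.projective_def'.1 (inferInstance : Module.Projective B M)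
  let s' : M →ₗ[A] (M →₀ B) :=
    { toFun := s
      map_add' := map_add s
      map_smul' := fun a m => by
        rw [hM, map_smul]
        rfl }
  let p' : (M →₀ B) →ₗ[A] M :=
    { toFun := Finsupp.linearCombination B id
      map_add' := map_add _
      map_smul' := fun a x => by
        rw [RingHom.id_apply, hM, ← map_smul]
        rfl }
  exact Module.Projective.of_split s' p' (LinearMap.ext fun m => LinearMap.congr_fun hs m)

theorem apply_smul_comm (h : IsCrossedProduct f u) {M P : Type} [AddCommGroup M] [Module B M]
    [AddCommGroup P] [Module B P] (s : M →+ P) (hf : ∀ a m, s (f a • m) = f a • s m)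
    (hu : ∀ ρ m, s (u ρ • m) = u ρ • s m) (x : B) (m : M) : s (x • m) = x • s m := by
  obtain ⟨c, rfl⟩ := h.bijective.2 x
  simp only [Finset.sum_smul, map_sum, mul_smul, hf, hu]

/-- Maschke's argument: an `A`-linear section `s` of a free cover is replaced by its average `t =
|G|⁻¹ ∑ ρ s ρ⁻¹`, which is `B`-linear and still a section. -/
theorem projective_of_restrict (h : IsCrossedProduct f u) (hcard : IsUnit (Fintype.card G : B))
    {M : Type} [AddCommGroup M] [Module A M]
    [Module B M] (hM : ∀ (a : A) (m : M), a • m = f a • m) [Module.Projective A M] :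
    Module.Projective B M := by
  let _ : Module A (M →₀ B) := Module.compHom _ f
  have hP : ∀ (a : A) (x : M →₀ B), a • x = f a • x := fun _ _ => rfl
  let p : (M →₀ B) →ₗ[B] M := Finsupp.linearCombination B id
  let p' : (M →₀ B) →ₗ[A] M :=
    { toFun := p
      map_add' := map_add _
      map_smul' := fun a x => by rw [RingHom.id_apply, hM, hP, map_smul] }
  obtain ⟨s, hs⟩ := Module.projective_lifting_property p' LinearMap.id fun m =>
    ⟨Finsupp.single m 1, by
      change Finsupp.linearCombination B id (Finsupp.single m (1 : B)) = m
      simp⟩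
  have hs' : ∀ m, p (s m) = m := fun m => LinearMap.congr_fun hs m
  obtain ⟨w, hw⟩ := hcard
  have hwcomm : ∀ x : B, x * (w⁻¹ : Bˣ) = (w⁻¹ : Bˣ) * x := fun x =>
    ((hw ▸ Nat.cast_commute (Fintype.card G) x : Commute (w : B) x).units_inv_left).symm.eq
  let t : M →+ (M →₀ B) :=
    { toFun := fun m => ((w⁻¹ : Bˣ) : B) • ∑ ρ, u ρ • s (u ρ⁻¹ • m)
      map_zero' := by simp
      map_add' := fun m m' => by
        rw [← smul_add, ← Finset.sum_add_distrib]
        simp only [smul_add, map_add] }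
  have ht : ∀ m, t m = ((w⁻¹ : Bˣ) : B) • ∑ ρ, u ρ • s (u ρ⁻¹ • m) := fun _ => rfl
  have hucomm : ∀ ρ a, u ρ⁻¹ * f a = f (ρ⁻¹ • a) * u ρ⁻¹ := fun ρ a => h.comm ρ⁻¹ a
  have huu : ∀ ρ τ, u ρ * u τ = u (ρ * τ) := fun ρ τ => (map_mul u ρ τ).symm
  have hlin : ∀ (x : B) m, t (x • m) = x • t m := by
    refine h.apply_smul_comm t (fun a m => ?_) fun τ m => ?_
    · rw [ht, ht, smul_smul (f a), hwcomm, mul_smul]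
      congr 1
      rw [Finset.smul_sum]
      refine Finset.sum_congr rfl fun ρ _ => ?_
      rw [smul_smul, hucomm, mul_smul, ← hM, map_smul, hP, smul_smul, h.comm, smul_inv_smul,
        mul_smul]
    · rw [ht, ht, smul_smul (u τ), hwcomm, mul_smul]
      congr 1
      rw [Finset.smul_sum]
      refine Fintype.sum_equiv (Equiv.mulLeft τ⁻¹) _ _ fun ρ => ?_
      rw [Equiv.coe_mulLeft, smul_smul, huu, smul_smul, huu, mul_inv_cancel_left, mul_inv_rev,
        inv_inv]
  let t' : M →ₗ[B] (M →₀ B) := { t with map_smul' := hlin }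
  refine Module.Projective.of_split t' p (LinearMap.ext fun m => ?_)
  change p (((w⁻¹ : Bˣ) : B) • ∑ ρ, u ρ • s (u ρ⁻¹ • m)) = m
  rw [map_smul, map_sum]
  have : ∀ ρ, p (u ρ • s (u ρ⁻¹ • m)) = m := fun ρ => by
    rw [map_smul, hs', smul_smul, huu, mul_inv_cancel, map_one, one_smul]
  simp only [this, Finset.sum_const, Finset.card_univ]
  rw [← Nat.cast_smul_eq_nsmul B, ← hw, smul_smul, Units.inv_mul, one_smul]

/-- Dimension shifting along the free cover `B^(M) → M`, whose source is projective over `A` as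
well. -/
theorem hasProjectiveDimensionLE_iff (h : IsCrossedProduct f u)
    (hcard : IsUnit (Fintype.card G : B)) (d : ℕ) {M : Type} [AddCommGroup M] [Module A M]
    [Module B M] (hM : ∀ (a : A) (m : M), a • m = f a • m) :
    HasProjectiveDimensionLE (ModuleCat.of B M) d ↔
      HasProjectiveDimensionLE (ModuleCat.of A M) d := by
  induction d generalizing M with
  | zero =>
    rw [← projective_iff_hasProjectiveDimensionLE_zero,
      ← projective_iff_hasProjectiveDimensionLE_zero, ← IsProjective.iff_projective,
      ← IsProjective.iff_projective]
    exact ⟨fun _ => h.projective_restrict hM, fun _ => h.projective_of_restrict hcard hM⟩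
  | succ d ih =>
    let _ : Module A (M →₀ B) := Module.compHom _ f
    have hP : ∀ (a : A) (x : M →₀ B), a • x = f a • x := fun _ _ => rfl
    let p : (M →₀ B) →ₗ[B] M := Finsupp.linearCombination B id
    have hp : Function.Surjective p := fun m => ⟨Finsupp.single m 1, by simp [p]⟩
    let p' : (M →₀ B) →ₗ[A] M :=
      { toFun := p
        map_add' := map_add _
        map_smul' := fun a x => by rw [RingHom.id_apply, hM, hP, map_smul] }
    let _ : Module A (LinearMap.ker p) := Module.compHom _ f
    have hK : ∀ (a : A) (x : LinearMap.ker p), a • x = f a • x := fun _ _ => rfl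
    have : Module.Projective A (M →₀ B) := h.projective_restrict hP
    -- Both kernels are the same group with the same action of `A`, obtained once before and once
    -- after restriction of scalars.
    let e : LinearMap.ker p' ≃ₗ[A] LinearMap.ker p :=
      { toFun := fun x => ⟨x.1, x.2⟩
        invFun := fun x => ⟨x.1, x.2⟩
        map_add' := fun _ _ => rfl
        map_smul' := fun _ _ => rfl
        left_inv := fun _ => rfl
        right_inv := fun _ => rfl }
    have h1 := (LinearMap.shortExact_shortComplexKer hp).hasProjectiveDimensionLT_X₃_iff d
      ((IsProjective.iff_projective _).1 (inferInstance : Module.Projective B (M →₀ B)))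
    have h2 := (LinearMap.shortExact_shortComplexKer (f := p') hp).hasProjectiveDimensionLT_X₃_iff d
      ((IsProjective.iff_projective _).1 this)
    refine h1.trans (((ih hK).trans ?_).trans h2.symm)
    exact ⟨fun _ => ModuleCat.hasProjectiveDimensionLE_of_linearEquiv
        (M := ModuleCat.of A (LinearMap.ker p)) (N := ModuleCat.of A (LinearMap.ker p')) e.symm d,
      fun _ => ModuleCat.hasProjectiveDimensionLE_of_linearEquiv
        (M := ModuleCat.of A (LinearMap.ker p')) (N := ModuleCat.of A (LinearMap.ker p)) e d⟩

end IsCrossedProduct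

theorem hasProjectiveDimensionLE_of_split {R M N : Type} [Ring R] [AddCommGroup M] [Module R M]
    [AddCommGroup N] [Module R N] (i : M →ₗ[R] N) (r : N →ₗ[R] M) (hri : r.comp i = LinearMap.id)
    (d : ℕ) [HasProjectiveDimensionLE (ModuleCat.of R N) d] :
    HasProjectiveDimensionLE (ModuleCat.of R M) d :=
  Retract.hasProjectiveDimensionLT (X := ModuleCat.of R M) (Y := ModuleCat.of R N)
    { i := ModuleCat.ofHom i
      r := ModuleCat.ofHom r
      retract := by rw [← ModuleCat.ofHom_comp, hri]; rfl } (d + 1)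

theorem hasProjectiveDimensionLE_pi {R : Type} [Ring R] (d : ℕ) {α : Type} [Finite α]
    (M : α → Type) [∀ i, AddCommGroup (M i)] [∀ i, Module R (M i)]
    (hM : ∀ i, HasProjectiveDimensionLE (ModuleCat.of R (M i)) d) :
    HasProjectiveDimensionLE (ModuleCat.of R (∀ i, M i)) d := by
  let e := ModuleCat.biproductIsoPi fun i => ModuleCat.of R (M i)
  have : HasProjectiveDimensionLE (Limits.biproduct fun i => ModuleCat.of R (M i)) d := by
    have := Fintype.ofFinite α
    let _ := HasExt.standard (ModuleCat.{0} R)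
    rw [HasProjectiveDimensionLE, hasProjectiveDimensionLT_iff]
    intro i hi Y x
    have hsub : ∀ j, Subsingleton (Abelian.Ext (ModuleCat.of R (M j)) Y i) := fun j =>
      have := hM j
      HasProjectiveDimensionLT.subsingleton _ (d + 1) i hi Y
    -- `Ext` out of a finite biproduct is the product of the `Ext` groups, all of which vanish.
    exact (Abelian.Ext.biproductAddEquiv (Limits.biproduct.isBilimit fun i => ModuleCat.of R (M i))
      Y i).injective (Subsingleton.elim _ _)
  exact hasProjectiveDimensionLT_of_iso e (d + 1)

/-- For `s ≠ 0` one has `S = Bs = ∑_ρ A(ρs)`. Finite generation is what provides a maximal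
`A`-submodule. -/
theorem IsCrossedProduct.finite_restrict (h : IsCrossedProduct f u) {S : Type} [AddCommGroup S]
    [Module A S] [Module B S] (hS : ∀ (a : A) (m : S), a • m = f a • m) [IsSimpleModule B S] :
    Module.Finite A S := by
  have : Nontrivial S := IsSimpleModule.nontrivial B S
  obtain ⟨s, hs⟩ := exists_ne (0 : S)
  refine ⟨Submodule.fg_def.2 ⟨Set.range fun ρ => u ρ • s, Set.finite_range _, ?_⟩⟩
  rw [eq_top_iff]
  rintro m -
  have hm : m ∈ Submodule.span B {s} := by
    rw [IsSimpleModule.span_singleton_eq_top B hs]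
    trivial
  obtain ⟨x, rfl⟩ := Submodule.mem_span_singleton.1 hm
  obtain ⟨c, rfl⟩ := h.bijective.2 x
  simp only [Finset.sum_smul, mul_smul, ← hS]
  exact Submodule.sum_mem _ fun ρ _ => Submodule.smul_mem _ _ (Submodule.subset_span ⟨ρ, rfl⟩)

/-- The twist of a submodule by a group element. -/
def IsCrossedProduct.twist (h : IsCrossedProduct f u) {S : Type} [AddCommGroup S]
    [Module A S] [Module B S] (hS : ∀ (a : A) (m : S), a • m = f a • m) (ρ : G)
    (K : Submodule A S) : Submodule A S where
  carrier := {s | u ρ • s ∈ K}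
  zero_mem' := by
    change u ρ • (0 : S) ∈ K
    rw [smul_zero]
    exact K.zero_mem
  add_mem' {s t} hs ht := by
    change u ρ • (s + t) ∈ K
    rw [smul_add]
    exact K.add_mem hs ht
  smul_mem' a s hs := by
    change u ρ • a • s ∈ K
    rw [hS, smul_smul, h.comm, mul_smul, ← hS]
    exact K.smul_mem _ hs

/-- Twisting is an automorphism of the lattice of submodules. -/
def IsCrossedProduct.twistIso (h : IsCrossedProduct f u) {S : Type} [AddCommGroup S]
    [Module A S] [Module B S] (hS : ∀ (a : A) (m : S), a • m = f a • m) (ρ : G) :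
    Submodule A S ≃o Submodule A S where
  toFun := h.twist hS ρ
  invFun := h.twist hS ρ⁻¹
  left_inv K := by
    ext s
    change u ρ • u ρ⁻¹ • s ∈ K ↔ s ∈ K
    rw [smul_smul, ← map_mul, mul_inv_cancel, map_one, one_smul]
  right_inv K := by
    ext s
    change u ρ⁻¹ • u ρ • s ∈ K ↔ s ∈ K
    rw [smul_smul, ← map_mul, inv_mul_cancel, map_one, one_smul]
  map_rel_iff' {K K'} := by
    refine ⟨fun hK s hs => ?_, fun hK s hs => hK hs⟩
    have := @hK (u ρ⁻¹ • s) (by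
      change u ρ • u ρ⁻¹ • s ∈ K
      rwa [smul_smul, ← map_mul, mul_inv_cancel, map_one, one_smul])
    change u ρ • u ρ⁻¹ • s ∈ K' at this
    rwa [smul_smul, ← map_mul, mul_inv_cancel, map_one, one_smul] at this

/-- The intersection of all twists is stable under `A` and `G`, hence a `B`-submodule; it is proper,
so it vanishes by simplicity. -/
theorem IsCrossedProduct.iInf_twist_eq_bot (h : IsCrossedProduct f u) {S : Type} [AddCommGroup S]
    [Module A S] [Module B S] (hS : ∀ (a : A) (m : S), a • m = f a • m) [IsSimpleModule B S]
    {K : Submodule A S} (hK : K ≠ ⊤) : ⨅ ρ, h.twist hS ρ K = ⊥ := by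
  let N : Submodule B S :=
    { carrier := {s | ∀ ρ, u ρ • s ∈ K}
      zero_mem' := fun ρ => by
        rw [smul_zero]
        exact K.zero_mem
      add_mem' := fun hs ht ρ => by
        rw [smul_add]
        exact K.add_mem (hs ρ) (ht ρ)
      smul_mem' := fun x s hs ρ => by
        obtain ⟨c, rfl⟩ := h.bijective.2 x
        simp only [Finset.sum_smul, Finset.smul_sum]
        refine K.sum_mem fun τ _ => ?_
        rw [smul_smul, ← mul_assoc, h.comm, mul_assoc, ← map_mul, mul_smul, ← hS]
        exact K.smul_mem _ (hs _) }
  have hN : N = ⊥ := by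
    refine (eq_bot_or_eq_top N).resolve_right fun hN => hK ?_
    rw [eq_top_iff]
    rintro s -
    have hs : s ∈ N := by
      rw [hN]
      trivial
    have := hs 1
    rwa [map_one, one_smul] at this
  rw [eq_bot_iff]
  intro s hs
  have hs' : s ∈ N := fun ρ => (Submodule.mem_iInf _).1 hs ρ
  rw [hN] at hs'
  exact hs'

theorem IsCrossedProduct.projectiveDimension_eq (h : IsCrossedProduct f u)
    (hcard : IsUnit (Fintype.card G : B)) {d : ℕ}
    (hA : ∀ (S : Type) [AddCommGroup S] [Module A S], IsSimpleModule A S →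
      projectiveDimension (ModuleCat.of A S) = d)
    (S : Type) [AddCommGroup S] [Module B S] [IsSimpleModule B S] :
    projectiveDimension (ModuleCat.of B S) = d := by
  let _ : Module A S := Module.compHom S f
  have hS : ∀ (a : A) (m : S), a • m = f a • m := fun _ _ => rfl
  have : Nontrivial S := IsSimpleModule.nontrivial B S
  have := h.finite_restrict hS
  obtain ⟨K, hK, -⟩ := (eq_top_or_exists_le_coatom (⊥ : Submodule A S)).resolve_left bot_ne_top
  have hsimple : ∀ ρ, IsSimpleModule A (S ⧸ h.twist hS ρ K) := fun ρ =>
    isSimpleModule_iff_isCoatom.2 (((h.twistIso hS ρ).isCoatom_iff K).2 hK)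
  -- `S` embeds into a finite product of simple `A`-modules. So it is semisimple over `A`, a summand
  -- of that product (upper bound), and has each simple quotient as a summand (lower bound).
  let i : S →ₗ[A] ∀ ρ, S ⧸ h.twist hS ρ K := LinearMap.pi fun ρ => (h.twist hS ρ K).mkQ
  have hi : Function.Injective i := by
    rw [← LinearMap.ker_eq_bot, LinearMap.ker_pi]
    simp only [Submodule.ker_mkQ]
    exact h.iInf_twist_eq_bot hS hK.1
  have : IsSemisimpleModule A S := IsSemisimpleModule.of_injective i hi
  apply le_antisymm
  · rw [projectiveDimension_le_iff, h.hasProjectiveDimensionLE_iff hcard d hS]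
    have := hasProjectiveDimensionLE_pi (R := A) d (fun ρ => S ⧸ h.twist hS ρ K) fun ρ =>
      (projectiveDimension_le_iff _ _).1 (hA _ (hsimple ρ)).le
    obtain ⟨r, hr⟩ := IsSemisimpleModule.extension_property i hi LinearMap.id
    exact hasProjectiveDimensionLE_of_split i r hr d
  · rw [projectiveDimension_ge_iff]
    intro hlt
    -- Negative projective dimension would mean `S = 0`, so `d = 0` is treated apart; for `d = e +
    -- 1` the simple summand would have projective dimension at most `e`.
    rcases d with _ | e
    · rw [hasProjectiveDimensionLT_zero_iff_isZero, ModuleCat.isZero_iff_subsingleton] at hlt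
      exact not_subsingleton S hlt
    · have hle := (h.hasProjectiveDimensionLE_iff hcard e hS).1 hlt
      obtain ⟨r, hr⟩ := IsSemisimpleModule.lifting_property (h.twist hS 1 K).mkQ
        (Submodule.mkQ_surjective _) LinearMap.id
      have := hasProjectiveDimensionLE_of_split r (h.twist hS 1 K).mkQ hr e
      rw [← projectiveDimension_le_iff, hA _ (hsimple 1)] at this
      have h2 : e + 1 ≤ e := by exact_mod_cast this
      omega

theorem IsCrossedProduct.isHomologicallyHomogeneous (h : IsCrossedProduct f u)
    (hcard : IsUnit (Fintype.card G : B)) (hA : IsHomologicallyHomogeneous A) :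
    IsHomologicallyHomogeneous B := by
  obtain ⟨d, hd⟩ := hA
  exact ⟨d, fun S _ _ _ => h.projectiveDimension_eq hcard hd S⟩

end CrossedProduct

/-! ### The quotient as a toric variety -/

section Subst

variable {n k g : ℕ} {v : Fin k → Fin n → ℤ} {U : Matrix (Fin n) (Fin n) ℤ} {ι : Type}
  {rep : Fin g → Fin n → ℤ}

theorem subst_coeff_eq (f : Laurent n) :
    (subst U f).coeff = f.coeff.mapDomain fun m => m ᵥ* U := by
  induction f using AddMonoidAlgebra.induction_linear with
  | zero => simp
  | add f g hf hg =>
    rw [map_add, AddMonoidAlgebra.coeff_add, hf, hg, AddMonoidAlgebra.coeff_add,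
      Finsupp.mapDomain_add]
  | single a c =>
    simp [subst]

theorem coeff_subst (hU : U.det ≠ 0) (f : Laurent n) (m : Fin n → ℤ) :
    (subst U f).coeff (m ᵥ* U) = f.coeff m := by
  rw [subst_coeff_eq]
  exact Finsupp.mapDomain_apply (vecMul_injective_of_det_ne_zero hU) _ _

theorem coeff_subst_of_notMem (f : Laurent n) {a : Fin n → ℤ} (ha : a ∉ subLattice U) :
    (subst U f).coeff a = 0 := by
  rw [subst_coeff_eq]
  exact Finsupp.mapDomain_of_notMem_range _ _ ha

theorem subst_injective (hU : U.det ≠ 0) : Function.Injective (subst U) := fun f h hfh =>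
  AddMonoidAlgebra.coeff_injective (Finsupp.ext fun m => by
    rw [← coeff_subst hU, hfh, coeff_subst hU])

/-- The Laurent polynomial `∑ₘ cₘ x^m`, where `cₘ` is the coefficient of `f` at `μ + mU`. -/
noncomputable def cosetPart (hU : U.det ≠ 0) (μ : Fin n → ℤ) (f : Laurent n) : Laurent n :=
  AddMonoidAlgebra.ofCoeff (f.coeff.comapDomain (fun m => μ + m ᵥ* U)
    ((add_right_injective μ).comp (vecMul_injective_of_det_ne_zero hU)).injOn)

theorem coeff_cosetPart (hU : U.det ≠ 0) (μ : Fin n → ℤ) (f : Laurent n) (m : Fin n → ℤ) :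
    (cosetPart hU μ f).coeff m = f.coeff (μ + m ᵥ* U) := rfl

/-- The `r`-th summand is supported on the coset of `rep r`, so coefficients on one coset see a
single summand. -/
theorem coeff_cosetSum (hU : U.det ≠ 0)
    (hrep : Function.Bijective fun r => (rep r : (Fin n → ℤ) ⧸ subLattice U))
    (F : Fin g → Laurent n) (r₀ : Fin g) (m : Fin n → ℤ) :
    (∑ r, mono (rep r) * subst U (F r)).coeff (rep r₀ + m ᵥ* U) = (F r₀).coeff m := by
  rw [AddMonoidAlgebra.coeff_sum, Finsupp.finsetSum_apply, Finset.sum_eq_single r₀]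
  · rw [coeff_mono_mul, add_sub_cancel_left, coeff_subst hU]
  · intro r _ hr
    rw [coeff_mono_mul]
    refine coeff_subst_of_notMem _ fun h => hr (eq_of_rep_sub_rep_mem hrep ?_)
    have := (subLattice U).sub_mem h ⟨m, rfl⟩
    have e : rep r₀ + m ᵥ* U - rep r - m ᵥ* U = rep r₀ - rep r := by abel
    rw [← e]
    exact this
  · simp

theorem exists_eq_rep_add (hrep : Function.Bijective fun r => (rep r : (Fin n → ℤ) ⧸ subLattice U))
    (a : Fin n → ℤ) : ∃ r m, rep r + m ᵥ* U = a := by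
  obtain ⟨r, m, hm⟩ := exists_sub_mem_subLattice hrep a
  refine ⟨r, m, ?_⟩
  have hm' : m ᵥ* U = a - rep r := hm
  rw [hm', add_sub_cancel]

theorem cosetSum_cosetPart (hU : U.det ≠ 0)
    (hrep : Function.Bijective fun r => (rep r : (Fin n → ℤ) ⧸ subLattice U)) (f : Laurent n) :
    ∑ r, mono (rep r) * subst U (cosetPart hU (rep r) f) = f := by
  refine AddMonoidAlgebra.coeff_injective (Finsupp.ext fun a => ?_)
  obtain ⟨r, m, rfl⟩ := exists_eq_rep_add hrep a
  rw [coeff_cosetSum hU hrep, coeff_cosetPart]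

theorem mem_support_subst (hU : U.det ≠ 0) {f : Laurent n} {a : Fin n → ℤ}
    (ha : a ∈ (subst U f).coeff.support) : ∃ m ∈ f.coeff.support, m ᵥ* U = a := by
  by_cases h : a ∈ subLattice U
  · obtain ⟨m, rfl⟩ := h
    refine ⟨m, ?_, rfl⟩
    rw [Finsupp.mem_support_iff] at ha ⊢
    rwa [← coeff_subst hU]
  · exact absurd (coeff_subst_of_notMem f h) (Finsupp.mem_support_iff.1 ha)

theorem subst_mem_toricRing (hU : U.det ≠ 0) {f : Laurent n} (hf : f ∈ toricRing (newGens U v)) :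
    subst U f ∈ toricRing v := by
  intro a ha i
  obtain ⟨m, hm, rfl⟩ := mem_support_subst hU ha
  rw [← dotProduct_newGens]
  exact hf m hm i

theorem subst_mem_invariantRing (hU : U.det ≠ 0) {f : Laurent n}
    (hf : f ∈ toricRing (newGens U v)) :
    (⟨subst U f, subst_mem_toricRing hU hf⟩ : toricRing v) ∈ invariantRing v U := by
  intro ρ hρ
  change charAct ρ (subst U f) = subst U f
  refine AddMonoidAlgebra.coeff_injective (Finsupp.ext fun a => ?_)
  rw [charAct_coeff]
  by_cases h : a ∈ subLattice U
  · rw [hρ a h, Units.val_one, one_mul]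
  · rw [coeff_subst_of_notMem f h, mul_zero]

/-- Some `ρ` in `G` has `ρ(a) ≠ 1`, while invariance forces `ρ(a)` to fix the coefficient. -/
theorem coeff_eq_zero_of_mem_invariantRing
    (hrep : Function.Bijective fun r => (rep r : (Fin n → ℤ) ⧸ subLattice U))
    {r : toricRing v} (hr : r ∈ invariantRing v U) {a : Fin n → ℤ} (ha : a ∉ subLattice U) :
    (r : Laurent n).coeff a = 0 := by
  obtain ⟨ρ, hρ⟩ := exists_charVal_ne_one hrep ha
  have h := congrArg (fun f : Laurent n => f.coeff a) (hr ρ ρ.2)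
  simp only [charAct_coeff] at h
  exact (mul_left_eq_self₀.1 h).resolve_left hρ

theorem exists_toricRing_equiv (v : Fin k → Fin n → ℤ) (hU : U.det ≠ 0)
    (hrep : Function.Bijective fun r => (rep r : (Fin n → ℤ) ⧸ subLattice U)) :
    ∃ θ : toricRing (newGens U v) ≃ₐ[ℂ] invariantRing v U,
      ∀ f, ((θ f : toricRing v) : Laurent n) = subst U (f : Laurent n) := by
  let φ : toricRing (newGens U v) →ₐ[ℂ] invariantRing v U :=
    (((subst U).comp (toricRing (newGens U v)).val).codRestrict (toricRing v)
      fun f => subst_mem_toricRing hU f.2).codRestrict (invariantRing v U)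
      fun f => subst_mem_invariantRing hU f.2
  have hφ : ∀ f, ((φ f : toricRing v) : Laurent n) = subst U (f : Laurent n) := fun f => rfl
  have hbij : Function.Bijective φ := by
    refine ⟨fun f h hfh => Subtype.ext (subst_injective hU ?_), fun r => ?_⟩
    · rw [← hφ, hfh, hφ]
    -- The preimage of an invariant is its part on the trivial coset `MU`, where its whole support
    -- lies.
    · have hmem : cosetPart hU 0 ((r : toricRing v) : Laurent n) ∈ toricRing (newGens U v) := by
        intro m hm i
        rw [Finsupp.mem_support_iff, coeff_cosetPart, zero_add] at hm
        rw [dotProduct_newGens]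
        exact (r : toricRing v).2 _ (Finsupp.mem_support_iff.2 hm) i
      refine ⟨⟨_, hmem⟩, Subtype.ext (Subtype.ext
        (AddMonoidAlgebra.coeff_injective (Finsupp.ext fun a => ?_)))⟩
      rw [hφ]
      by_cases ha : a ∈ subLattice U
      · obtain ⟨m, rfl⟩ := ha
        change (subst U _).coeff (m ᵥ* U) = ((r : toricRing v) : Laurent n).coeff (m ᵥ* U)
        rw [coeff_subst hU, coeff_cosetPart, zero_add]
      · rw [coeff_subst_of_notMem _ ha, coeff_eq_zero_of_mem_invariantRing hrep r.2 ha]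
  exact ⟨AlgEquiv.ofBijective φ hbij, hφ⟩

theorem mono_mul_subst_mem (hU : U.det ≠ 0) {μ : Fin n → ℤ} {L : GradedSubmodule v}
    {f : Laurent n} (hf : f ∈ (piece U μ L).toSubmodule) :
    mono μ * subst U f ∈ L.toSubmodule := by
  refine L.mem_of_mono_mem fun a ha => ?_
  rw [Finsupp.mem_support_iff, coeff_mono_mul, ← Finsupp.mem_support_iff] at ha
  obtain ⟨m, hm, hma⟩ := mem_support_subst hU ha
  have := mono_mem_piece.1 ((piece U μ L).mono_mem hf hm)
  rwa [hma, add_sub_cancel] at this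

theorem cosetPart_mem_piece (hU : U.det ≠ 0) {μ : Fin n → ℤ} {L : GradedSubmodule v}
    {f : Laurent n} (hf : f ∈ L.toSubmodule) : cosetPart hU μ f ∈ (piece U μ L).toSubmodule := by
  refine GradedSubmodule.mem_of_mono_mem _ fun m hm => mono_mem_piece.2 (L.mono_mem hf ?_)
  rwa [Finsupp.mem_support_iff, coeff_cosetPart, ← Finsupp.mem_support_iff] at hm

/-- A Laurent polynomial is uniquely the sum of its parts on the cosets of `MU`; the inverse map is
given by `cosetPart`. -/
theorem exists_dirSum_piece_equiv (L : ι → GradedSubmodule v) (hU : U.det ≠ 0)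
    (hrep : Function.Bijective fun r => (rep r : (Fin n → ℤ) ⧸ subLattice U))
    (θ : toricRing (newGens U v) ≃ₐ[ℂ] invariantRing v U)
    (hθ : ∀ f, ((θ f : toricRing v) : Laurent n) = subst U (f : Laurent n)) :
    ∃ Θ : DirSum (fun q : ι × Fin g => piece U (rep q.2) (L q.1)) ≃+ DirSum L,
      (∀ f s, Θ (f • s) = θ f • Θ s) ∧
      (∀ s j, (Θ s j : Laurent n) =
        ∑ r, mono (rep r) * subst U (s (j, r) : Laurent n)) := by
  let φ : DirSum (fun q : ι × Fin g => piece U (rep q.2) (L q.1)) →+ DirSum L :=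
    { toFun := fun s j => ⟨∑ r, mono (rep r) * subst U (s (j, r) : Laurent n),
        Submodule.sum_mem _ fun r _ => mono_mul_subst_mem hU (s (j, r)).2⟩
      map_zero' := DirSum.ext_coe fun j => by
        change ∑ r, mono (rep r) * subst U 0 = (0 : Laurent n)
        simp only [map_zero, mul_zero, Finset.sum_const_zero]
      map_add' := fun s t => DirSum.ext_coe fun j => by
        change ∑ r, mono (rep r) * subst U ((s (j, r) : Laurent n) + t (j, r)) =
          ∑ r, mono (rep r) * subst U (s (j, r) : Laurent n) +
            ∑ r, mono (rep r) * subst U (t (j, r) : Laurent n)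
        simp only [map_add, mul_add, Finset.sum_add_distrib] }
  have hφ : ∀ s j, (φ s j : Laurent n) =
      ∑ r, mono (rep r) * subst U (s (j, r) : Laurent n) := fun _ _ => rfl
  have hbij : Function.Bijective φ := by
    refine ⟨fun s t hst => DirSum.ext_coe fun q => ?_, fun t => ?_⟩
    · refine AddMonoidAlgebra.coeff_injective (Finsupp.ext fun m => ?_)
      have h : (φ s q.1 : Laurent n) = φ t q.1 := by rw [hst]
      rw [hφ, hφ] at h
      have h' := congrArg (fun f : Laurent n => f.coeff (rep q.2 + m ᵥ* U)) h
      simpa only [coeff_cosetSum hU hrep (fun r => (s (q.1, r) : Laurent n)),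
        coeff_cosetSum hU hrep (fun r => (t (q.1, r) : Laurent n))] using h'
    · let s : DirSum (fun q : ι × Fin g => piece U (rep q.2) (L q.1)) :=
        fun q => ⟨cosetPart hU (rep q.2) (t q.1), cosetPart_mem_piece hU (t q.1).2⟩
      have hs : ∀ j r, (s (j, r) : Laurent n) = cosetPart hU (rep r) (t j) := fun _ _ => rfl
      refine ⟨s, DirSum.ext_coe fun j => ?_⟩
      rw [hφ s j]
      simp only [hs]
      exact cosetSum_cosetPart hU hrep (t j : Laurent n)
  refine ⟨AddEquiv.ofBijective φ hbij, fun f s => DirSum.ext_coe fun j => ?_, hφ⟩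
  change ∑ r, mono (rep r) * subst U ((f : Laurent n) * (s (j, r) : Laurent n)) =
    ((θ f : toricRing v) : Laurent n) * ∑ r, mono (rep r) * subst U (s (j, r) : Laurent n)
  rw [hθ, Finset.mul_sum]
  exact Finset.sum_congr rfl fun r _ => by rw [map_mul, mul_left_comm]

end Subst

/-! ### Finiteness and reflexivity -/

section Transport

/-- A functional on a finite product is the sum of its restrictions to the factors, so the
evaluation map can be inverted factor by factor. -/
theorem isReflexive_pi {R ι : Type*} [CommRing R] [Finite ι] {M : ι → Type*}
    [∀ i, AddCommGroup (M i)] [∀ i, Module R (M i)] (hM : ∀ i, Module.IsReflexive R (M i)) :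
    Module.IsReflexive R (∀ i, M i) := by
  classical
  have := Fintype.ofFinite ι
  refine ⟨(injective_iff_map_eq_zero _).2 fun x hx => funext fun i => ?_, fun Ψ => ?_⟩
  · refine (hM i).bijective_dual_eval'.1 (LinearMap.ext fun φ => ?_)
    rw [Pi.zero_apply, map_zero]
    exact LinearMap.congr_fun hx (φ.comp (LinearMap.proj i))
  · choose x hx using fun i => (hM i).bijective_dual_eval'.2
      (Ψ.comp (Module.Dual.transpose (R := R) (LinearMap.proj i)))
    refine ⟨x, LinearMap.ext fun φ => ?_⟩
    have h1 : φ = ∑ i, (φ.comp (LinearMap.single R M i)).comp (LinearMap.proj i) := by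
      refine LinearMap.ext fun y => ?_
      rw [LinearMap.sum_apply]
      conv_lhs => rw [← Finset.univ_sum_single y, map_sum]
      rfl
    conv_rhs => rw [h1, map_sum]
    conv_lhs => rw [Module.Dual.eval_apply, h1, LinearMap.sum_apply]
    exact Finset.sum_congr rfl fun i _ =>
      LinearMap.congr_fun (hx i) (φ.comp (LinearMap.single R M i))

variable {R S M N : Type*} [CommRing R] [CommRing S] [AddCommGroup M] [AddCommGroup N]
  [Module R M] [Module S N] (e : R ≃+* S) (Θ : M ≃+ N) (h : ∀ (r : R) m, Θ (r • m) = e r • Θ m)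

include h

theorem finite_of_semilinearEquiv [Module.Finite R M] : Module.Finite S N := by
  obtain ⟨s, hs⟩ := (inferInstance : Module.Finite R M)
  classical
  refine ⟨s.image Θ, ?_⟩
  rw [eq_top_iff]
  rintro n -
  obtain ⟨m, rfl⟩ := Θ.surjective n
  have hm : m ∈ Submodule.span R (s : Set M) := by
    rw [hs]
    trivial
  induction hm using Submodule.span_induction with
  | mem x hx => exact Submodule.subset_span (Finset.mem_coe.2 (Finset.mem_image_of_mem Θ hx))
  | zero => rw [map_zero]; exact Submodule.zero_mem _
  | add x y _ _ hx hy => rw [map_add]; exact Submodule.add_mem _ hx hy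
  | smul r x _ hx => rw [h]; exact Submodule.smul_mem _ _ hx

/-- Functionals are carried across by conjugation with `e` and `Θ`. This serves to pass from
`R_{Uσ}` to `R^G`, two different rings. -/
theorem isReflexive_of_semilinearEquiv [Module.IsReflexive R M] : Module.IsReflexive S N := by
  have hsymm : ∀ s n, Θ.symm (s • n) = e.symm s • Θ.symm n := fun s n => by
    rw [Θ.symm_apply_eq, h, e.apply_symm_apply, Θ.apply_symm_apply]
  let toS : Module.Dual R M → Module.Dual S N := fun φ =>
    { toFun := fun n => e (φ (Θ.symm n))
      map_add' := fun x y => by simp only [map_add]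
      map_smul' := fun s x => by
        rw [hsymm, map_smul, smul_eq_mul, map_mul, e.apply_symm_apply]
        rfl }
  let toR : Module.Dual S N → Module.Dual R M := fun ψ =>
    { toFun := fun m => e.symm (ψ (Θ m))
      map_add' := fun x y => by simp only [map_add]
      map_smul' := fun r x => by
        rw [h, map_smul, smul_eq_mul, map_mul, e.symm_apply_apply]
        rfl }
  have htoS : ∀ ψ, toS (toR ψ) = ψ := fun ψ => LinearMap.ext fun n => by
    change e (e.symm (ψ (Θ (Θ.symm n)))) = ψ n
    rw [e.apply_symm_apply, Θ.apply_symm_apply]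
  refine ⟨(injective_iff_map_eq_zero _).2 fun n hn => ?_, fun Ψ => ?_⟩
  · have : Θ.symm n = 0 := (Module.bijective_dual_eval R M).1 (LinearMap.ext fun φ => by
      rw [map_zero]
      have h1 : e (φ (Θ.symm n)) = 0 := LinearMap.congr_fun hn (toS φ)
      exact (map_eq_zero_iff e e.injective).1 h1)
    exact (map_eq_zero_iff Θ.symm Θ.symm.injective).1 this
  · let Ψ' : Module.Dual R (Module.Dual R M) :=
      { toFun := fun φ => e.symm (Ψ (toS φ))
        map_add' := fun φ χ => by
          have : toS (φ + χ) = toS φ + toS χ := LinearMap.ext fun n => map_add e _ _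
          rw [this, map_add, map_add]
        map_smul' := fun r φ => by
          have : toS (r • φ) = e r • toS φ := LinearMap.ext fun n => map_mul e _ _
          rw [this, map_smul, smul_eq_mul, map_mul, e.symm_apply_apply]
          rfl }
    obtain ⟨m, hm⟩ := (Module.bijective_dual_eval R M).2 Ψ'
    refine ⟨Θ m, LinearMap.ext fun ψ => ?_⟩
    have h1 : e.symm (ψ (Θ m)) = e.symm (Ψ (toS (toR ψ))) := LinearMap.congr_fun hm (toR ψ)
    rw [htoS] at h1
    exact e.symm.injective h1

end Transport

/-! ### Finite generation and reflexivity of sums of the modules `T(b)`. -/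

section Finite

variable {n k : ℕ} {v : Fin k → Fin n → ℤ} {ι : Type}

/-- The module `T(b)` is finitely generated, by Dickson's lemma. -/
theorem finite_reflexiveOf (v : Fin k → Fin n → ℤ) (b : Fin k → ℤ) :
    Module.Finite (toricRing v) (reflexiveOf v b).toSubmodule := by
  -- `x` records the slacks `⟨m, vᵢ⟩ - bᵢ`. Minimal slack vectors form an antichain in `ℕᵏ`, hence a
  -- finite set, and a larger slack differs from a smaller one by a degree in `σ^∨`.
  let P : (Fin k → ℕ) → Prop := fun x => ∃ m : Fin n → ℤ, ∀ i, m ⬝ᵥ v i = b i + x i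
  have hfin : {x | Minimal P x}.Finite :=
    WellQuasiOrderedLE.finite_of_isAntichain (setOfPred_minimal_antichain P)
  choose! μ hμ using fun (x : Fin k → ℕ) (hx : P x) => hx
  have hmem : ∀ x, P x → mono (μ x) ∈ (reflexiveOf v b).toSubmodule := fun x hx =>
    mono_mem_reflexiveOf.2 fun i => by rw [hμ x hx i]; omega
  refine Module.Finite.of_fg (Submodule.fg_def.2 ⟨(fun x => mono (μ x)) '' {x | Minimal P x},
    hfin.image _, le_antisymm (Submodule.span_le.2 ?_) fun f hf => ?_⟩)
  · rintro _ ⟨x, hx, rfl⟩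
    exact hmem x hx.1
  · rw [← sum_coeff_smul_mono f]
    refine Submodule.sum_mem _ fun m hm => ?_
    rw [← algebraMap_smul (toricRing v)]
    refine Submodule.smul_mem _ _ ?_
    have hb := hf m hm
    obtain ⟨x, hxle, hx⟩ := exists_minimal_le_of_wellFoundedLT P
      (fun i => (m ⬝ᵥ v i - b i).toNat) ⟨m, fun i => by
        have := hb i
        simp only
        omega⟩
    have ha : mono (m - μ x) ∈ toricRing v := mono_mem_toricRing.2 fun i => by
      have h1 := hxle i
      have h2 := hb i
      rw [sub_dotProduct, hμ x hx.1]
      simp only at h1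
      omega
    have : mono m = (⟨_, ha⟩ : toricRing v) • (mono (μ x) : Laurent n) := by
      change _ = mono _ * mono _
      rw [mono_mul_mono, sub_add_cancel]
    rw [this]
    exact Submodule.smul_mem _ _ (Submodule.subset_span ⟨x, hx, rfl⟩)

theorem finite_sumOf [Finite ι] (b : ι → Fin k → ℤ) :
    Module.Finite (toricRing v) (DirSum (sumOf v b)) :=
  have := fun i => finite_reflexiveOf v (b i)
  inferInstanceAs (Module.Finite (toricRing v) (∀ i, (sumOf v b i).toSubmodule))

theorem isReflexive_sumOf [Finite ι] (hv : IsConeGenerators v) (b : ι → Fin k → ℤ) :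
    Module.IsReflexive (toricRing v) (DirSum (sumOf v b)) :=
  isReflexive_pi fun i => isReflexive_reflexiveOf hv (b i)

end Finite

/-! ### The quotient of a noncommutative crepant resolution -/

section NCCR

variable {n k g : ℕ} {v : Fin k → Fin n → ℤ} {U : Matrix (Fin n) (Fin n) ℤ} {ι : Type}
  {rep : Fin g → Fin n → ℤ} [Fintype ι] [DecidableEq ι] {b : ι → Fin k → ℤ}

theorem piece_sumOf (U : Matrix (Fin n) (Fin n) ℤ) (rep : Fin g → Fin n → ℤ)
    (b : ι → Fin k → ℤ) :
    (fun q : ι × Fin g => piece U (rep q.2) (sumOf v b q.1)) =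
      sumOf (newGens U v) fun q i => b q.1 i - rep q.2 ⬝ᵥ v i :=
  funext fun _ => piece_reflexiveOf _ _ _

/-- Through `Θ`, the module `T` over `R^G` is a sum of modules `T(b')` over `R_{Uσ}`, for which both
properties are known. -/
theorem finite_and_isReflexive_invariantRing (hv' : IsConeGenerators (newGens U v))
    (hU : U.det ≠ 0)
    (hrep : Function.Bijective fun r => (rep r : (Fin n → ℤ) ⧸ subLattice U)) :
    Module.Finite (invariantRing v U) (DirSum (sumOf v b)) ∧
      Module.IsReflexive (invariantRing v U) (DirSum (sumOf v b)) := by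
  obtain ⟨θ, hθ⟩ := exists_toricRing_equiv v hU hrep
  obtain ⟨Θ, hΘ, -⟩ := exists_dirSum_piece_equiv (sumOf v b) hU hrep θ hθ
  generalize hL : (fun q : ι × Fin g => piece U (rep q.2) (sumOf v b q.1)) = L' at Θ hΘ
  rw [piece_sumOf] at hL
  subst hL
  have h1 := finite_sumOf (v := newGens U v)
    fun (q : ι × Fin g) i => b q.1 i - rep q.2 ⬝ᵥ v i
  have h2 := isReflexive_sumOf hv' fun (q : ι × Fin g) i => b q.1 i - rep q.2 ⬝ᵥ v i
  exact ⟨finite_of_semilinearEquiv (S := invariantRing v U) θ.toRingEquiv Θ hΘ,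
    isReflexive_of_semilinearEquiv (S := invariantRing v U) θ.toRingEquiv Θ hΘ⟩

theorem isCrossedProduct_restrictEnd [Fintype (quotGroup U)] {L : ι → GradedSubmodule v}
    (h : Function.Bijective (skewHom L U)) :
    IsCrossedProduct (restrictEnd L U) (sumActMonoidHom L U) where
  comm ρ E := (restrictEnd_smul_mul L E ρ).symm
  bijective := by
    let e : (quotGroup U → Module.End (toricRing v) (DirSum L)) → SkewGroupRing L U :=
      fun c => ⟨Finsupp.equivFunOnFinite.symm c⟩
    have he : Function.Bijective e :=
      ⟨fun c d hcd => Finsupp.equivFunOnFinite.symm.injective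
        (SkewMonoidAlgebra.ofCoeff_injective hcd),
        fun x => ⟨x.coeff, SkewMonoidAlgebra.ext fun ρ => rfl⟩⟩
    convert h.comp he using 1
    funext c
    refine LinearMap.ext fun t => ?_
    rw [Function.comp_apply, skewHom_apply, LinearMap.sum_apply]
    rfl

theorem isNCCR_invariantRing (hv : IsConeGenerators v) (hv' : IsConeGenerators (newGens U v))
    (hU : U.det ≠ 0)
    (hrep : Function.Bijective fun r => (rep r : (Fin n → ℤ) ⧸ subLattice U))
    (h : IsNCCR (toricRing v) (Module.End (toricRing v) (DirSum (sumOf v b)))) :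
    IsNCCR (invariantRing v U) (Module.End (invariantRing v U) (DirSum (sumOf v b))) := by
  obtain ⟨h1, h2⟩ := finite_and_isReflexive_invariantRing (b := b) hv' hU hrep
  refine ⟨⟨DirSum (sumOf v b), inferInstance, inferInstance, h1, h2, ⟨AlgEquiv.refl⟩⟩, ?_⟩
  have := finite_quotGroup hrep
  have := Fintype.ofFinite (quotGroup U)
  refine (isCrossedProduct_restrictEnd ⟨skewHom_injective hv hv' hrep,
    skewHom_surjective hv' hrep⟩).isHomologicallyHomogeneous ?_ h.2
  -- The order of `G` is invertible since `ℂ ⊆ R^G`.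
  have hu : IsUnit (Fintype.card (quotGroup U) : ℂ) :=
    (Nat.cast_ne_zero.2 Fintype.card_ne_zero).isUnit
  have := (hu.map (algebraMap ℂ (invariantRing v U))).map
    (algebraMap (invariantRing v U) (Module.End (invariantRing v U) (DirSum (sumOf v b))))
  rwa [map_natCast, map_natCast] at this

end NCCR

/-! ### Lifting paths -/

section Quiver

variable {n k g : ℕ} {v : Fin k → Fin n → ℤ} {U : Matrix (Fin n) (Fin n) ℤ} {ι : Type}
  {rep : Fin g → Fin n → ℤ} {b : ι → Fin k → ℤ}

/-- The morphism between the `L j` of which the given morphism between the `L j r` is a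
restriction. -/
def Arrow.down (U : Matrix (Fin n) (Fin n) ℤ) (rep : Fin g → Fin n → ℤ)
    (a : Arrow (ι × Fin g) n) : Arrow ι n :=
  ⟨a.src.1, a.tgt.1, rep a.tgt.2 + a.deg ᵥ* U - rep a.src.2⟩

/-- The vectors `b` of the `L j r`. -/
def liftDeg (v : Fin k → Fin n → ℤ) (rep : Fin g → Fin n → ℤ) (b : ι → Fin k → ℤ) :
    ι × Fin g → Fin k → ℤ :=
  fun q i => b q.1 i - rep q.2 ⬝ᵥ v i

theorem isHomDeg_liftDeg {q q' : ι × Fin g} {m : Fin n → ℤ} :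
    IsHomDeg (newGens U v) (liftDeg v rep b) q q' m ↔
      IsHomDeg v b q.1 q'.1 (rep q'.2 + m ᵥ* U - rep q.2) := by
  refine forall_congr' fun x => ?_
  rw [dotProduct_newGens, sub_dotProduct, add_dotProduct, liftDeg, liftDeg]
  constructor <;> intro h <;> linarith

theorem eq_of_rep_add_sub_rep_eq_zero (hU : U.det ≠ 0)
    (hrep : Function.Bijective fun r => (rep r : (Fin n → ℤ) ⧸ subLattice U)) {r s : Fin g}
    {m : Fin n → ℤ} (h : rep s + m ᵥ* U - rep r = 0) : r = s ∧ m = 0 := by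
  have hrs : r = s := (eq_of_rep_sub_rep_mem hrep ⟨m, by
    have : m ᵥ* U = rep r - rep s := by
      rw [← sub_eq_zero, ← h]
      abel
    exact this⟩ : s = r).symm
  subst hrs
  rw [add_sub_cancel_left] at h
  exact ⟨rfl, vecMul_injective_of_det_ne_zero hU (h.trans (Matrix.zero_vecMul U).symm)⟩

theorem Paths.lift (hU : U.det ≠ 0)
    (hrep : Function.Bijective fun r => (rep r : (Fin n → ℤ) ⧸ subLattice U))
    {Γ : Set (Arrow ι n)} {i j : ι} {d : Fin n → ℤ} (h : Paths Γ i j d) :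
    ∀ {r s : Fin g} {m : Fin n → ℤ}, rep s + m ᵥ* U - rep r = d →
      Paths (Arrow.down U rep ⁻¹' Γ) (i, r) (j, s) m := by
  induction h with
  | nil i =>
    intro r s m h
    obtain ⟨rfl, rfl⟩ := eq_of_rep_add_sub_rep_eq_zero hU hrep h
    exact .nil _
  | @cons i l j d d' ha _ ih =>
    intro r s m h
    -- An arrow of degree `d` leaving the coset of `rep r` must end in the coset of `rep r + d`;
    -- this determines its lift.
    obtain ⟨t, e, he⟩ := exists_eq_rep_add hrep (rep r + d)
    have h1 : rep s + (m - e) ᵥ* U - rep t = d' := by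
      rw [Matrix.sub_vecMul, eq_sub_of_add_eq' he, ← sub_eq_zero, ← sub_eq_zero.2 h]
      abel
    have h2 : Arrow.down U rep (⟨(i, r), (l, t), e⟩ : Arrow (ι × Fin g) n) = ⟨i, l, d⟩ := by
      rw [Arrow.down]
      congr 1
      rw [he, add_sub_cancel_left]
    have := Paths.cons (Γ := Arrow.down U rep ⁻¹' Γ) (i := (i, r)) (l := (l, t)) (d := e)
      (by rw [Set.mem_preimage, h2]; exact ha) (ih h1)
    rwa [add_sub_cancel] at this

/-- Cut the path at the first occurrence of `γ`, if there is one. -/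
theorem Paths.diff_or {Γ : Set (Arrow ι n)} (γ : Arrow ι n) {i j : ι} {m : Fin n → ℤ}
    (h : Paths Γ i j m) : Paths (Γ \ {γ}) i j m ∨
      ∃ x y, Paths Γ i γ.src x ∧ Paths Γ γ.tgt j y ∧ x + γ.deg + y = m := by
  induction h with
  | nil i => exact .inl (.nil i)
  | @cons i l j d m ha hp ih =>
    by_cases hγ : (⟨i, l, d⟩ : Arrow ι n) = γ
    · subst hγ
      exact .inr ⟨0, m, .nil _, hp, by rw [zero_add]⟩
    · rcases ih with ih | ⟨x, y, hx, hy, hxy⟩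
      · exact .inl (.cons ⟨ha, hγ⟩ ih)
      · exact .inr ⟨d + x, y, .cons ha hx, hy, by rw [← hxy]; abel⟩

theorem Paths.of_forall {Γ Γ' : Set (Arrow ι n)}
    (hΓ : ∀ a ∈ Γ, Paths Γ' a.src a.tgt a.deg) {i j : ι} {m : Fin n → ℤ} (h : Paths Γ i j m) :
    Paths Γ' i j m := by
  induction h with
  | nil i => exact .nil i
  | cons ha _ ih => exact (hΓ _ ha).trans ih

/-- Mutually inverse morphisms of degrees `m` and `m'` are identities. -/
def HasNoIsos (v : Fin k → Fin n → ℤ) (b : ι → Fin k → ℤ) : Prop :=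
  ∀ i j m m', IsHomDeg v b i j m → IsHomDeg v b j i m' → m + m' = 0 → i = j ∧ m = 0

/-- Both `m` and `-m` pair nonnegatively with all generators, so `m` is orthogonal to a spanning
set. -/
theorem IsHomDeg.eq_zero (hv : IsConeGenerators v) {i j : ι} {m m' : Fin n → ℤ}
    (h : IsHomDeg v b i i m) (h' : IsHomDeg v b j j m') (hm : m + m' = 0) : m = 0 :=
  hv.eq_zero fun x => by
    have h1 := h x
    have h2 := h' x
    rw [eq_neg_of_add_eq_zero_right hm, neg_dotProduct] at h2
    linarith

theorem hasNoIsos_of_nonisomorphic (hv : IsConeGenerators v)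
    (h : ∀ i j, i ≠ j → IsEmpty
      ((sumOf v b i).toSubmodule ≃ₗ[toricRing v] (sumOf v b j).toSubmodule)) :
    HasNoIsos v b := by
  intro i j m m' hm hm' hmm
  have hij : i = j := by
    by_contra hij
    have key : ∀ {i j m}, IsHomDeg v b i j m → ∀ t ∈ (sumOf v b i).toSubmodule,
        mono m * t ∈ (sumOf v b j).toSubmodule := fun hm t ht => by
      have := mul_mem_reflexiveOf (isHomDeg_iff.1 hm) ht
      rwa [sub_add_cancel] at this
    refine (h i j hij).elim' (LinearEquiv.ofLinearMap (mulHom _ _ (mono m) (key hm))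
      (mulHom _ _ (mono m') (key hm')) (LinearMap.ext fun t => Subtype.ext ?_)
      (LinearMap.ext fun t => Subtype.ext ?_))
    · change mono m * (mono m' * (t : Laurent n)) = t
      rw [← mul_assoc, mono_mul_mono, hmm, mono_zero, one_mul]
    · change mono m' * (mono m * (t : Laurent n)) = t
      rw [← mul_assoc, mono_mul_mono, add_comm, hmm, mono_zero, one_mul]
  subst hij
  exact ⟨rfl, hm.eq_zero hv hm' hmm⟩

/-- The multipliers of `e` and `e⁻¹` have product `1`. Its nonzero constant coefficient must come
from a pair of degrees with sum zero. -/
theorem exists_isHomDeg_of_equiv (hv : IsConeGenerators v) {i j : ι}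
    (e : (sumOf v b i).toSubmodule ≃ₗ[toricRing v] (sumOf v b j).toSubmodule) :
    ∃ m m', IsHomDeg v b i j m ∧ IsHomDeg v b j i m' ∧ m + m' = 0 := by
  obtain ⟨h, hh, he⟩ := exists_multiplier_reflexiveOf hv _ _ e.toLinearMap
  obtain ⟨h', hh', he'⟩ := exists_multiplier_reflexiveOf hv _ _ e.symm.toLinearMap
  obtain ⟨a, ha⟩ := hv.exists_mono_mem (b i)
  have h1 : h * h' = 1 := by
    have h2 := he' (e ⟨mono a, ha⟩)
    have h3 : (e ⟨mono a, ha⟩ : Laurent n) = h * mono a := he _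
    rw [h3, LinearEquiv.coe_coe, e.symm_apply_apply] at h2
    apply mul_right_cancel₀ (mono_ne_zero a)
    rw [one_mul]
    refine Eq.trans ?_ h2.symm
    ring
  obtain ⟨m, m', hm, hm', hmm⟩ := coeff_mul_ne_zero (f := h) (g := h') (m := 0) (by
    rw [h1, ← mono_zero, coeff_mono, if_pos rfl]
    exact one_ne_zero)
  exact ⟨m, m', isHomDeg_iff.2 (GradedSubmodule.mono_mem _ hh (Finsupp.mem_support_iff.2 hm)),
    isHomDeg_iff.2 (GradedSubmodule.mono_mem _ hh' (Finsupp.mem_support_iff.2 hm')), hmm⟩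

theorem HasNoIsos.liftDeg (h : HasNoIsos v b) (hU : U.det ≠ 0)
    (hrep : Function.Bijective fun r => (rep r : (Fin n → ℤ) ⧸ subLattice U)) :
    HasNoIsos (newGens U v) (liftDeg v rep b) := by
  rintro ⟨i, r⟩ ⟨j, s⟩ m m' hm hm' hmm
  rw [isHomDeg_liftDeg] at hm hm'
  obtain ⟨hij, h0⟩ := h _ _ _ _ hm hm' (by
    have : m ᵥ* U + m' ᵥ* U = 0 := by rw [← Matrix.add_vecMul, hmm, Matrix.zero_vecMul]
    rw [eq_neg_of_add_eq_zero_right this]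
    abel)
  obtain ⟨hrs, hm0⟩ := eq_of_rep_add_sub_rep_eq_zero hU hrep h0
  exact ⟨Prod.ext hij hrs, hm0⟩

variable [Fintype ι] [DecidableEq ι]

theorem generates_down (hv : IsConeGenerators v) (hv' : IsConeGenerators (newGens U v))
    (hU : U.det ≠ 0)
    (hrep : Function.Bijective fun r => (rep r : (Fin n → ℤ) ⧸ subLattice U))
    {Γ : Set (Arrow ι n)} (h : Generates (sumOf v b) Γ) :
    Generates (sumOf (newGens U v) (liftDeg v rep b)) (Arrow.down U rep ⁻¹' Γ) := by
  rw [generates_iff hv] at h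
  rw [generates_iff hv']
  exact ⟨fun a ha => isHomDeg_liftDeg.2 (h.1 _ ha),
    fun q q' m hm => (h.2 _ _ _ (isHomDeg_liftDeg.1 hm)).lift hU hrep rfl⟩

theorem generates_diff_singleton (hv : IsConeGenerators v) {Γ : Set (Arrow ι n)}
    (h : Generates (sumOf v b) Γ) {γ : Arrow ι n}
    (hγ : Paths (Γ \ {γ}) γ.src γ.tgt γ.deg) : Generates (sumOf v b) (Γ \ {γ}) := by
  rw [generates_iff hv] at h ⊢
  refine ⟨fun a ha => h.1 a ha.1, fun i j m hm => (h.2 i j m hm).of_forall fun a ha => ?_⟩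
  by_cases haγ : a = γ
  · rw [haγ]
    exact hγ
  · exact .single ⟨ha, haγ⟩

theorem not_paths_diff_of_minimal (hv : IsConeGenerators v) {Γ : Set (Arrow ι n)}
    (h : Minimal (Generates (sumOf v b)) Γ) {γ : Arrow ι n} (hγ : γ ∈ Γ) :
    ¬ Paths (Γ \ {γ}) γ.src γ.tgt γ.deg := fun hp =>
  (h.2 (generates_diff_singleton hv h.1 hp) Set.sdiff_subset hγ).2 rfl

theorem identity_notMem_of_minimal (hv : IsConeGenerators v) {Γ : Set (Arrow ι n)}
    (h : Minimal (Generates (sumOf v b)) Γ) (i : ι) : (⟨i, i, 0⟩ : Arrow ι n) ∉ Γ := fun hi =>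
  not_paths_diff_of_minimal hv h hi (.nil i)

/-- The arrows of a minimal generating set are irreducible. -/
theorem irreducible_of_minimal (hv : IsConeGenerators v) (hb : HasNoIsos v b)
    {Γ : Set (Arrow ι n)} (h : Minimal (Generates (sumOf v b)) Γ) {γ : Arrow ι n} (hγ : γ ∈ Γ)
    {l : ι} {d d' : Fin n → ℤ} (hd : IsHomDeg v b γ.src l d) (hd' : IsHomDeg v b l γ.tgt d')
    (hdd : d + d' = γ.deg) : (γ.src = l ∧ d = 0) ∨ (l = γ.tgt ∧ d' = 0) := by
  by_contra hcon
  rw [not_or] at hcon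
  have hgen := (generates_iff hv).1 h.1
  refine not_paths_diff_of_minimal hv h hγ ?_
  rw [← hdd]
  -- If the path of degree `d` passed through `γ`, what remains would consist of loops at the two
  -- ends of `γ` with total degree zero. Then the second factor would be invertible, hence trivial,
  -- which is excluded.
  have h1 : Paths (Γ \ {γ}) γ.src l d := by
    refine ((hgen.2 _ _ _ hd).diff_or γ).resolve_right ?_
    rintro ⟨x, y, hx, hy, hxy⟩
    have hx' := hx.isHomDeg hgen.1
    have hy' := hy.isHomDeg hgen.1
    have hsum : (y + d') + x = 0 := by
      have : x + γ.deg + y + d' = γ.deg := by rw [hxy, hdd]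
      rw [← sub_eq_zero] at this
      rw [← this]
      abel
    have h0 := (hy'.trans hd').eq_zero hv hx' hsum
    obtain ⟨h2, h3⟩ := hb _ _ _ _ hd' hy' (by rw [add_comm, h0])
    exact hcon.2 ⟨h2, h3⟩
  have h2 : Paths (Γ \ {γ}) l γ.tgt d' := by
    refine ((hgen.2 _ _ _ hd').diff_or γ).resolve_right ?_
    rintro ⟨x, y, hx, hy, hxy⟩
    have hx' := hx.isHomDeg hgen.1
    have hy' := hy.isHomDeg hgen.1
    have hsum : (d + x) + y = 0 := by
      have : d + (x + γ.deg + y) = γ.deg := by rw [hxy, hdd]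
      rw [← sub_eq_zero] at this
      rw [← this]
      abel
    have h0 := (hd.trans hx').eq_zero hv hy' hsum
    exact hcon.1 (hb _ _ _ _ hd hx' h0)
  exact h1.trans h2

/-- An arrow of the preimage is a path in any smaller generating set `Γ₁`. Splitting off the first
step factors an arrow of `Γ`; by irreducibility one factor is an identity. It is not the first step,
since a minimal set contains no identities, so the arrow itself is in `Γ₁`. -/
theorem minimal_generates_down (hv : IsConeGenerators v)
    (hv' : IsConeGenerators (newGens U v)) (hU : U.det ≠ 0)
    (hrep : Function.Bijective fun r => (rep r : (Fin n → ℤ) ⧸ subLattice U))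
    (hb : HasNoIsos v b) {Γ : Set (Arrow ι n)} (h : Minimal (Generates (sumOf v b)) Γ) :
    Minimal (Generates (sumOf (newGens U v) (liftDeg v rep b))) (Arrow.down U rep ⁻¹' Γ) := by
  refine ⟨generates_down hv hv' hU hrep h.1, fun Γ₁ h₁ hle a ha => ?_⟩
  have hgen := (generates_iff hv').1 (generates_down hv hv' hU hrep h.1)
  have hgen₁ := (generates_iff hv').1 h₁
  obtain ⟨q, q', m⟩ := a
  have hp := hgen₁.2 _ _ _ (hgen.1 _ ha)
  simp only at hp
  have hid : ∀ (i : ι) (r : Fin g), (⟨(i, r), (i, r), 0⟩ : Arrow (ι × Fin g) n) ∉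
      Arrow.down U rep ⁻¹' Γ := fun i r hr => identity_notMem_of_minimal hv h i (by
    have : Arrow.down U rep (⟨(i, r), (i, r), 0⟩ : Arrow (ι × Fin g) n) = ⟨i, i, 0⟩ := by
      simp [Arrow.down]
    rw [← this]
    exact hr)
  cases hp with
  | nil => exact absurd ha (hid _ _)
  | @cons _ c _ e m hc hm =>
    have hm' := isHomDeg_liftDeg.1 (hm.isHomDeg hgen₁.1)
    have hc' := isHomDeg_liftDeg.1 (hgen.1 _ (hle hc))
    rcases irreducible_of_minimal hv hb h ha hc' hm' (by
      simp only [Arrow.down, Matrix.add_vecMul]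
      abel) with ⟨h1, h2⟩ | ⟨h1, h2⟩
    · obtain ⟨h3, h4⟩ := eq_of_rep_add_sub_rep_eq_zero hU hrep h2
      have hqc : q = c := Prod.ext h1 h3
      subst hqc
      simp only at h4
      subst h4
      exact absurd (hle hc) (hid _ _)
    · obtain ⟨h3, h4⟩ := eq_of_rep_add_sub_rep_eq_zero hU hrep h2
      have hcq : c = q' := Prod.ext h1 h3
      subst hcq
      subst h4
      rwa [add_zero]

end Quiver

/-! ### Universal covers -/

section Cover

variable {n : ℕ} {ι : Type} {p : ι → Fin n → ℝ} {Γ : Set (Arrow ι n)}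

theorem torusProj_eq_iff {x y : Fin n → ℝ} :
    torusProj n x = torusProj n y ↔ ∃ t, x = y + toReal n t := by
  change ((x : Torus n) = (y : Torus n)) ↔ _
  rw [eq_comm, QuotientAddGroup.eq]
  constructor
  · rintro ⟨t, ht⟩
    exact ⟨t, by rw [ht, add_neg_cancel_left]⟩
  · rintro ⟨t, rfl⟩
    exact ⟨t, by rw [neg_add_cancel_left]⟩

theorem mem_universalCover_verts {x : Fin n → ℝ} :
    x ∈ (embeddedQuiver p Γ).universalCover.verts ↔ ∃ i t, x = p i + toReal n t := by
  change (∃ i, torusProj n (p i) = torusProj n x) ↔ _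
  simp only [eq_comm (b := torusProj n x), torusProj_eq_iff]

theorem segmentPath_add {x y z : Fin n → ℝ} (s : unitInterval) :
    segmentPath (x + z) (y + z) s = segmentPath x y s + z := by
  change x + z + (s : ℝ) • (y + z - (x + z)) = x + (s : ℝ) • (y - x) + z
  rw [add_sub_add_right_eq_sub]
  abel

/-- Lifts along a covering are determined by their starting point, so every lift of a projected
segment is a translate of the segment by `M`. -/
theorem mem_universalCover_arrows {a : C(unitInterval, Fin n → ℝ)} :
    a ∈ (embeddedQuiver p Γ).universalCover.arrows ↔ ∃ γ ∈ Γ, ∃ t,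
      a = segmentPath (p γ.src + toReal n γ.deg + toReal n t) (p γ.tgt + toReal n t) := by
  constructor
  · rintro ⟨γ, hγ, ha⟩
    have hproj : ∀ s, torusProj n (a s) =
        torusProj n (segmentPath (p γ.src + toReal n γ.deg) (p γ.tgt) s) := fun s =>
      (DFunLike.congr_fun ha s).symm
    obtain ⟨t, ht⟩ := torusProj_eq_iff.1 (hproj 0)
    refine ⟨γ, hγ, t, DFunLike.coe_injective ?_⟩
    refine (isCoveringMap_torusProj n).eq_of_comp_eq a.continuous (ContinuousMap.continuous _)
      (funext fun s => ?_) 0 ?_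
    · rw [Function.comp_apply, Function.comp_apply, hproj, segmentPath_add]
      exact (torusProj_eq_iff.2 ⟨t, rfl⟩).symm
    · rw [ht, segmentPath_add]
  · rintro ⟨γ, hγ, t, rfl⟩
    refine ⟨γ, hγ, ContinuousMap.ext fun s => ?_⟩
    change torusProj n _ = torusProj n _
    rw [segmentPath_add]
    exact (torusProj_eq_iff.2 ⟨t, rfl⟩).symm

end Cover

/-! ### The map `x ↦ xU⁻¹` and the comparison of the universal covers. -/

section MulInv

variable {n g : ℕ} {U : Matrix (Fin n) (Fin n) ℤ} {ι : Type} {rep : Fin g → Fin n → ℤ}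

theorem mulInv_apply (x : Fin n → ℝ) :
    mulInv U x = x ᵥ* (U.map (fun z : ℤ => (z : ℝ)))⁻¹ := rfl

theorem mulInv_add (x y : Fin n → ℝ) : mulInv U (x + y) = mulInv U x + mulInv U y := by
  rw [mulInv_apply, mulInv_apply, mulInv_apply, Matrix.add_vecMul]

theorem mulInv_sub (x y : Fin n → ℝ) : mulInv U (x - y) = mulInv U x - mulInv U y := by
  rw [mulInv_apply, mulInv_apply, mulInv_apply, Matrix.sub_vecMul]

theorem toReal_vecMul (m : Fin n → ℤ) :
    toReal n (m ᵥ* U) = toReal n m ᵥ* U.map (fun z : ℤ => (z : ℝ)) := by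
  funext i
  simp [toReal, Matrix.vecMul, dotProduct]

theorem mulInv_toReal_vecMul (hU : U.det ≠ 0) (m : Fin n → ℤ) :
    mulInv U (toReal n (m ᵥ* U)) = toReal n m := by
  rw [mulInv_apply, toReal_vecMul, Matrix.vecMul_vecMul,
    Matrix.mul_nonsing_inv _ (det_map_intCast_ne_zero hU).isUnit, Matrix.vecMul_one]

theorem mulInv_injective (hU : U.det ≠ 0) : Function.Injective (mulInv U) := fun x y h => by
  have := congrArg (· ᵥ* U.map (fun z : ℤ => (z : ℝ))) h
  simpa only [mulInv_apply, Matrix.vecMul_vecMul,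
    Matrix.nonsing_inv_mul _ (det_map_intCast_ne_zero hU).isUnit, Matrix.vecMul_one] using this

theorem toReal_injective : Function.Injective (toReal n) := fun a b h => by
  funext i
  have hi : (a i : ℝ) = b i := congrFun h i
  exact_mod_cast hi

theorem mulInv_comp_segmentPath (x y : Fin n → ℝ) :
    (mulInv U).comp (segmentPath x y) = segmentPath (mulInv U x) (mulInv U y) := by
  refine ContinuousMap.ext fun s => ?_
  change mulInv U (x + (s : ℝ) • (y - x)) = mulInv U x + (s : ℝ) • (mulInv U y - mulInv U x)
  rw [mulInv_add, ← mulInv_sub, mulInv_apply ((s : ℝ) • (y - x)), Matrix.smul_vecMul]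
  rfl

theorem mulInv_sub_toReal_add (hU : U.det ≠ 0) (x : Fin n → ℝ) (m t : Fin n → ℤ) :
    mulInv U (x - toReal n m) + toReal n t = mulInv U (x + toReal n (t ᵥ* U - m)) := by
  rw [← mulInv_toReal_vecMul hU t, ← mulInv_add, map_sub]
  congr 1
  abel

/-- Multiplying an integral difference by `U` shows `p_i - p_j ∈ M`, so `i = j`; then the two
representatives differ by an element of `MU`. -/
theorem sub_notMem_lattice (hU : U.det ≠ 0)
    (hrep : Function.Bijective fun r => (rep r : (Fin n → ℤ) ⧸ subLattice U))
    {p : ι → Fin n → ℝ} (hp : ∀ i j, i ≠ j → p i - p j ∉ lattice n) {q q' : ι × Fin g}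
    (hq : q ≠ q') :
    mulInv U (p q.1 - toReal n (rep q.2)) - mulInv U (p q'.1 - toReal n (rep q'.2)) ∉
      lattice n := by
  rintro ⟨a, ha⟩
  rw [← mulInv_toReal_vecMul hU, ← mulInv_sub] at ha
  have h := mulInv_injective hU ha
  have h1 : p q.1 - p q'.1 = toReal n (a ᵥ* U + rep q.2 - rep q'.2) := by
    rw [map_sub, map_add, h]
    abel
  have hij : q.1 = q'.1 := by
    by_contra hne
    exact hp _ _ hne ⟨_, h1.symm⟩
  rw [hij, sub_self] at h1
  have h2 := toReal_injective ((map_zero (toReal n)).trans h1)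
  refine hq (Prod.ext hij (eq_of_rep_sub_rep_mem hrep ⟨a, ?_⟩))
  change a ᵥ* U = _
  rw [← sub_eq_zero, h2]
  abel

theorem universalCover_down (hU : U.det ≠ 0)
    (hrep : Function.Bijective fun r => (rep r : (Fin n → ℤ) ⧸ subLattice U))
    (p : ι → Fin n → ℝ) (Γ : Set (Arrow ι n)) :
    (embeddedQuiver (fun q : ι × Fin g => mulInv U (p q.1 - toReal n (rep q.2)))
      (Arrow.down U rep ⁻¹' Γ)).universalCover =
      (embeddedQuiver p Γ).universalCover.map (mulInv U) := by
  -- The cosets `MU - m_s` exhaust `M`. So the translates of `p_j` by `M` correspond, under `U⁻¹`,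
  -- to the translates by `M` of all the points `p_{j,s}`.
  have hneg : ∀ t : Fin n → ℤ, ∃ (s : Fin g) (t' : Fin n → ℤ), t' ᵥ* U - rep s = t := by
    intro t
    obtain ⟨s, t', h⟩ := exists_eq_rep_add hrep (-t)
    exact ⟨s, -t', by rw [Matrix.neg_vecMul, ← neg_add', add_comm, h, neg_neg]⟩
  refine EmbeddedQuiver.ext (Set.ext fun x => ?_) (Set.ext fun a => ?_)
  · rw [mem_universalCover_verts]
    constructor
    · rintro ⟨q, t, rfl⟩
      exact ⟨_, mem_universalCover_verts.2 ⟨q.1, _, rfl⟩, (mulInv_sub_toReal_add hU _ _ _).symm⟩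
    · rintro ⟨_, hy, rfl⟩
      obtain ⟨i, t, rfl⟩ := mem_universalCover_verts.1 hy
      obtain ⟨s, t', rfl⟩ := hneg t
      exact ⟨(i, s), t', (mulInv_sub_toReal_add hU _ _ _).symm⟩
  · rw [mem_universalCover_arrows]
    have key : ∀ (γ : Arrow (ι × Fin g) n) (t : Fin n → ℤ),
        segmentPath (mulInv U (p γ.src.1 - toReal n (rep γ.src.2)) + toReal n γ.deg + toReal n t)
          (mulInv U (p γ.tgt.1 - toReal n (rep γ.tgt.2)) + toReal n t) =
        (mulInv U).comp (segmentPath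
          (p (γ.down U rep).src + toReal n (γ.down U rep).deg + toReal n (t ᵥ* U - rep γ.tgt.2))
          (p (γ.down U rep).tgt + toReal n (t ᵥ* U - rep γ.tgt.2))) := by
      intro γ t
      rw [mulInv_comp_segmentPath, add_assoc (mulInv U _), ← map_add, mulInv_sub_toReal_add hU,
        mulInv_sub_toReal_add hU, add_assoc, ← map_add]
      congr 4
      change (γ.deg + t) ᵥ* U - rep γ.src.2 =
        rep γ.tgt.2 + γ.deg ᵥ* U - rep γ.src.2 + (t ᵥ* U - rep γ.tgt.2)
      rw [Matrix.add_vecMul]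
      abel
    constructor
    · rintro ⟨γ, hγ, t, rfl⟩
      exact ⟨_, mem_universalCover_arrows.2 ⟨_, hγ, _, rfl⟩, (key γ t).symm⟩
    · rintro ⟨_, ha, rfl⟩
      obtain ⟨γ, hγ, t, rfl⟩ := mem_universalCover_arrows.1 ha
      obtain ⟨s, t', rfl⟩ := hneg t
      -- The translation fixes the coset `s` at the head. The coset `r` at the tail is then that of
      -- `rep s - γ.deg`, and `-e` is the degree for which `Arrow.down` returns `γ`.
      obtain ⟨r, e, hr⟩ := exists_eq_rep_add hrep (rep s - γ.deg)
      have hdown : Arrow.down U rep (⟨(γ.src, r), (γ.tgt, s), -e⟩ : Arrow (ι × Fin g) n) = γ := by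
        rw [Arrow.down]
        obtain ⟨i, j, d⟩ := γ
        congr 1
        simp only at hr ⊢
        rw [Matrix.neg_vecMul, eq_sub_of_add_eq' hr]
        abel
      refine ⟨⟨(γ.src, r), (γ.tgt, s), -e⟩, ?_, t', ?_⟩
      · rw [Set.mem_preimage, hdown]
        exact hγ
      · rw [key, hdown]

end MulInv

/-! ### The standard choice of points -/

section Kappa

variable {n k : ℕ} {v : Fin k → Fin n → ℤ} {U : Matrix (Fin n) (Fin n) ℤ}

/-- The matrix whose columns are the generators. -/
def genMatrix (v : Fin k → Fin n → ℤ) : Matrix (Fin n) (Fin k) ℝ :=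
  Matrix.of fun a i => (v i a : ℝ)

theorem kappa_eq (v : Fin k → Fin n → ℤ) (b : Fin k → ℤ) :
    kappa v b = (genMatrix v * (genMatrix v)ᵀ)⁻¹ *ᵥ (genMatrix v *ᵥ fun i => (b i : ℝ)) := rfl

theorem genMatrix_newGens :
    genMatrix (newGens U v) = U.map (fun z : ℤ => (z : ℝ)) * genMatrix v := by
  ext a i
  simp [genMatrix, newGens, Matrix.mul_apply, Matrix.mulVec, dotProduct]

/-- If `φφᵀx = 0` then `φᵀx` has norm zero, so `x` is orthogonal to all generators, which span. -/
theorem isUnit_det_genMatrix_mul_transpose (hv : IsConeGenerators v) :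
    IsUnit (genMatrix v * (genMatrix v)ᵀ).det := by
  rw [isUnit_iff_ne_zero]
  intro h
  obtain ⟨x, hx0, hx⟩ := Matrix.exists_mulVec_eq_zero_iff.2 h
  have h1 : (genMatrix v)ᵀ *ᵥ x = 0 := by
    rw [← dotProduct_self_eq_zero, Matrix.mulVec_transpose, ← Matrix.dotProduct_mulVec,
      ← Matrix.mulVec_transpose, Matrix.mulVec_mulVec, hx, dotProduct_zero]
  have key : ∀ y ∈ Submodule.span ℝ (Set.range fun i => (fun a => (v i a : ℝ))), y ⬝ᵥ x = 0 := by
    intro y hy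
    induction hy using Submodule.span_induction with
    | mem y hy =>
      obtain ⟨i, rfl⟩ := hy
      exact congrFun h1 i
    | zero => exact zero_dotProduct x
    | add y z _ _ hy hz => rw [add_dotProduct, hy, hz, add_zero]
    | smul c y _ hy => rw [smul_dotProduct, hy, smul_zero]
  exact hx0 (dotProduct_self_eq_zero.1 (key x (by rw [hv.full_dim]; trivial)))

/-- As `φ_U = Uφ`, the matrix `(φ_U φ_Uᵀ)⁻¹ φ_U` equals `(Uᵀ)⁻¹ (φφᵀ)⁻¹ φ`. The shift of `b` is
`φᵀμ`, which `(φφᵀ)⁻¹ φ` sends to `μ`. -/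
theorem kappa_newGens (hv : IsConeGenerators v) (hU : U.det ≠ 0) (b : Fin k → ℤ)
    (μ : Fin n → ℤ) :
    kappa (newGens U v) (fun i => b i - μ ⬝ᵥ v i) = mulInv U (kappa v b - toReal n μ) := by
  have hb : (fun i => ((b i - μ ⬝ᵥ v i : ℤ) : ℝ)) =
      (fun i => (b i : ℝ)) - (genMatrix v)ᵀ *ᵥ toReal n μ := by
    funext i
    simp [genMatrix, Matrix.mulVec, dotProduct, toReal, mul_comm]
  have hW := (det_map_intCast_ne_zero hU).isUnit
  have hφ := isUnit_det_genMatrix_mul_transpose hv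
  rw [kappa_eq, kappa_eq, hb, genMatrix_newGens, mulInv_apply, ← Matrix.mulVec_transpose]
  generalize U.map (fun z : ℤ => (z : ℝ)) = W at hW
  generalize genMatrix v = φ at hφ
  have h1 : (Wᵀ)⁻¹ * (φ * φᵀ)⁻¹ * (W⁻¹ * (W * φ)) = (Wᵀ)⁻¹ * ((φ * φᵀ)⁻¹ * φ) := by
    rw [← Matrix.mul_assoc W⁻¹, Matrix.nonsing_inv_mul _ hW, Matrix.one_mul, Matrix.mul_assoc]
  have h2 : (φ * φᵀ)⁻¹ * φ * φᵀ = 1 := by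
    rw [Matrix.mul_assoc, Matrix.nonsing_inv_mul _ hφ]
  rw [Matrix.transpose_mul, Matrix.mul_assoc W, ← Matrix.mul_assoc φ, Matrix.mul_inv_rev,
    Matrix.mul_inv_rev, Matrix.mulVec_mulVec, Matrix.mul_assoc _ W⁻¹ _, h1,
    ← Matrix.mulVec_mulVec, Matrix.mulVec_sub, Matrix.mulVec_mulVec, h2, Matrix.one_mulVec,
    ← Matrix.mulVec_mulVec, Matrix.transpose_nonsing_inv]

end Kappa

end ToricQuotient

open ToricQuotient in
theorem mainTheorem11 {n k ℓ g : ℕ}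
    (v : Fin k → Fin n → ℤ) (hv : IsConeGenerators v)
    (U : Matrix (Fin n) (Fin n) ℤ) (hU : U.det ≠ 0) (hUv : ∀ i, IsPrimitive (U *ᵥ v i))
    (rep : Fin g → Fin n → ℤ)
    (hrep : Function.Bijective fun r => (rep r : (Fin n → ℤ) ⧸ subLattice U))
    (L : Fin ℓ → GradedSubmodule v) (hL : ∀ j, (L j).IsRankOneReflexive) :
    (∃ Φ : SkewGroupRing L U ≃+* Module.End (invariantRing v U) (DirSum L),
      ∀ (ρ : quotGroup U) (f : Module.End (toricRing v) (DirSum L)) (t : DirSum L),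
        Φ (SkewMonoidAlgebra.single ρ f) t = f (sumAct L ρ t)) ∧
    (IsNCCR (toricRing v) (Module.End (toricRing v) (DirSum L)) →
      IsNCCR (invariantRing v U) (Module.End (invariantRing v U) (DirSum L))) ∧
    (IsConeGenerators (newGens U v) ∧
      (∀ j r, (piece U (rep r) (L j)).IsRankOneReflexive) ∧
      ∃ (θ : toricRing (newGens U v) ≃ₐ[ℂ] invariantRing v U)
        (Θ : DirSum (fun q : Fin ℓ × Fin g => piece U (rep q.2) (L q.1)) ≃+ DirSum L),
        (∀ f, ((θ f : toricRing v) : Laurent n) = subst U (f : Laurent n)) ∧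
        (∀ f s, Θ (f • s) = θ f • Θ s) ∧
        (∀ s j, (Θ s j : Laurent n) =
          ∑ r, mono (rep r) * subst U (s (j, r) : Laurent n))) ∧
    (∀ (p : Fin ℓ → Fin n → ℝ) (Γ : Set (Arrow (Fin ℓ) n)), IsQuiverFor L p Γ →
      ∃ Γ' : Set (Arrow (Fin ℓ × Fin g) n),
        IsQuiverFor (fun q : Fin ℓ × Fin g => piece U (rep q.2) (L q.1))
          (fun q => mulInv U (p q.1 - toReal n (rep q.2))) Γ' ∧
        (Minimal (Generates L) Γ →
          Minimal (Generates fun q : Fin ℓ × Fin g => piece U (rep q.2) (L q.1)) Γ') ∧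
        (embeddedQuiver (fun q : Fin ℓ × Fin g => mulInv U (p q.1 - toReal n (rep q.2)))
          Γ').universalCover = (embeddedQuiver p Γ).universalCover.map (mulInv U)) ∧
    (∀ (b : Fin k → ℤ) (j : Fin ℓ) (r : Fin g), L j = reflexiveOf v b →
      piece U (rep r) (L j) = reflexiveOf (newGens U v) (fun i => b i - rep r ⬝ᵥ v i) ∧
      kappa (newGens U v) (fun i => b i - rep r ⬝ᵥ v i) =
        mulInv U (kappa v b - toReal n (rep r))) := by
  classical
  have hv' := hv.newGens hU hUv
  -- From here on every summand is some `T(b j)`, so all claims become statements on degrees.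
  choose b hb using fun j => (hL j).exists_eq_reflexiveOf hv
  obtain rfl : L = sumOf v b := funext hb
  have hpiece := piece_sumOf (v := v) U rep b
  obtain ⟨θ, hθ⟩ := exists_toricRing_equiv v hU hrep
  obtain ⟨Θ, hΘ, hΘ'⟩ := exists_dirSum_piece_equiv (sumOf v b) hU hrep θ hθ
  refine ⟨⟨RingEquiv.ofBijective (skewHom (sumOf v b) U)
      ⟨skewHom_injective hv hv' hrep, skewHom_surjective hv' hrep⟩,
      fun ρ f t => skewHom_single_apply (sumOf v b) ρ f t⟩,
    isNCCR_invariantRing hv hv' hU hrep,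
    ⟨hv', fun j r => ?_, θ, Θ, hθ, hΘ, hΘ'⟩, fun p Γ h => ?_, fun c j r hj => ?_⟩
  · rw [sumOf, piece_reflexiveOf]
    exact isRankOneReflexive_reflexiveOf hv' _
  · have hiso := hasNoIsos_of_nonisomorphic hv h.nonisomorphic
    refine ⟨Arrow.down U rep ⁻¹' Γ, ⟨?_, fun q q' => sub_notMem_lattice hU hrep h.distinct, ?_⟩,
      ?_, universalCover_down hU hrep p Γ⟩
    · refine fun q q' hq => ⟨fun e => hq ?_⟩
      have e' : (sumOf (newGens U v) (liftDeg v rep b) q).toSubmodule ≃ₗ[toricRing (newGens U v)]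
          (sumOf (newGens U v) (liftDeg v rep b) q').toSubmodule := by
        change _ = sumOf (newGens U v) (liftDeg v rep b) at hpiece
        rw [← hpiece]
        exact e
      obtain ⟨m, m', hm, hm', hmm⟩ := exists_isHomDeg_of_equiv hv' e'
      exact (hiso.liftDeg hU hrep q q' m m' hm hm' hmm).1
    · rw [hpiece]
      exact generates_down hv hv' hU hrep h.generates
    · rw [hpiece]
      exact minimal_generates_down hv hv' hU hrep hiso
  · rw [hj]
    exact ⟨piece_reflexiveOf U (rep r) c, kappa_newGens hv hU c (rep r)⟩
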